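/- Let $p, q, s$ be three distinct prime numbers with $p\equiv -s\equiv 5 \pmod 8$, $q\equiv 7\pmod 8$ and Legendre symbols $\left(\frac{p}{q}\right)=\left(\frac{p}{s}\right)=\left(\frac{s}{q}\right)=-1$. Let $\ell\ge 1$ be an odd square-free integer relatively prime to $p$, $q$ and $s$. Put $L^+=\mathbb{Q}(\sqrt2,\sqrt{pq},\sqrt{ps})$ and $L=\mathbb{Q}(\sqrt2,\sqrt{pq},\sqrt{ps},\sqrt{-\ell})$, regarded as subfields of $\mathbb{C}$. For a number field $K$ let $E_K$ be the group of units of its ring of integers; for a square-free integer $m>1$ let $\varepsilon_m>1$ be the fundamental unit of $\mathbb{Q}(\sqrt m)$; let $\zeta_n=e^{2\pi i/n}$; and let $\langle\cdots\rangle$ denote the multiplicative subgroup of $\mathbb{C}^\times$ generated by the listed numbers. Square roots of positive real numbers are the positive ones, and the other square roots are principal ones. 1. $E_{L^+}=\left\langle -1,\ \varepsilon_2,\ \varepsilon_{pq},\ \sqrt{\varepsilon_{pq}\varepsilon_{2pq}},\ \sqrt{\varepsilon_{ps}\varepsilon_{2ps}},\ \sqrt{\varepsilon_{qs}\varepsilon_{2qs}},\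 \sqrt{\varepsilon_{pq}\varepsilon_{ps}},\ \sqrt{\varepsilon_{pq}\varepsilon_{qs}}\right\rangle$. 2. If $\ell=1$, put $\beta_b=\sqrt{\zeta_8\,\varepsilon_{pq}^{\,b}\sqrt{\varepsilon_{pq}\varepsilon_{2pq}}\sqrt{\varepsilon_{qs}\varepsilon_{2qs}}}$ for $b\in\{0,1\}$. Then $E_L$ is equal to one of the following four groups: - $\langle\zeta_8\rangle\cdot E_{L^+}$; - $\left\langle \zeta_8,\ \varepsilon_2,\ \varepsilon_{pq},\ \sqrt{\varepsilon_{pq}\varepsilon_{2pq}},\ \sqrt{\varepsilon_{ps}\varepsilon_{2ps}},\ \sqrt{\varepsilon_{pq}\varepsilon_{ps}},\ \sqrt{\varepsilon_{pq}\varepsilon_{qs}},\ \beta_1\right\rangle$; - $\left\langle \zeta_8,\ \varepsilon_2,\ \varepsilon_{pq},\ \sqrt{\varepsilon_{pq}\varepsilon_{2pq}},\ \sqrt{\varepsilon_{ps}\varepsilon_{2ps}},\ \sqrt{\varepsilon_{pq}\varepsilon_{ps}},\ \sqrt{\varepsilon_{pq}\varepsilon_{qs}},\ \beta_0\right\rangle$;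 - $\left\langle \zeta_8,\ \varepsilon_2,\ \sqrt{\varepsilon_{pq}\varepsilon_{2pq}},\ \sqrt{\varepsilon_{ps}\varepsilon_{2ps}},\ \sqrt{\varepsilon_{pq}\varepsilon_{ps}},\ \sqrt{\varepsilon_{pq}\varepsilon_{qs}},\ \beta_0,\ \beta_1\right\rangle$. 3. If $\ell\ne1$, then $E_L=\left\langle \eta,\ \varepsilon_2,\ \varepsilon_{pq},\ \sqrt{\varepsilon_{pq}\varepsilon_{2pq}},\ \sqrt{\varepsilon_{ps}\varepsilon_{2ps}},\ \sqrt{\varepsilon_{qs}\varepsilon_{2qs}},\ \sqrt{\varepsilon_{pq}\varepsilon_{ps}},\ \sqrt{\varepsilon_{pq}\varepsilon_{qs}}\right\rangle$, where $\eta=\zeta_6$ if $\ell=3$ and $\eta=-1$ otherwise. -/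

import Mathlib

open scoped NumberField

noncomputable section

namespace MultiquadraticUnits

/-- The unit group `E_K` of the ring of integers of a subfield `K` of `ℂ`,
as a subgroup of `ℂˣ`. -/
def unitGroup (K : IntermediateField ℚ ℂ) : Subgroup ℂˣ :=
  (Units.map ((algebraMap K ℂ).comp (algebraMap (𝓞 K) K)).toMonoidHom).range

/-- The quadratic field `ℚ(√m)`. -/
def quadField (m : ℕ) : IntermediateField ℚ ℂ :=
  IntermediateField.adjoin ℚ {((√(m : ℝ) : ℝ) : ℂ)}

/-- The fundamental unit `ε_m` of the real quadratic field `ℚ(√m)`: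
the least unit of its ring of integers that is greater than `1`. -/
def fundUnit (m : ℕ) : ℝ :=
  sInf {x : ℝ | 1 < x ∧ ∃ u ∈ unitGroup (quadField m), (u : ℂ) = (x : ℂ)}

/-- `√(ε_m ε_n)`, the positive square root. -/
def sqrtUnits (m n : ℕ) : ℝ := √(fundUnit m * fundUnit n)

/-- `ℚ(√2, √(pq), √(ps))`. -/
def fieldLplus (p q s : ℕ) : IntermediateField ℚ ℂ :=
  IntermediateField.adjoin ℚ
    {((√(2 : ℝ) : ℝ) : ℂ), ((√((p * q : ℕ) : ℝ) : ℝ) : ℂ), ((√((p * s : ℕ) : ℝ) : ℝ) : ℂ)}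

/-- `ℚ(√2, √(pq), √(ps), √(-ℓ))`, where `√(-ℓ) = i √ℓ`. -/
def fieldL (p q s ℓ : ℕ) : IntermediateField ℚ ℂ :=
  IntermediateField.adjoin ℚ
    {((√(2 : ℝ) : ℝ) : ℂ), ((√((p * q : ℕ) : ℝ) : ℝ) : ℂ), ((√((p * s : ℕ) : ℝ) : ℝ) : ℂ),
      Complex.I * ((√(ℓ : ℝ) : ℝ) : ℂ)}

/-- The primitive `n`-th root of unity `exp(2πi/n)`. -/
def zeta (n : ℕ) : ℂ := Complex.exp (2 * Real.pi * Complex.I / n)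

/-- The multiplicative group generated by a set of nonzero complex numbers. -/
def gen (S : Set ℂ) : Subgroup ℂˣ := Subgroup.closure (Units.val ⁻¹' S)

/-- A generator of the group of roots of unity of `ℚ(√2, √(pq), √(ps), √(-ℓ))` for `ℓ ≠ 1`. -/
def eta (ℓ : ℕ) : ℂ := if ℓ = 3 then zeta 6 else -1

/-- `√(ζ₈ ε_{pq}^b √(ε_{pq} ε_{2pq}) √(ε_{qs} ε_{2qs}))`, the principal square root. -/
def mixedRoot (p q s b : ℕ) : ℂ :=
  Complex.sqrt (zeta 8 * (fundUnit (p * q) : ℂ) ^ b * (sqrtUnits (p * q) (2 * p * q) : ℂ) *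
    (sqrtUnits (q * s) (2 * q * s) : ℂ))

end MultiquadraticUnits

end

/-! ### Endomorphisms of ℂ with prescribed signs on square roots -/

namespace MultiquadraticUnits

open Cardinal

/-! The real field L⁺ has Galois group (ℤ/2)³ and seven quadratic subfields ℚ(√m), with m = 2, pq,
2pq, ps, 2ps, qs, 2qs. The product of the norms of a unit x to these subfields is ±x⁴
(`prod_normUnder`), so x⁴ is, up to sign, a product of powers of the ε_m. What remains is to extract
a fourth root.

For m ≠ 2 a prime congruent to 3 modulo 4 divides m, so ε_m has norm 1. If T is its trace, the
squarefree parts d and d' of T + 2 and T - 2 give √ε_m = (x√d + y√d')/2 with dd' equal to m or 4m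
(`exists_sqrt_fundUnit_eq`). Legendre symbols leave a single pair (d, d') for each of the six m.
Hence a sign change of √2, √p, √q or √s sends √ε_m to ±√ε_m or ±1/√ε_m, with a known sign. All six
√ε_m lie in √p·L⁺ and none lies in L⁺, so a monomial in ε_2 and the √ε_m lies in L⁺ exactly when the
exponents of the √ε_m have even sum. The unit ε_2 has norm -1 and enters with integral exponent.

Suppose X ∈ L⁺ and X² = δ·(monomial) with δ a positive real number in ℚ(√2). The conjugates of X are
real, and products X·σ(X) are known up to sign; comparing signs gives seven parity conditions on the
exponents (`parity_of_sq_eq`). With δ = 1 they force all exponents to be even, so every unit of L⁺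
is ± a monomial (`exists_eq_unitMonomial`). This is statement 1.

For a unit u of L the quotient u/ū has absolute value 1 in every embedding, hence is a root of
unity; its order divides 24 because automorphisms act on L as involutions. If ℓ ≠ 1 the order
divides 6, and a power of η makes u real or purely imaginary. The second case would put √ℓ times a
monomial in L⁺, which a sign change of √ℓ forbids. If ℓ = 1, a power of ζ₈ reduces to u real or u =
ζ₈ū. In the latter case (1 + ζ₈)² = ζ₈(2 + √2) leads back to the parity conditions with δ = 2 + √2,
and they show that u is ±β₀ or ±β₁ times a unit of L⁺ (`exists_isUnitIn_mixedRoot`).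

Automorphisms are replaced throughout by ring endomorphisms of ℂ, which apply equally to the √ε_m
outside L⁺. -/

theorem exists_ringHom_of_isAlgClosed {R K L : Type} [Field R] [Countable R] [Field K] [Field L]
    [Algebra R K] [Algebra R L] [IsAlgClosed K] [IsAlgClosed L]
    (hK : ℵ₀ < #K) (hKL : #K = #L) :
    ∃ φ : K →+* L, ∀ r : R, φ (algebraMap R K r) = algebraMap R L r := by
  obtain ⟨s, hs⟩ := exists_isTranscendenceBasis R K
  obtain ⟨t, ht⟩ := exists_isTranscendenceBasis R L
  have hR : #R ≤ ℵ₀ := Cardinal.mk_le_aleph0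
  have hst : #s = #t := by
    rw [← IsAlgClosed.cardinal_eq_cardinal_transcendence_basis_of_aleph0_lt' _ hs hR hK,
      ← IsAlgClosed.cardinal_eq_cardinal_transcendence_basis_of_aleph0_lt' _ ht hR (hKL ▸ hK), hKL]
  obtain ⟨e⟩ := Cardinal.eq.1 hst
  let _ := IsAlgClosed.isAlgClosure_of_transcendence_basis _ hs
  let _ := IsAlgClosed.isAlgClosure_of_transcendence_basis _ ht
  let f : Algebra.adjoin R (Set.range ((↑) : s → K)) ≃ₐ[R]
      Algebra.adjoin R (Set.range ((↑) : t → L)) :=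
    hs.1.aevalEquiv.symm.trans ((MvPolynomial.renameEquiv R e).trans ht.1.aevalEquiv)
  refine ⟨(IsAlgClosure.equivOfEquiv K L f.toRingEquiv).toRingHom, fun r => ?_⟩
  have h := IsAlgClosure.equivOfEquiv_algebraMap K L f.toRingEquiv
    (algebraMap R (Algebra.adjoin R (Set.range ((↑) : s → K))) r)
  have h2 : f.toRingEquiv (algebraMap R _ r) = algebraMap R _ r := f.commutes r
  rw [h2] at h
  simpa [← IsScalarTower.algebraMap_apply] using h

/-- An embedding of a number field in `ℂ` extends to an endomorphism of `ℂ`. -/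
theorem exists_ringHom_extending {K : IntermediateField ℚ ℂ} [FiniteDimensional ℚ K]
    (φ : K →+* ℂ) : ∃ σ : ℂ →+* ℂ, ∀ y : K, σ y = φ y := by
  have : Countable K := by
    have h := Algebra.IsAlgebraic.cardinalMk_le_max ℚ K
    rw [← Cardinal.mk_le_aleph0_iff]
    simpa using h
  exact @exists_ringHom_of_isAlgClosed K ℂ ℂ _ _ _ _ _ φ.toAlgebra _ _
    (by rw [Cardinal.mk_complex]; exact Cardinal.aleph0_lt_continuum) rfl

theorem exists_ringHom_of_aeval_minpoly_eq_zero {z w : ℂ} (hz : IsIntegral ℚ z)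
    (hw : Polynomial.aeval w (minpoly ℚ z) = 0) : ∃ σ : ℂ →+* ℂ, σ z = w := by
  let f : IntermediateField.adjoin ℚ {z} →ₐ[ℚ] ℂ :=
    (IntermediateField.adjoin.powerBasis hz).lift w (by
      rw [IntermediateField.adjoin.powerBasis_gen, IntermediateField.minpoly_gen]; exact hw)
  have hf : f (IntermediateField.AdjoinSimple.gen ℚ z) = w := by
    rw [← IntermediateField.adjoin.powerBasis_gen hz]
    exact (IntermediateField.adjoin.powerBasis hz).lift_gen w _
  have : FiniteDimensional ℚ (IntermediateField.adjoin ℚ {z}) :=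
    IntermediateField.adjoin.finiteDimensional hz
  obtain ⟨σ, hσ⟩ := exists_ringHom_extending f.toRingHom
  exact ⟨σ, (hσ (IntermediateField.AdjoinSimple.gen ℚ z)).trans hf⟩

theorem exists_ringHom_neg_of_sq_eq {z : ℂ} {d : ℚ} (hz : z ^ 2 = d) (hd : ¬ IsSquare d) :
    ∃ σ : ℂ →+* ℂ, σ z = -z := by
  have hirr : Irreducible (Polynomial.X ^ 2 - Polynomial.C d) := by
    apply X_pow_sub_C_irreducible_of_prime Nat.prime_two
    rintro b rfl
    exact hd ⟨b, sq b⟩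
  have hz0 : Polynomial.aeval z (Polynomial.X ^ 2 - Polynomial.C d) = 0 := by simp [hz]
  have hmin := minpoly.eq_of_irreducible_of_monic hirr hz0 (Polynomial.monic_X_pow_sub_C d two_ne_zero)
  have hint : IsIntegral ℚ z :=
    ⟨_, Polynomial.monic_X_pow_sub_C d two_ne_zero, by simpa using hz0⟩
  apply exists_ringHom_of_aeval_minpoly_eq_zero hint
  rw [← hmin]
  simp [hz]

/-- Ring endomorphisms of `ℂ` realise every choice of signs on a family of square roots of
rational numbers that is independent modulo squares. -/
theorem exists_ringHom_signs {ι : Type} [Fintype ι] [DecidableEq ι] (r : ι → ℂ) (d : ι → ℚ)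
    (hr : ∀ i, r i ^ 2 = d i) (hd : ∀ S : Finset ι, S.Nonempty → ¬ IsSquare (∏ i ∈ S, d i))
    (T : Finset ι) :
    ∃ σ : ℂ →+* ℂ, (∀ i ∈ T, σ (r i) = - r i) ∧ ∀ i ∉ T, σ (r i) = r i := by
  have hr0 : ∀ i, r i ≠ 0 := by
    intro i h
    refine hd {i} (Finset.singleton_nonempty i) ?_
    have h0 : (d i : ℂ) = 0 := by rw [← hr i, h]; simp
    have h0 : d i = 0 := by exact_mod_cast h0
    simp [h0]
  have hpm : ∀ (σ : ℂ →+* ℂ) i, σ (r i) = r i ∨ σ (r i) = - r i := by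
    intro σ i
    apply sq_eq_sq_iff_eq_or_eq_neg.1
    rw [← map_pow, hr]; simp
  have hne : ∀ i, r i ≠ - r i := fun i h => hr0 i (self_eq_neg.1 h)
  classical
  let χ : (ℂ →+* ℂ) → ι → ZMod 2 := fun σ i => if σ (r i) = r i then 0 else 1
  -- The attainable sign patterns form a subspace of 𝔽₂^ι. If it were proper, a nonzero functional v
  -- ↦ ∑_{i ∈ S} v i would vanish on it; but some endomorphism negates ∏_{i ∈ S} r i, since its
  -- square is a nonsquare rational number.
  let V : Submodule (ZMod 2) (ι → ZMod 2) :=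
    { carrier := Set.range χ
      zero_mem' := ⟨RingHom.id ℂ, by ext i; simp [χ]⟩
      add_mem' := by
        rintro _ _ ⟨σ, rfl⟩ ⟨τ, rfl⟩
        refine ⟨σ.comp τ, ?_⟩
        ext i
        rcases hpm σ i with h1 | h1 <;> rcases hpm τ i with h2 | h2 <;>
          simp [χ, h1, h2, (hne i).symm, show (1 : ZMod 2) + 1 = 0 from rfl]
      smul_mem' := by
        rintro c _ ⟨σ, rfl⟩
        obtain rfl | rfl : c = 0 ∨ c = 1 := by revert c; decide
        · exact ⟨RingHom.id ℂ, by ext i; simp [χ]⟩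
        · exact ⟨σ, by simp⟩ }
  have hV : V = ⊤ := by
    by_contra hV
    obtain ⟨f, hf0, hf⟩ := Submodule.exists_le_ker_of_lt_top V (lt_top_iff_ne_top.2 hV)
    let S : Finset ι := Finset.univ.filter fun i => f (Pi.single i 1) ≠ 0
    have hfsum : ∀ v, f v = ∑ i ∈ S, v i := by
      intro v
      conv_lhs => rw [← Finset.univ_sum_single v]
      rw [map_sum, Finset.sum_filter]
      refine Finset.sum_congr rfl fun i _ => ?_
      have : (Pi.single i (v i) : ι → ZMod 2) = v i • Pi.single i 1 := by
        rw [← Pi.single_smul]; simp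
      rw [this, map_smul, smul_eq_mul]
      have h01 : ∀ c : ZMod 2, c ≠ 0 → c = 1 := by decide
      split_ifs with h
      · rw [h01 _ h, mul_one]
      · rw [not_not.1 h, mul_zero]
    have hS : S.Nonempty := by
      rw [Finset.nonempty_iff_ne_empty]
      rintro h
      apply hf0
      ext v
      simp [hfsum, h]
    obtain ⟨σ, hσ⟩ := exists_ringHom_neg_of_sq_eq (z := ∏ i ∈ S, r i) (d := ∏ i ∈ S, d i)
      (by rw [← Finset.prod_pow]; push_cast; exact Finset.prod_congr rfl fun i _ => hr i) (hd S hS)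
    have hker : f (χ σ) = 0 := hf ⟨σ, rfl⟩
    have key : ∀ U : Finset ι, (σ (∏ i ∈ U, r i) = ∏ i ∈ U, r i ∧ ∑ i ∈ U, χ σ i = 0) ∨
        (σ (∏ i ∈ U, r i) = -∏ i ∈ U, r i ∧ ∑ i ∈ U, χ σ i = 1) := by
      intro U
      induction U using Finset.induction_on with
      | empty => simp
      | insert a U ha ih =>
        rw [Finset.prod_insert ha, Finset.sum_insert ha, map_mul]
        rcases ih with ⟨h1, h2⟩ | ⟨h1, h2⟩ <;> rcases hpm σ a with h | h <;>
          simp [h1, h2, h, χ, (hne a).symm, show (1 : ZMod 2) + 1 = 0 from rfl]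
    rw [hfsum] at hker
    rcases key S with ⟨h, -⟩ | ⟨-, h⟩
    · rw [hσ] at h
      exact Finset.prod_ne_zero_iff.2 (fun i _ => hr0 i) (self_eq_neg.1 h.symm)
    · rw [hker] at h; exact zero_ne_one h
  obtain ⟨σ, hσ⟩ : (fun i => if i ∈ T then (1 : ZMod 2) else 0) ∈ V := hV ▸ Submodule.mem_top
  refine ⟨σ, fun i hi => ?_, fun i hi => ?_⟩
  · have := congrFun hσ i
    rcases hpm σ i with h | h
    · simp [χ, h, hi] at this
    · exact h
  · have := congrFun hσ i
    rcases hpm σ i with h | h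
    · exact h
    · simp [χ, h, hi, (hne i).symm] at this

end MultiquadraticUnits

/-! ### Units as complex numbers, and quadratic extensions -/

namespace MultiquadraticUnits

theorem mem_unitGroup_iff {K : IntermediateField ℚ ℂ} {u : ℂˣ} :
    u ∈ unitGroup K ↔ (u : ℂ) ∈ K ∧ IsIntegral ℤ (u : ℂ) ∧ IsIntegral ℤ ((u : ℂ)⁻¹) := by
  constructor
  · rintro ⟨v, rfl⟩
    refine ⟨((v : 𝓞 K) : K).2, ?_, ?_⟩
    · exact ((v : 𝓞 K).isIntegral_coe).map (algebraMap K ℂ).toIntAlgHom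
    · rw [← Units.val_inv_eq_inv_val, ← map_inv]
      exact (((v⁻¹ : (𝓞 K)ˣ) : 𝓞 K).isIntegral_coe).map (algebraMap K ℂ).toIntAlgHom
  · rintro ⟨hK, h1, h2⟩
    have hinj : Function.Injective (algebraMap K ℂ) := (algebraMap K ℂ).injective
    let a : K := ⟨u, hK⟩
    let b : K := ⟨(u : ℂ)⁻¹, K.inv_mem hK⟩
    have ha : IsIntegral ℤ a := (isIntegral_algHom_iff (algebraMap K ℂ).toIntAlgHom hinj).1 h1
    have hb : IsIntegral ℤ b := (isIntegral_algHom_iff (algebraMap K ℂ).toIntAlgHom hinj).1 h2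
    have hab : a * b = 1 := Subtype.ext (by simp [a, b])
    refine ⟨⟨⟨a, ha⟩, ⟨b, hb⟩, ?_, ?_⟩, ?_⟩
    · apply NumberField.RingOfIntegers.ext; exact hab
    · apply NumberField.RingOfIntegers.ext; rw [mul_comm] at hab; exact hab
    · apply Units.ext; rfl

/-- `z` is a unit of the ring of integers of `K`. -/
def IsUnitIn (K : IntermediateField ℚ ℂ) (z : ℂ) : Prop :=
  z ≠ 0 ∧ z ∈ K ∧ IsIntegral ℤ z ∧ IsIntegral ℤ z⁻¹

namespace IsUnitIn

variable {K : IntermediateField ℚ ℂ} {z w : ℂ}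

theorem one : IsUnitIn K 1 :=
  ⟨one_ne_zero, K.one_mem, isIntegral_one, by simpa using isIntegral_one⟩

theorem mul (hz : IsUnitIn K z) (hw : IsUnitIn K w) : IsUnitIn K (z * w) :=
  ⟨mul_ne_zero hz.1 hw.1, K.mul_mem hz.2.1 hw.2.1, hz.2.2.1.mul hw.2.2.1, by
    rw [mul_inv]; exact hz.2.2.2.mul hw.2.2.2⟩

theorem inv (hz : IsUnitIn K z) : IsUnitIn K z⁻¹ :=
  ⟨inv_ne_zero hz.1, K.inv_mem hz.2.1, hz.2.2.2, by rw [inv_inv]; exact hz.2.2.1⟩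

theorem div (hz : IsUnitIn K z) (hw : IsUnitIn K w) : IsUnitIn K (z / w) := by
  rw [div_eq_mul_inv]; exact hz.mul hw.inv

theorem neg (hz : IsUnitIn K z) : IsUnitIn K (-z) :=
  ⟨neg_ne_zero.2 hz.1, K.neg_mem hz.2.1, hz.2.2.1.neg, by
    rw [inv_neg]; exact hz.2.2.2.neg⟩

theorem pow (hz : IsUnitIn K z) (n : ℕ) : IsUnitIn K (z ^ n) := by
  induction n with
  | zero => simpa using one
  | succ n ih => rw [pow_succ]; exact ih.mul hz

theorem zpow (hz : IsUnitIn K z) (n : ℤ) : IsUnitIn K (z ^ n) := by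
  cases n with
  | ofNat n => simpa using hz.pow n
  | negSucc n => rw [zpow_negSucc]; exact (hz.pow _).inv

theorem mono {K' : IntermediateField ℚ ℂ} (h : K ≤ K') (hz : IsUnitIn K z) : IsUnitIn K' z :=
  ⟨hz.1, h hz.2.1, hz.2.2⟩

/-- A nonzero element of `K` some power of which is a unit is a unit. -/
theorem of_pow {n : ℕ} (hn : 0 < n) (hz : z ∈ K) (h : IsUnitIn K (z ^ n)) : IsUnitIn K z :=
  ⟨fun h0 => h.1 (by rw [h0, zero_pow hn.ne']), hz, h.2.2.1.of_pow hn,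
    IsIntegral.of_pow hn (by rw [inv_pow]; exact h.2.2.2)⟩

end IsUnitIn

theorem mem_unitGroup_iff_isUnitIn {K : IntermediateField ℚ ℂ} {u : ℂˣ} :
    u ∈ unitGroup K ↔ IsUnitIn K u := by
  rw [mem_unitGroup_iff, IsUnitIn]
  simp

theorem mem_gen {S : Set ℂ} {u : ℂˣ} (h : (u : ℂ) ∈ S) : u ∈ gen S :=
  Subgroup.subset_closure h

theorem gen_le_iff {S : Set ℂ} {H : Subgroup ℂˣ} :
    gen S ≤ H ↔ ∀ u : ℂˣ, (u : ℂ) ∈ S → u ∈ H := Subgroup.closure_le H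

/-- Elements of `F(θ)` for `θ² ∈ F`. -/
theorem exists_eq_add_mul_of_mem_adjoin_insert {S : Set ℂ} {θ y : ℂ}
    (hθ : θ ^ 2 ∈ IntermediateField.adjoin ℚ S)
    (hy : y ∈ IntermediateField.adjoin ℚ (insert θ S)) :
    ∃ a ∈ IntermediateField.adjoin ℚ S, ∃ b ∈ IntermediateField.adjoin ℚ S, y = a + b * θ := by
  set K := IntermediateField.adjoin ℚ S with hK
  induction hy using IntermediateField.adjoin_induction with
  | mem x hx =>
    rcases hx with rfl | hx
    · exact ⟨0, K.zero_mem, 1, K.one_mem, by ring⟩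
    · exact ⟨x, IntermediateField.subset_adjoin _ _ hx, 0, K.zero_mem, by ring⟩
  | algebraMap x => exact ⟨_, K.algebraMap_mem x, 0, K.zero_mem, by ring⟩
  | add x y _ _ hx hy =>
    obtain ⟨a, ha, b, hb, rfl⟩ := hx
    obtain ⟨c, hc, d, hd, rfl⟩ := hy
    exact ⟨_, K.add_mem ha hc, _, K.add_mem hb hd, by ring⟩
  | inv x _ hx =>
    obtain ⟨a, ha, b, hb, rfl⟩ := hx
    by_cases h0 : a + b * θ = 0
    · exact ⟨0, K.zero_mem, 0, K.zero_mem, by simp [h0]⟩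
    -- θ may already lie in the base field, so the conjugate a - bθ can vanish while a + bθ does
    -- not; then a + bθ = 2a.
    by_cases h1 : a - b * θ = 0
    · refine ⟨(2 * a)⁻¹, K.inv_mem (K.mul_mem (ofNat_mem K 2) ha), 0, K.zero_mem, ?_⟩
      rw [← sub_eq_zero.1 h1]; ring
    · have hN : a ^ 2 - b ^ 2 * θ ^ 2 ∈ K :=
        K.sub_mem (pow_mem ha 2) (K.mul_mem (pow_mem hb 2) hθ)
      have hN0 : a ^ 2 - b ^ 2 * θ ^ 2 ≠ 0 := by
        rw [show a ^ 2 - b ^ 2 * θ ^ 2 = (a + b * θ) * (a - b * θ) by ring]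
        exact mul_ne_zero h0 h1
      refine ⟨a / (a ^ 2 - b ^ 2 * θ ^ 2), K.div_mem ha hN, -b / (a ^ 2 - b ^ 2 * θ ^ 2),
        K.div_mem (K.neg_mem hb) hN, ?_⟩
      field_simp
      ring
  | mul x y _ _ hx hy =>
    obtain ⟨a, ha, b, hb, rfl⟩ := hx
    obtain ⟨c, hc, d, hd, rfl⟩ := hy
    exact ⟨_, K.add_mem (K.mul_mem ha hc) (K.mul_mem (K.mul_mem hb hd) hθ), _,
      K.add_mem (K.mul_mem ha hd) (K.mul_mem hb hc), by ring⟩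

theorem ringHom_eq_of_mem_adjoin {S : Set ℂ} {σ τ : ℂ →+* ℂ} (h : ∀ x ∈ S, σ x = τ x) {y : ℂ}
    (hy : y ∈ IntermediateField.adjoin ℚ S) : σ y = τ y := by
  induction hy using IntermediateField.adjoin_induction with
  | mem x hx => exact h x hx
  | algebraMap x => simp
  | add x y _ _ hx hy => simp [hx, hy]
  | inv x _ hx => simp [hx]
  | mul x y _ _ hx hy => simp [hx, hy]

theorem map_mem_adjoin {S T : Set ℂ} {σ : ℂ →+* ℂ}
    (h : ∀ x ∈ S, σ x ∈ IntermediateField.adjoin ℚ T) {y : ℂ}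
    (hy : y ∈ IntermediateField.adjoin ℚ S) : σ y ∈ IntermediateField.adjoin ℚ T := by
  set K := IntermediateField.adjoin ℚ T
  induction hy using IntermediateField.adjoin_induction with
  | mem x hx => exact h x hx
  | algebraMap x => simp
  | add x y _ _ hx hy => rw [map_add]; exact K.add_mem hx hy
  | inv x _ hx => rw [map_inv₀]; exact K.inv_mem hx
  | mul x y _ _ hx hy => rw [map_mul]; exact K.mul_mem hx hy

theorem mem_adjoin_empty_iff {y : ℂ} :
    y ∈ IntermediateField.adjoin ℚ (∅ : Set ℂ) ↔ ∃ a : ℚ, y = a := by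
  rw [IntermediateField.adjoin_empty, IntermediateField.mem_bot]
  constructor
  · rintro ⟨a, rfl⟩; exact ⟨a, by simp⟩
  · rintro ⟨a, rfl⟩; exact ⟨a, by simp⟩

theorem isIntegral_map {σ : ℂ →+* ℂ} {x : ℂ} (hx : IsIntegral ℤ x) : IsIntegral ℤ (σ x) :=
  hx.map σ.toIntAlgHom

theorem sq_sqrt_natCast (m : ℕ) : (((√(m : ℝ) : ℝ) : ℂ)) ^ 2 = m := by
  rw [← Complex.ofReal_pow, Real.sq_sqrt (Nat.cast_nonneg m)]; simp

theorem sqrt_mem_quadField (m : ℕ) : ((√(m : ℝ) : ℝ) : ℂ) ∈ quadField m :=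
  IntermediateField.mem_adjoin_simple_self _ _

theorem mem_quadField_iff {m : ℕ} {y : ℂ} :
    y ∈ quadField m ↔ ∃ a b : ℚ, y = a + b * ((√(m : ℝ) : ℝ) : ℂ) := by
  constructor
  · intro hy
    rw [quadField, ← insert_empty_eq] at hy
    obtain ⟨a, ha, b, hb, rfl⟩ := exists_eq_add_mul_of_mem_adjoin_insert (by
      rw [sq_sqrt_natCast]; exact natCast_mem _ m) hy
    obtain ⟨a, rfl⟩ := mem_adjoin_empty_iff.1 ha
    obtain ⟨b, rfl⟩ := mem_adjoin_empty_iff.1 hb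
    exact ⟨a, b, rfl⟩
  · rintro ⟨a, b, rfl⟩
    have h : ∀ a : ℚ, (a : ℂ) ∈ quadField m := fun a => by
      simp
    exact add_mem (h a) (mul_mem (h b) (sqrt_mem_quadField m))

end MultiquadraticUnits

/-! ### Units of real quadratic fields -/

namespace MultiquadraticUnits

theorem exists_ringHom_sqrt_neg {m : ℕ} (hm : ¬ IsSquare m) :
    ∃ σ : ℂ →+* ℂ, σ ((√(m : ℝ) : ℝ) : ℂ) = -((√(m : ℝ) : ℝ) : ℂ) :=
  exists_ringHom_neg_of_sq_eq (d := m) (by rw [sq_sqrt_natCast]; simp)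
    (by rwa [Rat.isSquare_natCast_iff])

theorem isInt_of_isIntegral_ratCast {a : ℚ} (ha : IsIntegral ℤ (a : ℂ)) : ∃ n : ℤ, a = n := by
  have h : IsIntegral ℤ a :=
    (isIntegral_algHom_iff (algebraMap ℚ ℂ).toIntAlgHom (algebraMap ℚ ℂ).injective).1
      (by simpa using ha)
  obtain ⟨n, hn⟩ := IsIntegrallyClosed.isIntegral_iff.1 h
  exact ⟨n, by simpa using hn.symm⟩

theorem isInt_unit_of_ratCast {a : ℚ} (ha : IsIntegral ℤ (a : ℂ)) (ha' : IsIntegral ℤ (a : ℂ)⁻¹)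
    (h0 : a ≠ 0) : a = 1 ∨ a = -1 := by
  obtain ⟨n, rfl⟩ := isInt_of_isIntegral_ratCast ha
  obtain ⟨k, hk⟩ := isInt_of_isIntegral_ratCast (a := (n : ℚ)⁻¹) (by simpa using ha')
  have h1 : (n : ℚ) * k = 1 := by rw [← hk, mul_inv_cancel₀ h0]
  have h2 : n * k = 1 := by exact_mod_cast h1
  rcases Int.eq_one_or_neg_one_of_mul_eq_one h2 with h | h <;> simp [h]

/-- Trace and norm of a unit of a real quadratic field. -/
theorem exists_trace_norm_of_isUnitIn {m : ℕ} (hm : ¬ IsSquare m) {z : ℂ}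
    (hz : IsUnitIn (quadField m) z) :
    ∃ a b : ℚ, z = ((a + b * √(m : ℝ) : ℝ) : ℂ) ∧ (∃ t : ℤ, 2 * a = t) ∧
      (a ^ 2 - m * b ^ 2 = 1 ∨ a ^ 2 - m * b ^ 2 = -1) := by
  obtain ⟨h0, hK, h1, h2⟩ := hz
  obtain ⟨a, b, rfl⟩ := mem_quadField_iff.1 hK
  obtain ⟨σ, hσ⟩ := exists_ringHom_sqrt_neg hm
  set r := ((√(m : ℝ) : ℝ) : ℂ) with hr
  have hr2 : r ^ 2 = m := sq_sqrt_natCast m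
  have hσz : σ (a + b * r) = a - b * r := by simp [hσ]; ring
  have h3 := isIntegral_map (σ := σ) h1
  have h4 := isIntegral_map (σ := σ) h2
  rw [map_inv₀] at h4
  have hσ0 : σ (a + b * r) ≠ 0 := (map_ne_zero σ).2 h0
  rw [hσz] at h3 h4 hσ0
  have hN : (a + b * r) * (a - b * r) = ((a ^ 2 - m * b ^ 2 : ℚ) : ℂ) := by
    push_cast; rw [← hr2]; ring
  refine ⟨a, b, by push_cast; rfl, ?_, ?_⟩
  · apply isInt_of_isIntegral_ratCast
    have h : ((2 * a : ℚ) : ℂ) = (a + b * r) + (a - b * r) := by push_cast; ring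
    rw [h]; exact h1.add h3
  · apply isInt_unit_of_ratCast
    · rw [← hN]; exact h1.mul h3
    · rw [← hN, mul_inv]; exact h2.mul h4
    · intro h
      rw [h] at hN
      exact mul_ne_zero h0 hσ0 (by simpa using hN)

/-- The units greater than `1` of a real quadratic field. -/
def unitsGtOne (m : ℕ) : Set ℝ := {x : ℝ | 1 < x ∧ IsUnitIn (quadField m) x}

theorem fundUnit_eq (m : ℕ) : fundUnit m = sInf (unitsGtOne m) := by
  unfold fundUnit unitsGtOne
  congr 1
  ext x
  refine and_congr_right fun hx => ⟨?_, fun h => ?_⟩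
  · rintro ⟨u, hu, hux⟩
    rw [← hux]; exact mem_unitGroup_iff_isUnitIn.1 hu
  · exact ⟨Units.mk0 x h.1, mem_unitGroup_iff_isUnitIn.2 (by simpa using h), by simp⟩

theorem isUnitIn_of_int_norm {m : ℕ} {x y : ℤ} (h : x ^ 2 - m * y ^ 2 = 1 ∨ x ^ 2 - m * y ^ 2 = -1) :
    IsUnitIn (quadField m) ((x + y * √(m : ℝ) : ℝ) : ℂ) := by
  set r := ((√(m : ℝ) : ℝ) : ℂ) with hr
  have hr2 : r ^ 2 = m := sq_sqrt_natCast m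
  have hri : IsIntegral ℤ r := IsIntegral.of_pow two_pos (by
    rw [hr2]; exact_mod_cast isIntegral_algebraMap (R := ℤ) (A := ℂ) (x := (m : ℤ)))
  have hi : ∀ n : ℤ, IsIntegral ℤ (n : ℂ) := fun n => isIntegral_algebraMap (R := ℤ) (A := ℂ) (x := n)
  have hz : ∀ x y : ℤ, IsIntegral ℤ ((x : ℂ) + y * r) := fun x y => (hi x).add ((hi y).mul hri)
  have hN : ((x : ℂ) + y * r) * (x - y * r) = ((x ^ 2 - m * y ^ 2 : ℤ) : ℂ) := by
    push_cast; rw [← hr2]; ring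
  have hcast : ((x + y * √(m : ℝ) : ℝ) : ℂ) = (x : ℂ) + y * r := by push_cast; rfl
  rw [hcast]
  have hinv : ∃ ε : ℤ, ((x : ℂ) + y * r) * (((ε * x : ℤ) : ℂ) + ((-(ε * y) : ℤ) : ℂ) * r) = 1 := by
    rcases h with h | h
    · refine ⟨1, ?_⟩
      rw [h] at hN; push_cast at hN ⊢; linear_combination hN
    · refine ⟨-1, ?_⟩
      rw [h] at hN; push_cast at hN ⊢; linear_combination -hN
  obtain ⟨ε, hε⟩ := hinv
  refine ⟨left_ne_zero_of_mul_eq_one hε, ?_, hz x y, ?_⟩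
  · exact mem_quadField_iff.2 ⟨x, y, by push_cast; rfl⟩
  · rw [inv_eq_of_mul_eq_one_right hε]; exact hz _ _

theorem unitsGtOne_nonempty {m : ℕ} (hm : ¬ IsSquare m) : (unitsGtOne m).Nonempty := by
  have hm0 : 0 < m := Nat.pos_of_ne_zero fun h => hm (by simp [h])
  obtain ⟨x, y, hxy, hy⟩ := Pell.exists_of_not_isSquare (d := (m : ℤ)) (by exact_mod_cast hm0)
    (by rwa [Int.isSquare_natCast_iff])
  refine ⟨((|x| : ℤ) : ℝ) + ((|y| : ℤ) : ℝ) * √(m : ℝ), ?_, isUnitIn_of_int_norm ?_⟩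
  · have h1 : (1 : ℝ) ≤ ((|y| : ℤ) : ℝ) := by exact_mod_cast Int.one_le_abs hy
    have h2 : (1 : ℝ) ≤ √(m : ℝ) := Real.one_le_sqrt.2 (by exact_mod_cast hm0)
    have hx : x ≠ 0 := by
      rintro rfl
      have : 0 < (m : ℤ) * y ^ 2 := mul_pos (by exact_mod_cast hm0) (by positivity)
      simp at hxy; omega
    have h3 : (1 : ℝ) ≤ ((|x| : ℤ) : ℝ) := by exact_mod_cast Int.one_le_abs hx
    nlinarith
  · left; simpa using hxy

theorem finite_unitsGtOne_le {m : ℕ} (hm : ¬ IsSquare m) (B : ℝ) :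
    {x ∈ unitsGtOne m | x ≤ B}.Finite := by
  -- The larger root of Z² - tZ + N: a unit x > 1 is recovered from its trace t and norm N = ±1. Its
  -- conjugate t - x has absolute value 1/x < 1, which bounds t in terms of B.
  let f : ℤ × ℤ → ℝ := fun p => (p.1 + √((p.1 : ℝ) ^ 2 - 4 * p.2)) / 2
  refine (((Set.finite_Icc (-⌈B + 1⌉) ⌈B + 1⌉).prod (Set.finite_Icc (-1 : ℤ) 1)).image f).subset ?_
  rintro x ⟨⟨hx1, hxu⟩, hxB⟩
  obtain ⟨a, b, hx, ⟨t, ht⟩, hN⟩ := exists_trace_norm_of_isUnitIn hm hxu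
  have hx : x = a + b * √(m : ℝ) := by exact_mod_cast hx
  have hr2 : √(m : ℝ) ^ 2 = m := Real.sq_sqrt (Nat.cast_nonneg m)
  have ht' : (2 * a : ℝ) = t := by exact_mod_cast ht
  obtain ⟨N, hN1, hN2⟩ : ∃ N : ℤ, (N = 1 ∨ N = -1) ∧ (a ^ 2 - m * b ^ 2 : ℝ) = N := by
    rcases hN with h | h
    · exact ⟨1, Or.inl rfl, by exact_mod_cast h⟩
    · exact ⟨-1, Or.inr rfl, by exact_mod_cast h⟩
  have hprod : x * (t - x) = N := by rw [← ht', ← hN2, hx]; linear_combination (-(b : ℝ) ^ 2) * hr2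
  have hN3 : ((N : ℝ) = 1 ∨ (N : ℝ) = -1) := by rcases hN1 with rfl | rfl <;> simp
  have hb : |t - x| < 1 := by
    have : |t - x| * x = 1 := by
      rw [← abs_of_pos (show 0 < x by linarith), ← abs_mul, abs_of_pos (show 0 < x by linarith),
        mul_comm, hprod]
      rcases hN3 with h | h <;> simp [h]
    nlinarith [abs_nonneg (t - x)]
  rw [abs_lt] at hb
  refine ⟨(t, N), ⟨⟨?_, ?_⟩, ?_⟩, ?_⟩
  · have : -(⌈B + 1⌉ : ℝ) ≤ t := by linarith [Int.le_ceil (B + 1)]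
    exact_mod_cast this
  · have : (t : ℝ) ≤ ⌈B + 1⌉ := by linarith [Int.le_ceil (B + 1)]
    exact_mod_cast this
  · rcases hN1 with rfl | rfl <;> simp
  · have : √((t : ℝ) ^ 2 - 4 * N) = 2 * x - t := by
      rw [← hprod, show (t : ℝ) ^ 2 - 4 * (x * (t - x)) = (2 * x - t) ^ 2 by ring]
      exact Real.sqrt_sq (by linarith)
    simp only [f, this]; ring

theorem isLeast_fundUnit {m : ℕ} (hm : ¬ IsSquare m) : IsLeast (unitsGtOne m) (fundUnit m) := by
  obtain ⟨x, hx⟩ := unitsGtOne_nonempty hm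
  obtain ⟨y, hy, hmin⟩ := (finite_unitsGtOne_le hm x).exists_minimal ⟨x, hx, le_rfl⟩
  have : IsLeast (unitsGtOne m) y := by
    refine ⟨hy.1, fun z hz => ?_⟩
    rcases le_total y z with h | h
    · exact h
    · exact hmin ⟨hz, h.trans hy.2⟩ h
  rw [fundUnit_eq, this.csInf_eq]
  exact this

theorem one_lt_fundUnit {m : ℕ} (hm : ¬ IsSquare m) : 1 < fundUnit m := (isLeast_fundUnit hm).1.1

theorem isUnitIn_fundUnit {m : ℕ} (hm : ¬ IsSquare m) : IsUnitIn (quadField m) (fundUnit m) :=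
  (isLeast_fundUnit hm).1.2

theorem exists_zpow_fundUnit_of_pos {m : ℕ} (hm : ¬ IsSquare m) {x : ℝ} (hx : 0 < x)
    (hxu : IsUnitIn (quadField m) x) : ∃ n : ℤ, x = fundUnit m ^ n := by
  have hε := one_lt_fundUnit hm
  obtain ⟨n, hn1, hn2⟩ := exists_mem_Ico_zpow hx hε
  have hp : 0 < fundUnit m ^ n := zpow_pos (by linarith) n
  refine ⟨n, hn1.eq_of_not_lt' fun hlt => ?_⟩
  have hmem : x / fundUnit m ^ n ∈ unitsGtOne m := by
    refine ⟨(one_lt_div hp).2 hlt, ?_⟩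
    push_cast
    exact hxu.div ((isUnitIn_fundUnit hm).zpow n)
  have h1 := (isLeast_fundUnit hm).2 hmem
  rw [le_div_iff₀ hp] at h1
  rw [zpow_add_one₀ (by linarith), mul_comm] at hn2
  linarith

/-- The unit group of a real quadratic field is `±ε^ℤ`. -/
theorem exists_zpow_fundUnit {m : ℕ} (hm : ¬ IsSquare m) {z : ℂ}
    (hz : IsUnitIn (quadField m) z) :
    ∃ n : ℤ, z = (fundUnit m : ℂ) ^ n ∨ z = -(fundUnit m : ℂ) ^ n := by
  obtain ⟨a, b, rfl, -⟩ := exists_trace_norm_of_isUnitIn hm hz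
  rcases lt_trichotomy (a + b * √(m : ℝ) : ℝ) 0 with h | h | h
  · obtain ⟨n, hn⟩ := exists_zpow_fundUnit_of_pos hm (neg_pos.2 h) (by
      rw [Complex.ofReal_neg]; exact hz.neg)
    refine ⟨n, Or.inr ?_⟩
    rw [← Complex.ofReal_zpow, ← hn]; simp
  · exact absurd (by rw [h]; simp) hz.1
  · obtain ⟨n, hn⟩ := exists_zpow_fundUnit_of_pos hm h hz
    exact ⟨n, Or.inl (by rw [← Complex.ofReal_zpow, ← hn])⟩

end MultiquadraticUnits

/-! ### Square roots of fundamental units of norm 1 -/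

namespace MultiquadraticUnits

/-- The square of the denominator of b is prime to the square of its numerator, hence divides m. -/
theorem isInt_of_squarefree_mul_sq {m : ℕ} (hm : Squarefree m) {b : ℚ} {n : ℤ}
    (h : m * b ^ 2 = n) : ∃ k : ℤ, b = k := by
  have hd : (b.den : ℚ) ≠ 0 := by exact_mod_cast b.den_nz
  have h1 : (m : ℚ) * b.num ^ 2 = n * b.den ^ 2 := by
    rw [← h, ← Rat.mul_den_eq_num b]; ring
  have h2 : (m : ℤ) * b.num ^ 2 = n * b.den ^ 2 := by exact_mod_cast h1
  have h3 : (b.den : ℤ) ^ 2 ∣ (m : ℤ) * b.num ^ 2 := ⟨n, by rw [h2]; ring⟩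
  have hcop : IsCoprime ((b.den : ℤ) ^ 2) (b.num ^ 2) := by
    apply IsCoprime.pow
    rw [Int.isCoprime_iff_gcd_eq_one, Int.gcd_comm]
    exact b.reduced
  have h4 : (b.den : ℤ) ^ 2 ∣ (m : ℤ) := hcop.dvd_of_dvd_mul_right h3
  have h5 : b.den * b.den ∣ m := by rw [← sq]; exact_mod_cast h4
  have h6 : b.den = 1 := Nat.isUnit_iff.1 (hm _ h5)
  exact ⟨b.num, ((Rat.den_eq_one_iff b).1 h6).symm⟩

theorem not_isSquare_of_squarefree {m : ℕ} (hm : Squarefree m) (h1 : m ≠ 1) : ¬ IsSquare m := by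
  rintro ⟨k, rfl⟩
  have := Nat.isUnit_iff.1 (hm k dvd_rfl)
  simp [this] at h1

theorem eq_of_squarefree_mul_sq {a b x y : ℕ} (ha : Squarefree a) (hb : Squarefree b)
    (hx : x ≠ 0) (h : a * x ^ 2 = b * y ^ 2) : a = b := by
  have key : ∀ {a b x y : ℕ}, Squarefree a → Squarefree b → x ≠ 0 → a * x ^ 2 = b * y ^ 2 → a ∣ b := by
    intro a b x y ha hb hx h
    obtain ⟨k, hk⟩ := isInt_of_squarefree_mul_sq (m := b) hb (b := (y / x : ℚ)) (n := a) (by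
      have hx' : (x : ℚ) ≠ 0 := by exact_mod_cast hx
      field_simp
      rw [mul_comm ((x : ℚ) ^ 2)]; exact_mod_cast h.symm)
    have hx' : (x : ℚ) ≠ 0 := by exact_mod_cast hx
    have hy : (y : ℚ) = k * x := by field_simp at hk; linarith
    have h2 : (a : ℚ) = b * k ^ 2 := by
      have h3 : (a : ℚ) * x ^ 2 = b * y ^ 2 := by exact_mod_cast h
      rw [hy] at h3
      have : (a : ℚ) * x ^ 2 = b * k ^ 2 * x ^ 2 := by rw [h3]; ring
      exact mul_right_cancel₀ (pow_ne_zero 2 hx') this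
    have h4 : (a : ℤ) = b * k ^ 2 := by exact_mod_cast h2
    have h5 : a = b * k.natAbs ^ 2 := by
      zify; rw [sq_abs]; exact h4
    have h6 : k.natAbs = 1 := Nat.isUnit_iff.1 (ha _ ⟨b, by rw [← sq]; linarith⟩)
    rw [h6] at h5
    exact ⟨1, by omega⟩
  have hy : y ≠ 0 := by
    rintro rfl
    have := ha.ne_zero
    simp_all
  exact Nat.dvd_antisymm (key ha hb hx h) (key hb ha hy h.symm)

/-- The trace of the fundamental unit when a prime `≡ 3 mod 4` divides `m`. -/
theorem exists_trace_fundUnit {m π : ℕ} [Fact π.Prime] (hm : Squarefree m) (hπ : π ∣ m)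
    (hπ4 : π % 4 = 3) :
    ∃ T y : ℤ, fundUnit m + (fundUnit m)⁻¹ = T ∧ T ^ 2 - 4 = m * y ^ 2 := by
  have hm1 : m ≠ 1 := by
    rintro rfl
    exact (Fact.out : π.Prime).one_lt.ne' (Nat.dvd_one.1 hπ)
  have hsq := not_isSquare_of_squarefree hm hm1
  obtain ⟨a, b, hab, ⟨t, ht⟩, hN⟩ := exists_trace_norm_of_isUnitIn hsq (isUnitIn_fundUnit hsq)
  have hab : fundUnit m = a + b * √(m : ℝ) := by exact_mod_cast hab
  have hr2 : √(m : ℝ) ^ 2 = m := Real.sq_sqrt (Nat.cast_nonneg m)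
  obtain ⟨y, hy⟩ : ∃ y : ℤ, 2 * b = y := by
    rcases hN with h | h
    · apply isInt_of_squarefree_mul_sq hm (n := t ^ 2 - 4)
      push_cast; rw [← ht]; linear_combination -4 * h
    · apply isInt_of_squarefree_mul_sq hm (n := t ^ 2 + 4)
      push_cast; rw [← ht]; linear_combination -4 * h
  rcases hN with h | h
  · refine ⟨t, y, ?_, ?_⟩
    · have h' : (a : ℝ) ^ 2 - m * b ^ 2 = 1 := by exact_mod_cast h
      have ht' : (2 * a : ℝ) = t := by exact_mod_cast ht
      have hinv : (fundUnit m)⁻¹ = a - b * √(m : ℝ) := by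
        apply inv_eq_of_mul_eq_one_right
        rw [hab]; linear_combination h' - (b : ℝ) ^ 2 * hr2
      rw [hinv, hab, ← ht']; ring
    · have : ((t ^ 2 - 4 : ℤ) : ℚ) = ((m * y ^ 2 : ℤ) : ℚ) := by
        push_cast; rw [← ht, ← hy]; linear_combination 4 * h
      exact_mod_cast this
  -- Norm -1 would give t² = -2² modulo π, impossible for π ≡ 3 mod 4.
  · exfalso
    have h1 : ((t ^ 2 + 4 : ℤ) : ℚ) = ((m * y ^ 2 : ℤ) : ℚ) := by
      push_cast; rw [← ht, ← hy]; linear_combination 4 * h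
    have h2 : t ^ 2 + 4 = m * y ^ 2 := by exact_mod_cast h1
    have h3 : ((t : ZMod π)) ^ 2 = - 2 ^ 2 := by
      have h4 := congrArg (Int.cast : ℤ → ZMod π) h2
      push_cast at h4
      rw [(ZMod.natCast_eq_zero_iff m π).2 hπ] at h4
      linear_combination h4
    refine ZMod.mod_four_ne_three_of_sq_eq_neg_sq' (p := π) (y := 2) ?_ h3 hπ4
    intro h0
    have : ((2 : ℕ) : ZMod π) = 0 := by exact_mod_cast h0
    rw [ZMod.natCast_eq_zero_iff] at this
    have := (Nat.prime_dvd_prime_iff_eq Fact.out Nat.prime_two).1 this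
    omega

/-- The square root of the fundamental unit of `ℚ(√m)` when a prime `≡ 3 mod 4` divides `m`. -/
theorem exists_sqrt_fundUnit_eq {m π : ℕ} [Fact π.Prime] (hm : Squarefree m) (hπ : π ∣ m)
    (hπ4 : π % 4 = 3) :
    ∃ d d' x y : ℕ, √(fundUnit m) = (x * √(d : ℝ) + y * √(d' : ℝ)) / 2 ∧
      d * x ^ 2 = d' * y ^ 2 + 4 ∧ d ≠ 1 ∧
      (d * d' = m ∨ ∃ c c', d = 2 * c ∧ d' = 2 * c' ∧ c * c' = m ∧ Odd m) := by
  have hm1 : m ≠ 1 := by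
    rintro rfl
    exact (Fact.out : π.Prime).one_lt.ne' (Nat.dvd_one.1 hπ)
  have hsq := not_isSquare_of_squarefree hm hm1
  have hε := one_lt_fundUnit hsq
  obtain ⟨T, y, hT, hTy⟩ := exists_trace_fundUnit hm hπ hπ4
  set ε := fundUnit m with hεdef
  have hT2 : (2 : ℝ) < T := by
    rw [← hT]
    have h1 : ε * ε⁻¹ = 1 := mul_inv_cancel₀ (by linarith)
    have h2 : 0 < ε⁻¹ := inv_pos.2 (by linarith)
    nlinarith [sq_nonneg (ε - ε⁻¹), mul_pos (sub_pos.2 hε) (sub_pos.2 hε)]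
  have hT2 : 2 < T := by exact_mod_cast hT2
  obtain ⟨N, hTN⟩ := Int.eq_ofNat_of_zero_le (show 0 ≤ T - 2 by omega)
  obtain rfl : T = N + 2 := by omega
  have hN : 0 < N := by omega
  -- Here N = T - 2 and N + 4 = T + 2. These are the squares of √ε - 1/√ε and √ε + 1/√ε, so their
  -- squarefree decompositions give √ε as half a sum of two quadratic surds.
  obtain ⟨d, x, hd0, hx0, hdx, hd⟩ := Nat.sq_mul_squarefree_of_pos (show 0 < N + 4 by omega)
  obtain ⟨d', z, hd'0, hz0, hdz, hd'⟩ := Nat.sq_mul_squarefree_of_pos hN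
  have heq : d * x ^ 2 = d' * z ^ 2 + 4 := by rw [mul_comm, hdx, mul_comm, hdz]
  have hxR : (x : ℝ) ^ 2 * d = N + 4 := by exact_mod_cast hdx
  have hzR : (z : ℝ) ^ 2 * d' = N := by exact_mod_cast hdz
  have hTR : ε + ε⁻¹ = N + 2 := by rw [hT]; push_cast; ring
  have hsd : √(d : ℝ) ^ 2 = d := Real.sq_sqrt (Nat.cast_nonneg d)
  have hsd' : √(d' : ℝ) ^ 2 = d' := Real.sq_sqrt (Nat.cast_nonneg d')
  have hroot : √ε = (x * √(d : ℝ) + z * √(d' : ℝ)) / 2 := by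
    have he : 1 < √ε := by rw [Real.lt_sqrt] <;> linarith
    have hee : √ε ^ 2 = ε := Real.sq_sqrt (by linarith)
    have heinv : √ε * (√ε)⁻¹ = 1 := mul_inv_cancel₀ (by linarith)
    have hinv : ε⁻¹ = (√ε)⁻¹ ^ 2 := by rw [inv_pow, hee]
    have hi1 : 0 < (√ε)⁻¹ := inv_pos.2 (by linarith)
    have hi2 : (√ε)⁻¹ < 1 := inv_lt_one_of_one_lt₀ he
    rw [hinv] at hTR
    nth_rewrite 1 [← hee] at hTR
    have h1 : √ε + (√ε)⁻¹ = x * √(d : ℝ) := by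
      apply (sq_eq_sq₀ (by linarith) (by positivity)).1
      rw [mul_pow, hsd, hxR]; linear_combination hTR + 2 * heinv
    have h2 : √ε - (√ε)⁻¹ = z * √(d' : ℝ) := by
      apply (sq_eq_sq₀ (by linarith) (by positivity)).1
      rw [mul_pow, hsd', hzR]; linear_combination hTR - 2 * heinv
    linarith
  -- the product `d * d'` is `m` up to a square
  have hprod : d * d' * (x * z) ^ 2 = m * y.natAbs ^ 2 := by
    zify
    rw [sq_abs, ← hTy]
    have h1 : (x : ℤ) ^ 2 * d = N + 4 := by exact_mod_cast hdx
    have h2 : (z : ℤ) ^ 2 * d' = N := by exact_mod_cast hdz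
    linear_combination (z : ℤ) ^ 2 * d' * h1 + (N + 4 : ℤ) * h2
  have hxz : x * z ≠ 0 := by positivity
  have hg4 : Nat.gcd d d' ∣ 4 := by
    have h1 : Nat.gcd d d' ∣ d' * z ^ 2 + 4 := by
      rw [← heq]; exact (Nat.gcd_dvd_left d d').mul_right _
    exact (Nat.dvd_add_right ((Nat.gcd_dvd_right d d').mul_right _)).1 h1
  have hcases : d * d' = m ∨ ∃ c c', d = 2 * c ∧ d' = 2 * c' ∧ c * c' = m ∧ Odd m := by
    by_cases h2 : 2 ∣ d ∧ 2 ∣ d'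
    · right
      obtain ⟨⟨c, rfl⟩, ⟨c', rfl⟩⟩ := h2
      rw [Nat.gcd_mul_left] at hg4
      have hodd : ∀ c, Squarefree (2 * c) → Odd c := by
        intro c hc
        rw [← Nat.not_even_iff_odd, even_iff_two_dvd]
        rintro ⟨k, rfl⟩
        have := Nat.isUnit_iff.1 (hc 2 ⟨k, by ring⟩)
        omega
      have hc := hodd c hd
      have hc' := hodd c' hd'
      have hcop : Nat.Coprime c c' := by
        have h1 : Nat.gcd c c' ∣ 2 := by
          have : 2 * Nat.gcd c c' ∣ 2 * 2 := hg4
          exact (Nat.mul_dvd_mul_iff_left two_pos).1 this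
        rcases (Nat.dvd_prime Nat.prime_two).1 h1 with h | h
        · exact h
        · exfalso
          have : 2 ∣ c := h ▸ Nat.gcd_dvd_left c c'
          exact (Nat.not_even_iff_odd.2 hc) (even_iff_two_dvd.2 this)
      have hsf : Squarefree (c * c') := (Nat.squarefree_mul hcop).2
        ⟨hd.squarefree_of_dvd (dvd_mul_left _ _), hd'.squarefree_of_dvd (dvd_mul_left _ _)⟩
      have hm' : c * c' = m := by
        apply eq_of_squarefree_mul_sq hsf hm (x := 2 * (x * z)) (y := y.natAbs) (by omega)
        rw [← hprod]; ring
      exact ⟨c, c', rfl, rfl, hm', hm' ▸ hc.mul hc'⟩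
    · left
      have hcop : Nat.Coprime d d' := by
        refine Nat.Coprime.symm (Nat.coprime_of_dvd fun k hk h1 h3 => ?_)
        have h4 : k ∣ 2 ^ 2 := (Nat.dvd_gcd h3 h1).trans hg4
        have h5 := (Nat.prime_dvd_prime_iff_eq hk Nat.prime_two).1 (hk.dvd_of_dvd_pow h4)
        subst h5
        exact h2 ⟨h3, h1⟩
      exact eq_of_squarefree_mul_sq ((Nat.squarefree_mul hcop).2 ⟨hd, hd'⟩) hm hxz hprod
  refine ⟨d, d', x, z, hroot, heq, ?_, hcases⟩
  -- For d = 1 the square root √ε would be a unit of ℚ(√m) with 1 < √ε < ε, against the minimality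
  -- of ε.
  rintro rfl
  have hd'm : d' = m := by
    rcases hcases with h | ⟨c, c', h, -⟩
    · simpa using h
    · omega
  subst hd'm
  have he : 1 < √ε := by rw [Real.lt_sqrt] <;> linarith
  have hee : √ε ^ 2 = ε := Real.sq_sqrt (by linarith)
  have hmem : √ε ∈ unitsGtOne d' := by
    refine ⟨he, IsUnitIn.of_pow two_pos ?_ ?_⟩
    · rw [hroot]
      refine mem_quadField_iff.2 ⟨x / 2, z / 2, ?_⟩
      push_cast
      simp
      ring
    · rw [← Complex.ofReal_pow, hee]; exact isUnitIn_fundUnit hsq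
  have := (isLeast_fundUnit hsq).2 hmem
  rw [← hεdef] at this
  nlinarith

theorem legendreSym_eq_one_of_dvd_right {π : ℕ} [Fact π.Prime] (hπ2 : π ≠ 2) {d d' x y : ℕ}
    (h : d * x ^ 2 = d' * y ^ 2 + 4) (hd : π ∣ d') : legendreSym π d = 1 := by
  have h1 := congrArg (Nat.cast : ℕ → ZMod π) h
  push_cast at h1
  rw [(ZMod.natCast_eq_zero_iff d' π).2 hd, zero_mul, zero_add] at h1
  have h2 : (2 : ZMod π) ≠ 0 := by
    intro h0
    have : ((2 : ℕ) : ZMod π) = 0 := by exact_mod_cast h0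
    rw [ZMod.natCast_eq_zero_iff] at this
    exact hπ2 ((Nat.prime_dvd_prime_iff_eq Fact.out Nat.prime_two).1 this)
  have h4 : (4 : ZMod π) ≠ 0 := by
    rw [show (4 : ZMod π) = 2 * 2 by norm_num]; exact mul_ne_zero h2 h2
  have hd0 : (d : ZMod π) ≠ 0 := left_ne_zero_of_mul (h1 ▸ h4)
  have hx0 : (x : ZMod π) ≠ 0 := fun h0 => h4 (by rw [← h1, h0]; simp)
  rw [legendreSym.eq_one_iff π (by exact_mod_cast hd0)]
  refine ⟨2 / x, ?_⟩
  push_cast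
  field_simp
  rw [h1]; norm_num

theorem legendreSym_neg_eq_one_of_dvd_left {π : ℕ} [Fact π.Prime] (hπ2 : π ≠ 2) {d d' x y : ℕ}
    (h : d * x ^ 2 = d' * y ^ 2 + 4) (hd : π ∣ d) : legendreSym π (-d') = 1 := by
  have h1 := congrArg (Nat.cast : ℕ → ZMod π) h
  push_cast at h1
  rw [(ZMod.natCast_eq_zero_iff d π).2 hd, zero_mul] at h1
  have h2 : (2 : ZMod π) ≠ 0 := by
    intro h0
    have : ((2 : ℕ) : ZMod π) = 0 := by exact_mod_cast h0
    rw [ZMod.natCast_eq_zero_iff] at this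
    exact hπ2 ((Nat.prime_dvd_prime_iff_eq Fact.out Nat.prime_two).1 this)
  have h4 : (4 : ZMod π) ≠ 0 := by
    rw [show (4 : ZMod π) = 2 * 2 by norm_num]; exact mul_ne_zero h2 h2
  have h5 : (-d' : ZMod π) * y ^ 2 = 4 := by linear_combination h1
  have hd0 : (-d' : ZMod π) ≠ 0 := left_ne_zero_of_mul (h5 ▸ h4)
  have hx0 : (y : ZMod π) ≠ 0 := fun h0 => h4 (by rw [← h5, h0]; simp)
  rw [legendreSym.eq_one_iff π (by exact_mod_cast hd0)]
  refine ⟨2 / y, ?_⟩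
  push_cast
  field_simp
  linear_combination h5

end MultiquadraticUnits

/-! ### Legendre symbols single out the form of each square root -/

namespace MultiquadraticUnits

/-- `√ε_m = (x√d + y√d')/2` with `d x² - d' y² = 4`. -/
def HasSqrtForm (m d d' : ℕ) : Prop :=
  ∃ x y : ℕ, √(fundUnit m) = (x * √(d : ℝ) + y * √(d' : ℝ)) / 2 ∧ d * x ^ 2 = d' * y ^ 2 + 4

namespace HasSqrtForm

variable {m d d' : ℕ}

theorem legendreSym_left (h : HasSqrtForm m d d') {π : ℕ} [Fact π.Prime] (hπ2 : π ≠ 2)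
    (hd : π ∣ d') : legendreSym π d = 1 := by
  obtain ⟨x, y, -, h⟩ := h
  exact legendreSym_eq_one_of_dvd_right hπ2 h hd

theorem legendreSym_right (h : HasSqrtForm m d d') {π : ℕ} [Fact π.Prime] (hπ2 : π ≠ 2)
    (hd : π ∣ d) : legendreSym π (-1) * legendreSym π d' = 1 := by
  obtain ⟨x, y, -, h⟩ := h
  rw [← legendreSym.mul, neg_one_mul]
  exact legendreSym_neg_eq_one_of_dvd_left hπ2 h hd

end HasSqrtForm

theorem squarefree_mul_of_primes {a b : ℕ} (ha : a.Prime) (hb : b.Prime) (hab : a ≠ b) :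
    Squarefree (a * b) :=
  (Nat.squarefree_mul ((Nat.coprime_primes ha hb).2 hab)).2 ⟨ha.squarefree, hb.squarefree⟩

theorem squarefree_two_mul_mul_of_primes {a b : ℕ} (ha : a.Prime) (hb : b.Prime) (hab : a ≠ b)
    (ha2 : a ≠ 2) (hb2 : b ≠ 2) : Squarefree (2 * a * b) := by
  rw [mul_assoc]
  refine (Nat.squarefree_mul ?_).2 ⟨Nat.prime_two.squarefree, squarefree_mul_of_primes ha hb hab⟩
  exact Nat.Coprime.mul_right ((Nat.coprime_primes Nat.prime_two ha).2 ha2.symm)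
    ((Nat.coprime_primes Nat.prime_two hb).2 hb2.symm)

theorem mul_eq_mul_primes {a b c c' : ℕ} (ha : a.Prime) (hb : b.Prime) (h : c * c' = a * b) :
    (c = 1 ∧ c' = a * b) ∨ (c = a ∧ c' = b) ∨ (c = b ∧ c' = a) ∨ (c = a * b ∧ c' = 1) := by
  have ha0 := ha.pos
  have hb0 := hb.pos
  obtain ⟨u, v, hu, hv, rfl⟩ := (Nat.dvd_mul).1 (Dvd.intro _ h : c ∣ a * b)
  rcases (Nat.dvd_prime ha).1 hu with rfl | rfl <;> rcases (Nat.dvd_prime hb).1 hv with rfl | rfl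
  · exact Or.inl ⟨rfl, by simpa using h⟩
  · refine Or.inr (Or.inr (Or.inl ⟨by simp, ?_⟩))
    exact Nat.eq_of_mul_eq_mul_left hb0 (by linarith)
  · refine Or.inr (Or.inl ⟨by simp, ?_⟩)
    exact Nat.eq_of_mul_eq_mul_left ha0 (by linarith)
  · refine Or.inr (Or.inr (Or.inr ⟨rfl, ?_⟩))
    exact Nat.eq_of_mul_eq_mul_left (Nat.mul_pos ha0 hb0) (by linarith)

theorem mul_eq_two_mul_mul {a b c c' : ℕ}
    (h : c * c' = 2 * a * b) :
    (∃ k, c = 2 * k ∧ k * c' = a * b) ∨ (∃ k, c' = 2 * k ∧ c * k = a * b) := by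
  have h2 : 2 ∣ c * c' := ⟨a * b, by rw [h]; ring⟩
  rcases (Nat.Prime.dvd_mul Nat.prime_two).1 h2 with ⟨k, rfl⟩ | ⟨k, rfl⟩
  · exact Or.inl ⟨k, rfl, by nlinarith⟩
  · exact Or.inr ⟨k, rfl, by nlinarith⟩

/-- The square classes that may occur in `√ε_{ab}`. -/
theorem hasSqrtForm_mul {a b : ℕ} [ha : Fact a.Prime] [hb : Fact b.Prime] (hab : a ≠ b)
    (hb4 : b % 4 = 3) :
    HasSqrtForm (a * b) a b ∨ HasSqrtForm (a * b) b a ∨ HasSqrtForm (a * b) (a * b) 1 ∨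
    HasSqrtForm (a * b) 2 (2 * (a * b)) ∨ HasSqrtForm (a * b) (2 * a) (2 * b) ∨
    HasSqrtForm (a * b) (2 * b) (2 * a) ∨ HasSqrtForm (a * b) (2 * (a * b)) 2 := by
  obtain ⟨d, d', x, y, h1, h2, h3, h4⟩ := exists_sqrt_fundUnit_eq
    (squarefree_mul_of_primes ha.out hb.out hab) (dvd_mul_left b a) hb4
  have h : HasSqrtForm (a * b) d d' := ⟨x, y, h1, h2⟩
  rcases h4 with h4 | ⟨c, c', rfl, rfl, h4, -⟩
  · rcases mul_eq_mul_primes ha.out hb.out h4 with ⟨rfl, rfl⟩ | ⟨rfl, rfl⟩ | ⟨rfl, rfl⟩ | ⟨rfl, rfl⟩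
    · exact absurd rfl h3
    all_goals tauto
  · rcases mul_eq_mul_primes ha.out hb.out h4 with ⟨rfl, rfl⟩ | ⟨rfl, rfl⟩ | ⟨rfl, rfl⟩ | ⟨rfl, rfl⟩
    all_goals try simp only [mul_one] at h
    all_goals tauto

/-- The square classes that may occur in `√ε_{2ab}`. -/
theorem hasSqrtForm_two_mul {a b : ℕ} [ha : Fact a.Prime] [hb : Fact b.Prime] (hab : a ≠ b)
    (ha2 : a ≠ 2) (hb4 : b % 4 = 3) :
    HasSqrtForm (2 * a * b) a (2 * b) ∨ HasSqrtForm (2 * a * b) b (2 * a) ∨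
    HasSqrtForm (2 * a * b) (a * b) 2 ∨
    HasSqrtForm (2 * a * b) 2 (a * b) ∨ HasSqrtForm (2 * a * b) (2 * a) b ∨
    HasSqrtForm (2 * a * b) (2 * b) a ∨ HasSqrtForm (2 * a * b) (2 * (a * b)) 1 := by
  obtain ⟨d, d', x, y, h1, h2, h3, h4⟩ := exists_sqrt_fundUnit_eq
    (squarefree_two_mul_mul_of_primes ha.out hb.out hab ha2 (by rintro rfl; omega))
    (dvd_mul_left b (2 * a)) hb4
  have h : HasSqrtForm (2 * a * b) d d' := ⟨x, y, h1, h2⟩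
  rcases h4 with h4 | ⟨c, c', rfl, rfl, h4, h5⟩
  · rcases mul_eq_two_mul_mul h4 with ⟨k, rfl, hk⟩ | ⟨k, rfl, hk⟩
    · rcases mul_eq_mul_primes ha.out hb.out hk with ⟨rfl, rfl⟩ | ⟨rfl, rfl⟩ | ⟨rfl, rfl⟩ | ⟨rfl, rfl⟩
      all_goals try simp only [mul_one] at h
      all_goals tauto
    · rcases mul_eq_mul_primes ha.out hb.out hk with ⟨rfl, rfl⟩ | ⟨rfl, rfl⟩ | ⟨rfl, rfl⟩ | ⟨rfl, rfl⟩
      · exact absurd rfl h3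
      all_goals try simp only [mul_one] at h
      all_goals tauto
  · rw [mul_assoc] at h5
    exact absurd (even_two_mul _) (Nat.not_even_iff_odd.2 h5)

/-- The congruences and Legendre symbols of the three primes. -/
structure PrimeTriple (p q s : ℕ) [Fact p.Prime] [Fact q.Prime] [Fact s.Prime] : Prop where
  p_mod : p % 8 = 5
  q_mod : q % 8 = 7
  s_mod : s % 8 = 3
  sym_q_p : legendreSym q p = -1
  sym_s_p : legendreSym s p = -1
  sym_q_s : legendreSym q s = -1

namespace PrimeTriple

variable {p q s : ℕ} [Fact p.Prime] [Fact q.Prime] [Fact s.Prime]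

section

variable (h : PrimeTriple p q s)
include h

theorem p_ne_two : p ≠ 2 := by have := h.p_mod; omega
theorem q_ne_two : q ≠ 2 := by have := h.q_mod; omega
theorem s_ne_two : s ≠ 2 := by have := h.s_mod; omega
theorem p_ne_q : p ≠ q := by have := h.p_mod; have := h.q_mod; omega
theorem p_ne_s : p ≠ s := by have := h.p_mod; have := h.s_mod; omega
theorem q_ne_s : q ≠ s := by have := h.q_mod; have := h.s_mod; omega

theorem sym_p_q : legendreSym p q = -1 := by
  rw [← h.sym_q_p]
  exact (legendreSym.quadratic_reciprocity_one_mod_four (by have := h.p_mod; omega) h.q_ne_two).symm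

theorem sym_p_s : legendreSym p s = -1 := by
  rw [← h.sym_s_p]
  exact (legendreSym.quadratic_reciprocity_one_mod_four (by have := h.p_mod; omega) h.s_ne_two).symm

theorem sym_s_q : legendreSym s q = 1 := by
  have := legendreSym.quadratic_reciprocity_three_mod_four (p := q) (q := s)
    (by have := h.q_mod; omega) (by have := h.s_mod; omega)
  rw [this, h.sym_q_s]; norm_num

theorem sym_p_two : legendreSym p 2 = -1 := by
  rw [legendreSym.at_two h.p_ne_two, ZMod.χ₈_nat_eq_if_mod_eight, h.p_mod]
  have := h.p_mod; split_ifs <;> omega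

theorem sym_q_two : legendreSym q 2 = 1 := by
  rw [legendreSym.at_two h.q_ne_two, ZMod.χ₈_nat_eq_if_mod_eight, h.q_mod]
  have := h.q_mod; split_ifs <;> omega

theorem sym_s_two : legendreSym s 2 = -1 := by
  rw [legendreSym.at_two h.s_ne_two, ZMod.χ₈_nat_eq_if_mod_eight, h.s_mod]
  have := h.s_mod; split_ifs <;> omega

theorem sym_p_neg_one : legendreSym p (-1) = 1 := by
  rw [legendreSym.at_neg_one h.p_ne_two, ZMod.χ₄_nat_one_mod_four (by have := h.p_mod; omega)]

theorem sym_q_neg_one : legendreSym q (-1) = -1 := by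
  rw [legendreSym.at_neg_one h.q_ne_two, ZMod.χ₄_nat_three_mod_four (by have := h.q_mod; omega)]

theorem sym_s_neg_one : legendreSym s (-1) = -1 := by
  rw [legendreSym.at_neg_one h.s_ne_two, ZMod.χ₄_nat_three_mod_four (by have := h.s_mod; omega)]

/-- In d x² = d' y² + 4, d is a square modulo each odd prime dividing d', and -d' is a square modulo
each odd prime dividing d. Each of the other six candidates violates one of these conditions at p or
q. The five analogous lemmas below use the same test at the two odd primes dividing m. -/
theorem hasSqrtForm_pq : HasSqrtForm (p * q) (2 * q) (2 * p) := by
  rcases hasSqrtForm_mul h.p_ne_q (by have := h.q_mod; omega) with H | H | H | H | H | H | H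
  · have := H.legendreSym_left (π := q) h.q_ne_two (by simp)
    simp [h.sym_q_p] at this
  · have := H.legendreSym_left (π := p) h.p_ne_two (by simp)
    simp [h.sym_p_q] at this
  · have := H.legendreSym_right (π := q) h.q_ne_two (by simp)
    simp [h.sym_q_neg_one] at this
  · have := H.legendreSym_left (π := p) h.p_ne_two ⟨2 * q, by ring⟩
    simp [h.sym_p_two] at this
  · have := H.legendreSym_left (π := q) h.q_ne_two (by simp)
    simp [legendreSym.mul, h.sym_q_two, h.sym_q_p] at this
  · exact H
  · have := H.legendreSym_right (π := p) h.p_ne_two ⟨2 * q, by ring⟩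
    simp [h.sym_p_two, h.sym_p_neg_one] at this

theorem hasSqrtForm_two_pq : HasSqrtForm (2 * p * q) (2 * q) p := by
  rcases hasSqrtForm_two_mul h.p_ne_q h.p_ne_two (by have := h.q_mod; omega) with
    H | H | H | H | H | H | H
  · have := H.legendreSym_left (π := q) h.q_ne_two (by simp)
    simp [h.sym_q_p] at this
  · have := H.legendreSym_left (π := p) h.p_ne_two (by simp)
    simp [h.sym_p_q] at this
  · have := H.legendreSym_right (π := p) h.p_ne_two (by simp)
    simp [h.sym_p_neg_one, h.sym_p_two] at this
  · have := H.legendreSym_left (π := p) h.p_ne_two (by simp)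
    simp [h.sym_p_two] at this
  · have := H.legendreSym_right (π := p) h.p_ne_two (by simp)
    simp [h.sym_p_neg_one, h.sym_p_q] at this
  · exact H
  · have := H.legendreSym_right (π := q) h.q_ne_two ⟨2 * p, by ring⟩
    simp [h.sym_q_neg_one] at this

theorem hasSqrtForm_ps : HasSqrtForm (p * s) (2 * p) (2 * s) := by
  rcases hasSqrtForm_mul h.p_ne_s (by have := h.s_mod; omega) with H | H | H | H | H | H | H
  · have := H.legendreSym_left (π := s) h.s_ne_two (by simp)
    simp [h.sym_s_p] at this
  · have := H.legendreSym_left (π := p) h.p_ne_two (by simp)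
    simp [h.sym_p_s] at this
  · have := H.legendreSym_right (π := s) h.s_ne_two (by simp)
    simp [h.sym_s_neg_one] at this
  · have := H.legendreSym_left (π := p) h.p_ne_two ⟨2 * s, by ring⟩
    simp [h.sym_p_two] at this
  · exact H
  · have := H.legendreSym_right (π := s) h.s_ne_two (by simp)
    simp [legendreSym.mul, h.sym_s_two, h.sym_s_p, h.sym_s_neg_one] at this
  · have := H.legendreSym_right (π := p) h.p_ne_two ⟨2 * s, by ring⟩
    simp [h.sym_p_two, h.sym_p_neg_one] at this

theorem hasSqrtForm_two_ps : HasSqrtForm (2 * p * s) (2 * s) p := by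
  rcases hasSqrtForm_two_mul h.p_ne_s h.p_ne_two (by have := h.s_mod; omega) with
    H | H | H | H | H | H | H
  · have := H.legendreSym_left (π := s) h.s_ne_two (by simp)
    simp [h.sym_s_p] at this
  · have := H.legendreSym_left (π := p) h.p_ne_two (by simp)
    simp [h.sym_p_s] at this
  · have := H.legendreSym_right (π := p) h.p_ne_two (by simp)
    simp [h.sym_p_neg_one, h.sym_p_two] at this
  · have := H.legendreSym_left (π := p) h.p_ne_two (by simp)
    simp [h.sym_p_two] at this
  · have := H.legendreSym_right (π := p) h.p_ne_two (by simp)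
    simp [h.sym_p_neg_one, h.sym_p_s] at this
  · exact H
  · have := H.legendreSym_right (π := s) h.s_ne_two ⟨2 * p, by ring⟩
    simp [h.sym_s_neg_one] at this

theorem hasSqrtForm_qs : HasSqrtForm (q * s) q s := by
  rcases hasSqrtForm_mul h.q_ne_s (by have := h.s_mod; omega) with H | H | H | H | H | H | H
  · exact H
  · have := H.legendreSym_left (π := q) h.q_ne_two (by simp)
    simp [h.sym_q_s] at this
  · have := H.legendreSym_right (π := s) h.s_ne_two (by simp)
    simp [h.sym_s_neg_one] at this
  · have := H.legendreSym_left (π := s) h.s_ne_two ⟨2 * q, by ring⟩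
    simp [h.sym_s_two] at this
  · have := H.legendreSym_left (π := s) h.s_ne_two (by simp)
    simp [legendreSym.mul, h.sym_s_two, h.sym_s_q] at this
  · have := H.legendreSym_left (π := q) h.q_ne_two (by simp)
    simp [legendreSym.mul, h.sym_q_two, h.sym_q_s] at this
  · have := H.legendreSym_right (π := q) h.q_ne_two ⟨2 * s, by ring⟩
    simp [h.sym_q_two, h.sym_q_neg_one] at this

theorem hasSqrtForm_two_qs : HasSqrtForm (2 * q * s) q (2 * s) := by
  rcases hasSqrtForm_two_mul h.q_ne_s h.q_ne_two (by have := h.s_mod; omega) with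
    H | H | H | H | H | H | H
  · exact H
  · have := H.legendreSym_left (π := q) h.q_ne_two (by simp)
    simp [h.sym_q_s] at this
  · have := H.legendreSym_right (π := q) h.q_ne_two (by simp)
    simp [h.sym_q_neg_one, h.sym_q_two] at this
  · have := H.legendreSym_left (π := s) h.s_ne_two (by simp)
    simp [h.sym_s_two] at this
  · have := H.legendreSym_left (π := s) h.s_ne_two (by simp)
    simp [legendreSym.mul, h.sym_s_two, h.sym_s_q] at this
  · have := H.legendreSym_left (π := q) h.q_ne_two (by simp)
    simp [legendreSym.mul, h.sym_q_two, h.sym_q_s] at this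
  · have := H.legendreSym_right (π := s) h.s_ne_two ⟨2 * q, by ring⟩
    simp [h.sym_s_neg_one] at this

end

end PrimeTriple

end MultiquadraticUnits

/-! ### Action of sign changes on the square roots of units -/

namespace MultiquadraticUnits

/-- The positive square root of a natural number, as a complex number. -/
noncomputable def rt (n : ℕ) : ℂ := ((√(n : ℝ) : ℝ) : ℂ)

theorem rt_sq (n : ℕ) : rt n ^ 2 = n := sq_sqrt_natCast n

theorem rt_mul (a b : ℕ) : rt (a * b) = rt a * rt b := by
  simp [rt, Real.sqrt_mul]

theorem rt_one : rt 1 = 1 := by simp [rt]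

theorem rt_ne_zero {n : ℕ} (hn : n ≠ 0) : rt n ≠ 0 := by
  intro h
  have := rt_sq n
  rw [h] at this
  exact hn (by exact_mod_cast (show (n : ℂ) = 0 by rw [← this]; simp))

theorem conj_rt (n : ℕ) : (starRingEnd ℂ) (rt n) = rt n := Complex.conj_ofReal _

theorem map_rt (σ : ℂ →+* ℂ) (n : ℕ) : σ (rt n) = rt n ∨ σ (rt n) = - rt n := by
  apply sq_eq_sq_iff_eq_or_eq_neg.1
  rw [← map_pow, rt_sq, map_natCast]

theorem prod_squarefree_of_coprime {ι : Type} (n : ι → ℕ) (hn : ∀ i, Squarefree (n i))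
    (hc : Pairwise fun i j => Nat.Coprime (n i) (n j)) (S : Finset ι) :
    Squarefree (∏ i ∈ S, n i) := by
  classical
  induction S using Finset.induction_on with
  | empty => simp
  | insert a S ha ih =>
    rw [Finset.prod_insert ha]
    refine (Nat.squarefree_mul ?_).2 ⟨hn a, ih⟩
    exact Nat.Coprime.prod_right fun i hi => hc fun h => ha (h ▸ hi)

/-- Every choice of signs on square roots of pairwise coprime squarefree numbers is realised. -/
theorem exists_ringHom_rt_signs {ι : Type} [Fintype ι] [DecidableEq ι] (n : ι → ℕ)
    (hn : ∀ i, Squarefree (n i)) (h1 : ∀ i, n i ≠ 1)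
    (hc : Pairwise fun i j => Nat.Coprime (n i) (n j)) (T : Finset ι) :
    ∃ σ : ℂ →+* ℂ, (∀ i ∈ T, σ (rt (n i)) = - rt (n i)) ∧ ∀ i ∉ T, σ (rt (n i)) = rt (n i) := by
  apply exists_ringHom_signs (fun i => rt (n i)) (fun i => (n i : ℚ))
  · intro i; rw [rt_sq]; simp
  · rintro S ⟨i, hi⟩
    rw [← Nat.cast_prod, Rat.isSquare_natCast_iff]
    refine not_isSquare_of_squarefree (prod_squarefree_of_coprime n hn hc S) fun h => ?_
    exact h1 i (Nat.dvd_one.1 (h ▸ Finset.dvd_prod_of_mem n hi))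

/-- The square root of the fundamental unit `ε_m`, as a complex number. -/
noncomputable def rtUnit (m : ℕ) : ℂ := ((√(fundUnit m) : ℝ) : ℂ)

namespace HasSqrtForm

variable {m d d' : ℕ} {σ : ℂ →+* ℂ}

/-- Since d x² - d' y² = 4, inversion of √ε_m is the sign change of √d'. Thus an endomorphism
multiplies √ε_m by the sign it puts on √d, and also inverts it exactly when the signs on √d and √d'
differ; the next four lemmas are the four cases. -/
theorem rtUnit_eq (h : HasSqrtForm m d d') :
    ∃ x y : ℚ, rtUnit m = x * rt d + y * rt d' ∧ (rtUnit m)⁻¹ = x * rt d - y * rt d' := by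
  obtain ⟨x, y, h1, h2⟩ := h
  have he : rtUnit m = (x / 2 : ℂ) * rt d + (y / 2 : ℂ) * rt d' := by
    rw [rtUnit, h1, rt, rt]; push_cast; ring
  refine ⟨x / 2, y / 2, by push_cast; exact he, ?_⟩
  push_cast
  apply inv_eq_of_mul_eq_one_right
  have h3 : (d : ℂ) * x ^ 2 = d' * y ^ 2 + 4 := by exact_mod_cast h2
  rw [he]
  linear_combination (x / 2 : ℂ) ^ 2 * rt_sq d - (y / 2 : ℂ) ^ 2 * rt_sq d' + h3 / 4

theorem map_fix (h : HasSqrtForm m d d') (h1 : σ (rt d) = rt d) (h2 : σ (rt d') = rt d') :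
    σ (rtUnit m) = rtUnit m := by
  obtain ⟨x, y, h3, -⟩ := h.rtUnit_eq
  rw [h3]; simp [h1, h2]

theorem map_neg (h : HasSqrtForm m d d') (h1 : σ (rt d) = -rt d) (h2 : σ (rt d') = -rt d') :
    σ (rtUnit m) = -1 * rtUnit m := by
  obtain ⟨x, y, h3, -⟩ := h.rtUnit_eq
  rw [h3]; simp [h1, h2]; ring

theorem map_inv (h : HasSqrtForm m d d') (h1 : σ (rt d) = rt d) (h2 : σ (rt d') = -rt d') :
    σ (rtUnit m) = (rtUnit m)⁻¹ := by
  obtain ⟨x, y, h3, h4⟩ := h.rtUnit_eq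
  rw [h4, h3]; simp [h1, h2]; ring

theorem map_neg_inv (h : HasSqrtForm m d d') (h1 : σ (rt d) = -rt d) (h2 : σ (rt d') = rt d') :
    σ (rtUnit m) = -1 * (rtUnit m)⁻¹ := by
  obtain ⟨x, y, h3, h4⟩ := h.rtUnit_eq
  rw [h4, h3]; simp [h1, h2]; ring

end HasSqrtForm

/-- Endomorphisms of `ℂ` changing the sign of exactly one of `√2, √p, √q, √s`. -/
structure SignFlips (p q s : ℕ) where
  f2 : ℂ →+* ℂ
  fp : ℂ →+* ℂ
  fq : ℂ →+* ℂ
  fs : ℂ →+* ℂ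
  f2_two : f2 (rt 2) = -rt 2
  f2_p : f2 (rt p) = rt p
  f2_q : f2 (rt q) = rt q
  f2_s : f2 (rt s) = rt s
  fp_two : fp (rt 2) = rt 2
  fp_p : fp (rt p) = -rt p
  fp_q : fp (rt q) = rt q
  fp_s : fp (rt s) = rt s
  fq_two : fq (rt 2) = rt 2
  fq_p : fq (rt p) = rt p
  fq_q : fq (rt q) = -rt q
  fq_s : fq (rt s) = rt s
  fs_two : fs (rt 2) = rt 2
  fs_p : fs (rt p) = rt p
  fs_q : fs (rt q) = rt q
  fs_s : fs (rt s) = -rt s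

attribute [simp] SignFlips.f2_two SignFlips.f2_p SignFlips.f2_q SignFlips.f2_s SignFlips.fp_two
  SignFlips.fp_p SignFlips.fp_q SignFlips.fp_s SignFlips.fq_two SignFlips.fq_p SignFlips.fq_q
  SignFlips.fq_s SignFlips.fs_two SignFlips.fs_p SignFlips.fs_q SignFlips.fs_s

theorem fundUnit_two_pos : 0 < fundUnit 2 :=
  one_pos.trans (one_lt_fundUnit (not_isSquare_of_squarefree Nat.prime_two.squarefree (by norm_num)))

theorem isUnitIn_fundUnit_two : IsUnitIn (quadField 2) (fundUnit 2) :=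
  isUnitIn_fundUnit (not_isSquare_of_squarefree Nat.prime_two.squarefree (by norm_num))

theorem map_fundUnit_two_of_fix {σ : ℂ →+* ℂ} (h : σ (rt 2) = rt 2) :
    σ (fundUnit 2) = fundUnit 2 := by
  obtain ⟨a, b, hab⟩ := mem_quadField_iff.1 isUnitIn_fundUnit_two.2.1
  change _ = a + b * rt 2 at hab
  rw [hab]; simp [h]

/-- This says that ε_2 has norm -1. Its value is not needed: if the norm were 1, every unit ±ε_2^n
would have norm 1, whereas 1 + √2 has norm -1. -/
theorem map_fundUnit_two_of_neg {σ : ℂ →+* ℂ} (h : σ (rt 2) = -rt 2) :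
    σ (fundUnit 2) = -1 * (fundUnit 2 : ℂ)⁻¹ := by
  have hsq := not_isSquare_of_squarefree Nat.prime_two.squarefree (by norm_num)
  have hpos := fundUnit_two_pos
  obtain ⟨a, b, hab, -, hN⟩ := exists_trace_norm_of_isUnitIn hsq isUnitIn_fundUnit_two
  have hab' : (fundUnit 2 : ℂ) = a + b * rt 2 := by rw [hab, rt]; push_cast; rfl
  have h2 : rt 2 ^ 2 = 2 := by rw [rt_sq]; simp
  have h0 : (fundUnit 2 : ℂ) ≠ 0 := by exact_mod_cast hpos.ne'
  have hσ : σ (fundUnit 2) = a - b * rt 2 := by rw [hab']; simp [h]; ring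
  rcases hN with hN | hN
  · exfalso
    have hN' : (a : ℂ) ^ 2 - 2 * b ^ 2 = 1 := by exact_mod_cast hN
    have hinv : σ (fundUnit 2) = (fundUnit 2 : ℂ)⁻¹ := by
      rw [eq_comm]; apply inv_eq_of_mul_eq_one_right
      rw [hσ, hab']; linear_combination hN' - (b : ℂ) ^ 2 * h2
    have hu : IsUnitIn (quadField 2) (1 + rt 2) := by
      have := isUnitIn_of_int_norm (m := 2) (x := 1) (y := 1) (Or.inr (by norm_num))
      convert this using 1
      rw [rt]; push_cast; ring
    have hc : σ (1 + rt 2) * (1 + rt 2) = -1 := by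
      simp [h]; linear_combination -h2
    obtain ⟨n, hn⟩ := exists_zpow_fundUnit hsq hu
    have h3 : (fundUnit 2 : ℂ) ^ n ≠ 0 := zpow_ne_zero _ h0
    have hone : σ (1 + rt 2) * (1 + rt 2) = 1 := by
      rcases hn with hn | hn
      · rw [hn, map_zpow₀, hinv, inv_zpow, inv_mul_cancel₀ h3]
      · rw [hn, _root_.map_neg, map_zpow₀, hinv, inv_zpow, neg_mul_neg, inv_mul_cancel₀ h3]
    rw [hc] at hone
    norm_num at hone
  · have hN' : (a : ℂ) ^ 2 - 2 * b ^ 2 = -1 := by exact_mod_cast hN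
    have : (fundUnit 2 : ℂ) * (-σ (fundUnit 2)) = 1 := by
      rw [hσ, hab']; linear_combination -hN' + (b : ℂ) ^ 2 * h2
    rw [← eq_inv_of_mul_eq_one_right this]; ring

namespace PrimeTriple

variable {p q s : ℕ} [Fact p.Prime] [Fact q.Prime] [Fact s.Prime]

theorem exists_flip (h : PrimeTriple p q s) (T : Finset (Fin 4)) :
    ∃ σ : ℂ →+* ℂ, (∀ i ∈ T, σ (rt (![2, p, q, s] i)) = -rt (![2, p, q, s] i)) ∧
      ∀ i ∉ T, σ (rt (![2, p, q, s] i)) = rt (![2, p, q, s] i) := by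
  have hp : p.Prime := Fact.out
  have hq : q.Prime := Fact.out
  have hs : s.Prime := Fact.out
  have hprime : ∀ i, (![2, p, q, s] i).Prime := by
    intro i; fin_cases i <;> simp [Nat.prime_two, hp, hq, hs]
  refine exists_ringHom_rt_signs _ (fun i => (hprime i).squarefree) (fun i => (hprime i).ne_one)
    (fun i j hij => (Nat.coprime_primes (hprime i) (hprime j)).2 ?_) T
  have h1 := h.p_ne_two
  have h2 := h.q_ne_two
  have h3 := h.s_ne_two
  have h4 := h.p_ne_q
  have h5 := h.p_ne_s
  have h6 := h.q_ne_s
  fin_cases i <;> fin_cases j <;> simp at hij ⊢ <;> tauto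

theorem nonempty_signFlips (h : PrimeTriple p q s) : Nonempty (SignFlips p q s) := by
  obtain ⟨f2, a2, b2⟩ := h.exists_flip {0}
  obtain ⟨fp, ap, bp⟩ := h.exists_flip {1}
  obtain ⟨fq, aq, bq⟩ := h.exists_flip {2}
  obtain ⟨fs, as, bs⟩ := h.exists_flip {3}
  exact ⟨{
    f2 := f2, fp := fp, fq := fq, fs := fs
    f2_two := a2 0 (by simp)
    f2_p := b2 1 (by simp)
    f2_q := b2 2 (by simp)
    f2_s := b2 3 (by simp)
    fp_two := bp 0 (by simp)
    fp_p := ap 1 (by simp)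
    fp_q := bp 2 (by simp)
    fp_s := bp 3 (by simp)
    fq_two := bq 0 (by simp)
    fq_p := bq 1 (by simp)
    fq_q := aq 2 (by simp)
    fq_s := bq 3 (by simp)
    fs_two := bs 0 (by simp)
    fs_p := bs 1 (by simp)
    fs_q := bs 2 (by simp)
    fs_s := as 3 (by simp) }⟩

end PrimeTriple

end MultiquadraticUnits

/-! ### Unit monomials and parity conditions on their exponents -/

namespace MultiquadraticUnits

/-- `ε₂^a ε_{pq}^{A/2} ε_{2pq}^{B/2} ε_{ps}^{C/2} ε_{2ps}^{D/2} ε_{qs}^{E/2} ε_{2qs}^{F/2}`. -/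
noncomputable def unitMonomial (p q s : ℕ) (a A B C D E F : ℤ) : ℂ :=
  (fundUnit 2 : ℂ) ^ a * rtUnit (p * q) ^ A * rtUnit (2 * p * q) ^ B * rtUnit (p * s) ^ C *
    rtUnit (2 * p * s) ^ D * rtUnit (q * s) ^ E * rtUnit (2 * q * s) ^ F

section Lplus

variable {p q s : ℕ}

theorem fieldLplus_eq (p q s : ℕ) :
    fieldLplus p q s = IntermediateField.adjoin ℚ {rt 2, rt (p * q), rt (p * s)} := by
  simp [fieldLplus, rt]

theorem rt_two_mem : rt 2 ∈ fieldLplus p q s := by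
  rw [fieldLplus_eq]; exact IntermediateField.subset_adjoin _ _ (by simp)

theorem rt_pq_mem : rt (p * q) ∈ fieldLplus p q s := by
  rw [fieldLplus_eq]; exact IntermediateField.subset_adjoin _ _ (by simp)

theorem rt_ps_mem : rt (p * s) ∈ fieldLplus p q s := by
  rw [fieldLplus_eq]; exact IntermediateField.subset_adjoin _ _ (by simp)

theorem map_eq_of_mem_fieldLplus {σ τ : ℂ →+* ℂ} (h2 : σ (rt 2) = τ (rt 2))
    (hq : σ (rt (p * q)) = τ (rt (p * q))) (hs : σ (rt (p * s)) = τ (rt (p * s))) {y : ℂ}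
    (hy : y ∈ fieldLplus p q s) : σ y = τ y := by
  rw [fieldLplus_eq] at hy
  exact ringHom_eq_of_mem_adjoin (by simp [h2, hq, hs]) hy

theorem map_mem_fieldLplus (σ : ℂ →+* ℂ) {y : ℂ} (hy : y ∈ fieldLplus p q s) :
    σ y ∈ fieldLplus p q s := by
  have hpm : ∀ n, rt n ∈ fieldLplus p q s → σ (rt n) ∈ fieldLplus p q s := by
    intro n hn
    rcases map_rt σ n with h | h <;> rw [h]
    · exact hn
    · exact neg_mem hn
  have h2 := hpm 2 rt_two_mem
  have h3 := hpm _ rt_pq_mem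
  have h4 := hpm _ rt_ps_mem
  rw [fieldLplus_eq] at hy h2 h3 h4 ⊢
  exact map_mem_adjoin (by simp [h2, h3, h4]) hy

theorem conj_eq_of_mem_fieldLplus {y : ℂ} (hy : y ∈ fieldLplus p q s) : (starRingEnd ℂ) y = y :=
  map_eq_of_mem_fieldLplus (τ := RingHom.id ℂ) (conj_rt _) (conj_rt _) (conj_rt _) hy

theorem exists_real_of_mem_fieldLplus {y : ℂ} (hy : y ∈ fieldLplus p q s) : ∃ r : ℝ, y = r :=
  Complex.conj_eq_iff_real.1 (conj_eq_of_mem_fieldLplus hy)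

theorem map_map_self_of_mem_fieldLplus (σ : ℂ →+* ℂ) {y : ℂ} (hy : y ∈ fieldLplus p q s) :
    σ (σ y) = y := by
  have h : ∀ n, (σ.comp σ) (rt n) = (RingHom.id ℂ) (rt n) := by
    intro n; rcases map_rt σ n with h | h <;> simp [h]
  exact map_eq_of_mem_fieldLplus (h _) (h _) (h _) hy

theorem map_map_comm_of_mem_fieldLplus (σ τ : ℂ →+* ℂ) {y : ℂ} (hy : y ∈ fieldLplus p q s) :
    σ (τ y) = τ (σ y) := by
  have h : ∀ n, (σ.comp τ) (rt n) = (τ.comp σ) (rt n) := by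
    intro n
    rcases map_rt σ n with h | h <;> rcases map_rt τ n with h' | h' <;> simp [h, h']
  exact map_eq_of_mem_fieldLplus (h _) (h _) (h _) hy

end Lplus

/-- The square of a real number is not negative. It is applied to conjugates of elements of L⁺, all
of which are real. -/
theorem even_of_sq_eq {z : ℂ} {r : ℝ} {n : ℤ} (hz : ∃ x : ℝ, z = x) (hr : 0 < r)
    (h : z ^ 2 = (-1) ^ n * r) : Even n := by
  obtain ⟨x, rfl⟩ := hz
  by_contra hn
  rw [Int.not_even_iff_odd] at hn
  rw [hn.neg_one_zpow] at h
  have : x ^ 2 = -1 * r := by exact_mod_cast h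
  nlinarith [sq_nonneg x]

theorem even_of_eq_neg_one_zpow_mul {z : ℂ} {n : ℤ} (hz : z ≠ 0) (h : z = (-1) ^ n * z) :
    Even n := by
  by_contra hn
  rw [Int.not_even_iff_odd] at hn
  rw [hn.neg_one_zpow, neg_one_mul] at h
  exact hz (self_eq_neg.1 h)

namespace PrimeTriple

variable {p q s : ℕ} [Fact p.Prime] [Fact q.Prime] [Fact s.Prime]

section

variable (h : PrimeTriple p q s)
include h

theorem not_isSquare_pq : ¬ IsSquare (p * q) :=
  not_isSquare_of_squarefree (squarefree_mul_of_primes Fact.out Fact.out h.p_ne_q)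
    fun h1 => (Fact.out : p.Prime).ne_one (Nat.eq_one_of_mul_eq_one_right h1)

theorem not_isSquare_ps : ¬ IsSquare (p * s) :=
  not_isSquare_of_squarefree (squarefree_mul_of_primes Fact.out Fact.out h.p_ne_s)
    fun h1 => (Fact.out : p.Prime).ne_one (Nat.eq_one_of_mul_eq_one_right h1)

theorem not_isSquare_qs : ¬ IsSquare (q * s) :=
  not_isSquare_of_squarefree (squarefree_mul_of_primes Fact.out Fact.out h.q_ne_s)
    fun h1 => (Fact.out : q.Prime).ne_one (Nat.eq_one_of_mul_eq_one_right h1)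

theorem not_isSquare_two_pq : ¬ IsSquare (2 * p * q) :=
  not_isSquare_of_squarefree
    (squarefree_two_mul_mul_of_primes Fact.out Fact.out h.p_ne_q h.p_ne_two h.q_ne_two)
    fun h1 => (Fact.out : q.Prime).ne_one (Nat.eq_one_of_mul_eq_one_left h1)

theorem not_isSquare_two_ps : ¬ IsSquare (2 * p * s) :=
  not_isSquare_of_squarefree
    (squarefree_two_mul_mul_of_primes Fact.out Fact.out h.p_ne_s h.p_ne_two h.s_ne_two)
    fun h1 => (Fact.out : s.Prime).ne_one (Nat.eq_one_of_mul_eq_one_left h1)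

theorem not_isSquare_two_qs : ¬ IsSquare (2 * q * s) :=
  not_isSquare_of_squarefree
    (squarefree_two_mul_mul_of_primes Fact.out Fact.out h.q_ne_s h.q_ne_two h.s_ne_two)
    fun h1 => (Fact.out : s.Prime).ne_one (Nat.eq_one_of_mul_eq_one_left h1)

end

end PrimeTriple

theorem sqrt_fundUnit_pos {m : ℕ} (hm : ¬ IsSquare m) : 0 < √(fundUnit m) :=
  Real.sqrt_pos.2 (one_pos.trans (one_lt_fundUnit hm))

theorem rtUnit_ne_zero {m : ℕ} (hm : ¬ IsSquare m) : rtUnit m ≠ 0 := by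
  rw [rtUnit]; exact_mod_cast (sqrt_fundUnit_pos hm).ne'

theorem rtUnit_sq {m : ℕ} (hm : ¬ IsSquare m) : rtUnit m ^ 2 = fundUnit m := by
  rw [rtUnit, ← Complex.ofReal_pow, Real.sq_sqrt (one_pos.trans (one_lt_fundUnit hm)).le]

section Monomial

variable {p q s : ℕ} [Fact p.Prime] [Fact q.Prime] [Fact s.Prime]

theorem unitMonomial_pos (h : PrimeTriple p q s) (a A B C D E F : ℤ) :
    ∃ r : ℝ, 0 < r ∧ unitMonomial p q s a A B C D E F = r := by
  have h2 := fundUnit_two_pos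
  have hA := sqrt_fundUnit_pos h.not_isSquare_pq
  have hB := sqrt_fundUnit_pos h.not_isSquare_two_pq
  have hC := sqrt_fundUnit_pos h.not_isSquare_ps
  have hD := sqrt_fundUnit_pos h.not_isSquare_two_ps
  have hE := sqrt_fundUnit_pos h.not_isSquare_qs
  have hF := sqrt_fundUnit_pos h.not_isSquare_two_qs
  refine ⟨fundUnit 2 ^ a * √(fundUnit (p * q)) ^ A * √(fundUnit (2 * p * q)) ^ B *
    √(fundUnit (p * s)) ^ C * √(fundUnit (2 * p * s)) ^ D * √(fundUnit (q * s)) ^ E *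
    √(fundUnit (2 * q * s)) ^ F, by positivity, ?_⟩
  simp only [unitMonomial, rtUnit]
  push_cast
  rfl

theorem unitMonomial_ne_zero (h : PrimeTriple p q s) (a A B C D E F : ℤ) :
    unitMonomial p q s a A B C D E F ≠ 0 := by
  obtain ⟨r, hr, h1⟩ := unitMonomial_pos h a A B C D E F
  rw [h1]; exact_mod_cast hr.ne'

theorem unitMonomial_mul (h : PrimeTriple p q s) (a A B C D E F a' A' B' C' D' E' F' : ℤ) :
    unitMonomial p q s a A B C D E F * unitMonomial p q s a' A' B' C' D' E' F' =
      unitMonomial p q s (a + a') (A + A') (B + B') (C + C') (D + D') (E + E') (F + F') := by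
  have h2 : (fundUnit 2 : ℂ) ≠ 0 := by exact_mod_cast fundUnit_two_pos.ne'
  simp only [unitMonomial, zpow_add₀ h2, zpow_add₀ (rtUnit_ne_zero h.not_isSquare_pq),
    zpow_add₀ (rtUnit_ne_zero h.not_isSquare_two_pq), zpow_add₀ (rtUnit_ne_zero h.not_isSquare_ps),
    zpow_add₀ (rtUnit_ne_zero h.not_isSquare_two_ps), zpow_add₀ (rtUnit_ne_zero h.not_isSquare_qs),
    zpow_add₀ (rtUnit_ne_zero h.not_isSquare_two_qs)]
  ring

variable (h : PrimeTriple p q s) (f : SignFlips p q s)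
include h f

theorem f2_unitMonomial (a A B C D E F : ℤ) : f.f2 (unitMonomial p q s a A B C D E F) =
    (-1) ^ (a + A + B + C + D) * unitMonomial p q s (-a) A (-B) C (-D) E (-F) := by
  have h2 := map_fundUnit_two_of_neg f.f2_two
  have hA := h.hasSqrtForm_pq.map_neg (σ := f.f2) (by simp [rt_mul]) (by simp [rt_mul])
  have hB := h.hasSqrtForm_two_pq.map_neg_inv (σ := f.f2) (by simp [rt_mul]) (by simp)
  have hC := h.hasSqrtForm_ps.map_neg (σ := f.f2) (by simp [rt_mul]) (by simp [rt_mul])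
  have hD := h.hasSqrtForm_two_ps.map_neg_inv (σ := f.f2) (by simp [rt_mul]) (by simp)
  have hE := h.hasSqrtForm_qs.map_fix (σ := f.f2) (by simp) (by simp)
  have hF := h.hasSqrtForm_two_qs.map_inv (σ := f.f2) (by simp) (by simp [rt_mul])
  simp only [unitMonomial, map_mul, map_zpow₀, h2, hA, hB, hC, hD, hE, hF, mul_zpow, inv_zpow,
    zpow_neg, zpow_add₀ (show (-1 : ℂ) ≠ 0 by norm_num)]
  ring

theorem fp_unitMonomial (a A B C D E F : ℤ) : f.fp (unitMonomial p q s a A B C D E F) =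
    (-1) ^ C * unitMonomial p q s a (-A) (-B) (-C) (-D) E F := by
  have h2 := map_fundUnit_two_of_fix f.fp_two
  have hA := h.hasSqrtForm_pq.map_inv (σ := f.fp) (by simp [rt_mul]) (by simp [rt_mul])
  have hB := h.hasSqrtForm_two_pq.map_inv (σ := f.fp) (by simp [rt_mul]) (by simp)
  have hC := h.hasSqrtForm_ps.map_neg_inv (σ := f.fp) (by simp [rt_mul]) (by simp [rt_mul])
  have hD := h.hasSqrtForm_two_ps.map_inv (σ := f.fp) (by simp [rt_mul]) (by simp)
  have hE := h.hasSqrtForm_qs.map_fix (σ := f.fp) (by simp) (by simp)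
  have hF := h.hasSqrtForm_two_qs.map_fix (σ := f.fp) (by simp) (by simp [rt_mul])
  simp only [unitMonomial, map_mul, map_zpow₀, h2, hA, hB, hC, hD, hE, hF, mul_zpow, inv_zpow,
    zpow_neg]
  ring

theorem fq_unitMonomial (a A B C D E F : ℤ) : f.fq (unitMonomial p q s a A B C D E F) =
    (-1) ^ (A + B + E + F) * unitMonomial p q s a (-A) (-B) C D (-E) (-F) := by
  have h2 := map_fundUnit_two_of_fix f.fq_two
  have hA := h.hasSqrtForm_pq.map_neg_inv (σ := f.fq) (by simp [rt_mul]) (by simp [rt_mul])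
  have hB := h.hasSqrtForm_two_pq.map_neg_inv (σ := f.fq) (by simp [rt_mul]) (by simp)
  have hC := h.hasSqrtForm_ps.map_fix (σ := f.fq) (by simp [rt_mul]) (by simp [rt_mul])
  have hD := h.hasSqrtForm_two_ps.map_fix (σ := f.fq) (by simp [rt_mul]) (by simp)
  have hE := h.hasSqrtForm_qs.map_neg_inv (σ := f.fq) (by simp) (by simp)
  have hF := h.hasSqrtForm_two_qs.map_neg_inv (σ := f.fq) (by simp) (by simp [rt_mul])
  simp only [unitMonomial, map_mul, map_zpow₀, h2, hA, hB, hC, hD, hE, hF, mul_zpow, inv_zpow,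
    zpow_neg, zpow_add₀ (show (-1 : ℂ) ≠ 0 by norm_num)]
  ring

theorem fs_unitMonomial (a A B C D E F : ℤ) : f.fs (unitMonomial p q s a A B C D E F) =
    (-1) ^ D * unitMonomial p q s a A B (-C) (-D) (-E) (-F) := by
  have h2 := map_fundUnit_two_of_fix f.fs_two
  have hA := h.hasSqrtForm_pq.map_fix (σ := f.fs) (by simp [rt_mul]) (by simp [rt_mul])
  have hB := h.hasSqrtForm_two_pq.map_fix (σ := f.fs) (by simp [rt_mul]) (by simp)
  have hC := h.hasSqrtForm_ps.map_inv (σ := f.fs) (by simp [rt_mul]) (by simp [rt_mul])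
  have hD := h.hasSqrtForm_two_ps.map_neg_inv (σ := f.fs) (by simp [rt_mul]) (by simp)
  have hE := h.hasSqrtForm_qs.map_inv (σ := f.fs) (by simp) (by simp)
  have hF := h.hasSqrtForm_two_qs.map_inv (σ := f.fs) (by simp) (by simp [rt_mul])
  simp only [unitMonomial, map_mul, map_zpow₀, h2, hA, hB, hC, hD, hE, hF, mul_zpow, inv_zpow,
    zpow_neg]
  ring

/-- Changing the signs of √p, √q and √s together is the identity on L⁺ but negates each of the six
√ε_m, so it detects whether a monomial lies in L⁺. -/
theorem fpqs_unitMonomial (a A B C D E F : ℤ) :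
    f.fp (f.fq (f.fs (unitMonomial p q s a A B C D E F))) =
      (-1) ^ (A + B + C + D + E + F) * unitMonomial p q s a A B C D E F := by
  rw [fs_unitMonomial h f, map_mul, fq_unitMonomial h f, map_mul, map_mul, fp_unitMonomial h f]
  simp only [map_mul, map_zpow₀, _root_.map_neg, map_one, neg_neg, zpow_neg,
    zpow_add₀ (show (-1 : ℂ) ≠ 0 by norm_num), ← inv_zpow, inv_neg, inv_one]
  ring

/-- Sign constraints on a unit monomial that becomes a square in `L⁺` after multiplication by
`δ ∈ ℚ(√2)`, where `w` is a square root of the norm of `δ` and `f₂(w) = (-1)^k w`. -/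
theorem parity_of_sq_eq {X : ℂ} (hX : X ∈ fieldLplus p q s) {δ δ' w : ℝ} {k : ℤ}
    (hδ : 0 < δ) (hδ' : 0 < δ') (hw : w ^ 2 = δ * δ')
    (h2 : f.f2 δ = δ') (hp : f.fp δ = δ) (hq : f.fq δ = δ) (hs : f.fs δ = δ)
    (w2 : f.f2 w = (-1) ^ k * w) (wp : f.fp w = w) (wq : f.fq w = w) (ws : f.fs w = w)
    {a A B C D E F : ℤ} (hXY : X ^ 2 = δ * unitMonomial p q s a A B C D E F) :
    Even C ∧ Even D ∧ Even (A + B) ∧ Even (A + B + E + F) ∧ Even (a + A + B + C + D) ∧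
      Even (k + A + C) ∧ Even (A + C + E) := by
  have hw0 : (w : ℂ) ≠ 0 := by
    have : w ≠ 0 := by rintro rfl; nlinarith [mul_pos hδ hδ']
    exact_mod_cast this
  have hδ0 : (δ : ℂ) ≠ 0 := by exact_mod_cast hδ.ne'
  have hreal : ∀ σ : ℂ →+* ℂ, ∃ x : ℝ, σ X = x := fun σ =>
    exists_real_of_mem_fieldLplus (map_mem_fieldLplus σ hX)
  have hC : Even C := by
    obtain ⟨r, hr, h1⟩ := unitMonomial_pos h a (-A) (-B) (-C) (-D) E F
    apply even_of_sq_eq (hreal f.fp) (mul_pos hδ hr)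
    rw [← map_pow, hXY, map_mul, fp_unitMonomial h f, hp, h1]; push_cast; ring
  have hD : Even D := by
    obtain ⟨r, hr, h1⟩ := unitMonomial_pos h a A B (-C) (-D) (-E) (-F)
    apply even_of_sq_eq (hreal f.fs) (mul_pos hδ hr)
    rw [← map_pow, hXY, map_mul, fs_unitMonomial h f, hs, h1]; push_cast; ring
  have hABEF : Even (A + B + E + F) := by
    obtain ⟨r, hr, h1⟩ := unitMonomial_pos h a (-A) (-B) C D (-E) (-F)
    apply even_of_sq_eq (hreal f.fq) (mul_pos hδ hr)
    rw [← map_pow, hXY, map_mul, fq_unitMonomial h f, hq, h1]; push_cast; ring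
  have haABCD : Even (a + A + B + C + D) := by
    obtain ⟨r, hr, h1⟩ := unitMonomial_pos h (-a) A (-B) C (-D) E (-F)
    apply even_of_sq_eq (hreal f.f2) (mul_pos hδ' hr)
    rw [← map_pow, hXY, map_mul, f2_unitMonomial h f, h2, h1]; push_cast; ring
  -- The relative norm X·`fs`(X) is ±δ times the part of the monomial in a, A, B. On L⁺ the map `fs`
  -- agrees with `fp` ∘ `fq`, so the norm is fixed by the latter, which multiplies that part by
  -- (-1)^(A + B).
  have hAB : Even (A + B) := by
    have hV : (X * f.fs X) ^ 2 = (δ * unitMonomial p q s a A B 0 0 0 0) ^ 2 := by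
      rw [mul_pow, ← map_pow, hXY, map_mul, hs, fs_unitMonomial h f, hD.neg_one_zpow, one_mul,
        mul_mul_mul_comm, unitMonomial_mul h, mul_pow, sq (unitMonomial _ _ _ _ _ _ _ _ _ _),
        unitMonomial_mul h]
      simp only [add_neg_cancel, add_zero]; ring
    have hfix : f.fp (f.fq (X * f.fs X)) = X * f.fs X := by
      have h1 : f.fp (f.fq X) = f.fs X :=
        map_eq_of_mem_fieldLplus (σ := f.fp.comp f.fq) (by simp) (by simp [rt_mul])
          (by simp [rt_mul]) hX
      have h3 := map_map_self_of_mem_fieldLplus f.fs hX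
      rw [map_mul, map_mul, h1, map_map_comm_of_mem_fieldLplus f.fq f.fs hX,
        map_map_comm_of_mem_fieldLplus f.fp f.fs (map_mem_fieldLplus _ hX), h1, h3, mul_comm]
    have hfV : f.fp (f.fq (δ * unitMonomial p q s a A B 0 0 0 0)) =
        (-1) ^ (A + B) * (δ * unitMonomial p q s a A B 0 0 0 0) := by
      rw [map_mul, hq, map_mul, hp, fq_unitMonomial h f, map_mul, fp_unitMonomial h f]
      simp; ring
    apply even_of_eq_neg_one_zpow_mul (mul_ne_zero hδ0 (unitMonomial_ne_zero h a A B 0 0 0 0))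
    rw [← hfV]
    rcases sq_eq_sq_iff_eq_or_eq_neg.1 hV with h1 | h1
    · rw [← h1, hfix]
    · rw [eq_neg_iff_add_eq_zero, add_comm, ← eq_neg_iff_add_eq_zero] at h1
      rw [h1, _root_.map_neg, _root_.map_neg, hfix]
  -- The relative norm X·`f2`(X) is ±w times the part in A, C, E. The last two conditions express
  -- that it is fixed by `f2` and by `fp` ∘ `fq` ∘ `fs`.
  have hV : (X * f.f2 X) ^ 2 = (w * unitMonomial p q s 0 A 0 C 0 E 0) ^ 2 := by
    have hw' : (w : ℂ) ^ 2 = δ * δ' := by exact_mod_cast hw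
    rw [mul_pow, ← map_pow, hXY, map_mul, h2, f2_unitMonomial h f, haABCD.neg_one_zpow, one_mul,
      mul_mul_mul_comm, unitMonomial_mul h, mul_pow, sq (unitMonomial _ _ _ _ _ _ _ _ _ _),
      unitMonomial_mul h, hw']
    simp only [add_neg_cancel, add_zero]
  have hV0 := mul_ne_zero hw0 (unitMonomial_ne_zero h 0 A 0 C 0 E 0)
  have hpm : w * unitMonomial p q s 0 A 0 C 0 E 0 = X * f.f2 X ∨
      w * unitMonomial p q s 0 A 0 C 0 E 0 = -(X * f.f2 X) :=
    sq_eq_sq_iff_eq_or_eq_neg.1 hV.symm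
  refine ⟨hC, hD, hAB, hABEF, haABCD, ?_, ?_⟩
  · have hfix : f.f2 (X * f.f2 X) = X * f.f2 X := by
      rw [map_mul, map_map_self_of_mem_fieldLplus f.f2 hX, mul_comm]
    have hfV : f.f2 (w * unitMonomial p q s 0 A 0 C 0 E 0) =
        (-1) ^ (k + A + C) * (w * unitMonomial p q s 0 A 0 C 0 E 0) := by
      rw [map_mul, w2, f2_unitMonomial h f]
      simp [zpow_add₀ (show (-1 : ℂ) ≠ 0 by norm_num)]; ring
    apply even_of_eq_neg_one_zpow_mul hV0
    rw [← hfV]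
    rcases hpm with h1 | h1
    · rw [h1, hfix]
    · rw [h1, _root_.map_neg, hfix]
  · have hfix : ∀ {y : ℂ}, y ∈ fieldLplus p q s → f.fp (f.fq (f.fs y)) = y := fun hy =>
      map_eq_of_mem_fieldLplus (σ := f.fp.comp (f.fq.comp f.fs)) (τ := RingHom.id ℂ) (by simp)
        (by simp [rt_mul]) (by simp [rt_mul]) hy
    have hmem := mul_mem hX (map_mem_fieldLplus f.f2 hX)
    have hfV : f.fp (f.fq (f.fs (w * unitMonomial p q s 0 A 0 C 0 E 0))) =
        (-1) ^ (A + C + E) * (w * unitMonomial p q s 0 A 0 C 0 E 0) := by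
      rw [map_mul, map_mul, map_mul, ws, wq, wp, fpqs_unitMonomial h f]
      simp; ring
    apply even_of_eq_neg_one_zpow_mul hV0
    rw [← hfV]
    rcases hpm with h1 | h1
    · rw [h1, hfix hmem]
    · rw [h1, hfix (neg_mem hmem)]

end Monomial

end MultiquadraticUnits

/-! ### Monomials lying in L⁺, and coordinates on L⁺ -/

namespace MultiquadraticUnits

variable {p q s : ℕ}

theorem ratCast_mem (K : IntermediateField ℚ ℂ) (a : ℚ) : (a : ℂ) ∈ K := by
  simp

theorem HasSqrtForm.rt_mul_rtUnit_mem {m d d' : ℕ} (h : HasSqrtForm m d d')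
    {K : IntermediateField ℚ ℂ} {θ : ℂ} (hd : θ * rt d ∈ K) (hd' : θ * rt d' ∈ K) :
    θ * rtUnit m ∈ K := by
  obtain ⟨x, y, h1, -⟩ := h.rtUnit_eq
  rw [h1, show θ * (x * rt d + y * rt d') = x * (θ * rt d) + y * (θ * rt d') by ring]
  exact add_mem (mul_mem (ratCast_mem K x) hd) (mul_mem (ratCast_mem K y) hd')

theorem isUnitIn_top_rtUnit {m : ℕ} (hm : ¬ IsSquare m) : IsUnitIn ⊤ (rtUnit m) := by
  refine IsUnitIn.of_pow two_pos IntermediateField.mem_top ?_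
  rw [rtUnit_sq hm]
  exact (isUnitIn_fundUnit hm).mono le_top

theorem quadField_two_le : quadField 2 ≤ fieldLplus p q s := by
  rw [quadField, IntermediateField.adjoin_simple_le_iff]
  exact rt_two_mem

section Monomial

variable [Fact p.Prime] [Fact q.Prime] [Fact s.Prime]

/-- In each form of √ε_m, the products √p√d and √p√d' lie in L⁺, hence so does √p√ε_m. An even
exponent sum leaves only powers of p to divide out. -/
theorem unitMonomial_mem (h : PrimeTriple p q s) {a A B C D E F : ℤ}
    (hsum : Even (A + B + C + D + E + F)) :
    unitMonomial p q s a A B C D E F ∈ fieldLplus p q s := by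
  have hp0 : rt p ≠ 0 := rt_ne_zero (Fact.out : p.Prime).ne_zero
  have hpp : rt p * rt p ∈ fieldLplus p q s := by
    rw [← sq, rt_sq]; exact natCast_mem _ p
  have h2p : rt p * rt (2 * p) ∈ fieldLplus p q s := by
    rw [rt_mul, mul_left_comm]; exact mul_mem rt_two_mem hpp
  have hpq : rt p * rt q ∈ fieldLplus p q s := by rw [← rt_mul]; exact rt_pq_mem
  have hps : rt p * rt s ∈ fieldLplus p q s := by rw [← rt_mul]; exact rt_ps_mem
  have h2q : rt p * rt (2 * q) ∈ fieldLplus p q s := by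
    rw [rt_mul, mul_left_comm]; exact mul_mem rt_two_mem hpq
  have h2s : rt p * rt (2 * s) ∈ fieldLplus p q s := by
    rw [rt_mul, mul_left_comm]; exact mul_mem rt_two_mem hps
  have h2 := quadField_two_le (p := p) (q := q) (s := s) isUnitIn_fundUnit_two.2.1
  have hA := h.hasSqrtForm_pq.rt_mul_rtUnit_mem h2q h2p
  have hB := h.hasSqrtForm_two_pq.rt_mul_rtUnit_mem h2q hpp
  have hC := h.hasSqrtForm_ps.rt_mul_rtUnit_mem h2p h2s
  have hD := h.hasSqrtForm_two_ps.rt_mul_rtUnit_mem h2s hpp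
  have hE := h.hasSqrtForm_qs.rt_mul_rtUnit_mem hpq hps
  have hF := h.hasSqrtForm_two_qs.rt_mul_rtUnit_mem hpq h2s
  obtain ⟨k, hk⟩ := hsum
  have hpk : rt p ^ (A + B + C + D + E + F) = (rt p * rt p) ^ k := by
    rw [hk, mul_zpow, zpow_add₀ hp0]
  have key : unitMonomial p q s a A B C D E F * (rt p * rt p) ^ k =
      (fundUnit 2 : ℂ) ^ a * (rt p * rtUnit (p * q)) ^ A * (rt p * rtUnit (2 * p * q)) ^ B *
        (rt p * rtUnit (p * s)) ^ C * (rt p * rtUnit (2 * p * s)) ^ D *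
        (rt p * rtUnit (q * s)) ^ E * (rt p * rtUnit (2 * q * s)) ^ F := by
    rw [← hpk]
    simp only [unitMonomial, mul_zpow, zpow_add₀ hp0]
    ring
  rw [← eq_mul_inv_iff_mul_eq₀ (zpow_ne_zero _ (mul_ne_zero hp0 hp0))] at key
  rw [key]
  have hz : ∀ {x : ℂ} (n : ℤ), x ∈ fieldLplus p q s → x ^ n ∈ fieldLplus p q s :=
    fun n hx => zpow_mem hx n
  exact mul_mem (mul_mem (mul_mem (mul_mem (mul_mem (mul_mem (mul_mem (hz _ h2) (hz _ hA)) (hz _ hB))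
    (hz _ hC)) (hz _ hD)) (hz _ hE)) (hz _ hF)) (inv_mem (hz _ hpp))

theorem isUnitIn_unitMonomial (h : PrimeTriple p q s) {a A B C D E F : ℤ}
    (hsum : Even (A + B + C + D + E + F)) :
    IsUnitIn (fieldLplus p q s) (unitMonomial p q s a A B C D E F) := by
  have htop : IsUnitIn ⊤ (unitMonomial p q s a A B C D E F) :=
    ((((((((isUnitIn_fundUnit_two.mono le_top).zpow a).mul
      ((isUnitIn_top_rtUnit h.not_isSquare_pq).zpow A)).mul
      ((isUnitIn_top_rtUnit h.not_isSquare_two_pq).zpow B)).mul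
      ((isUnitIn_top_rtUnit h.not_isSquare_ps).zpow C)).mul
      ((isUnitIn_top_rtUnit h.not_isSquare_two_ps).zpow D)).mul
      ((isUnitIn_top_rtUnit h.not_isSquare_qs).zpow E)).mul
      ((isUnitIn_top_rtUnit h.not_isSquare_two_qs).zpow F))
  exact ⟨htop.1, unitMonomial_mem h hsum, htop.2.2⟩

theorem sum_even_of_unitMonomial_mem (h : PrimeTriple p q s) {a A B C D E F : ℤ}
    (hmem : unitMonomial p q s a A B C D E F ∈ fieldLplus p q s) :
    Even (A + B + C + D + E + F) := by
  obtain ⟨f⟩ := h.nonempty_signFlips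
  apply even_of_eq_neg_one_zpow_mul (unitMonomial_ne_zero h a A B C D E F)
  rw [← fpqs_unitMonomial h f]
  exact (map_eq_of_mem_fieldLplus (σ := f.fp.comp (f.fq.comp f.fs)) (τ := RingHom.id ℂ) (by simp)
        (by simp [rt_mul]) (by simp [rt_mul]) hmem).symm

end Monomial

/-- Coordinates of an element of `L⁺`. -/
theorem exists_coords_of_mem_fieldLplus {y : ℂ} (hy : y ∈ fieldLplus p q s) :
    ∃ c₀ c₁ c₂ c₃ c₄ c₅ c₆ c₇ : ℚ, y = c₀ + c₁ * rt 2 + c₂ * rt (p * q) +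
      c₃ * (rt 2 * rt (p * q)) + c₄ * rt (p * s) + c₅ * (rt 2 * rt (p * s)) +
      c₆ * (rt (p * q) * rt (p * s)) + c₇ * (rt 2 * rt (p * q) * rt (p * s)) := by
  have hsq : ∀ (S : Set ℂ) n, rt n ^ 2 ∈ IntermediateField.adjoin ℚ S := fun S n => by
    rw [rt_sq]; exact natCast_mem _ n
  have h1 : ∀ y ∈ IntermediateField.adjoin ℚ ({rt (p * s)} : Set ℂ),
      ∃ a b : ℚ, y = a + b * rt (p * s) := fun y hy => mem_quadField_iff.1 hy
  have h2 : ∀ y ∈ IntermediateField.adjoin ℚ ({rt (p * q), rt (p * s)} : Set ℂ),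
      ∃ a b c d : ℚ, y = a + b * rt (p * s) + (c + d * rt (p * s)) * rt (p * q) := by
    intro y hy
    obtain ⟨u, hu, v, hv, rfl⟩ := exists_eq_add_mul_of_mem_adjoin_insert (hsq _ _) hy
    obtain ⟨a, b, rfl⟩ := h1 u hu
    obtain ⟨c, d, rfl⟩ := h1 v hv
    exact ⟨a, b, c, d, rfl⟩
  rw [fieldLplus_eq] at hy
  obtain ⟨u, hu, v, hv, rfl⟩ := exists_eq_add_mul_of_mem_adjoin_insert (hsq _ _) hy
  obtain ⟨a, b, c, d, rfl⟩ := h2 u hu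
  obtain ⟨a', b', c', d', rfl⟩ := h2 v hv
  exact ⟨a, a', c, c', b, b', d, d', by ring⟩

/-- Averaging over the group generated by two endomorphisms fixing `y`. -/
theorem exists_coords_of_fixed {y : ℂ} (hy : y ∈ fieldLplus p q s) {σ τ : ℂ →+* ℂ}
    (hσ : σ y = y) (hτ : τ y = y) {a b c a' b' c' : ℂ}
    (ha : σ (rt 2) = a * rt 2) (hb : σ (rt (p * q)) = b * rt (p * q))
    (hc : σ (rt (p * s)) = c * rt (p * s))
    (ha' : τ (rt 2) = a' * rt 2) (hb' : τ (rt (p * q)) = b' * rt (p * q))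
    (hc' : τ (rt (p * s)) = c' * rt (p * s)) :
    ∃ c₀ c₁ c₂ c₃ c₄ c₅ c₆ c₇ : ℚ, 4 * y = 4 * c₀ + (1 + a) * (1 + a') * c₁ * rt 2 +
      (1 + b) * (1 + b') * c₂ * rt (p * q) +
      (1 + a * b) * (1 + a' * b') * c₃ * (rt 2 * rt (p * q)) +
      (1 + c) * (1 + c') * c₄ * rt (p * s) +
      (1 + a * c) * (1 + a' * c') * c₅ * (rt 2 * rt (p * s)) +
      (1 + b * c) * (1 + b' * c') * c₆ * (rt (p * q) * rt (p * s)) +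
      (1 + a * b * c) * (1 + a' * b' * c') * c₇ * (rt 2 * rt (p * q) * rt (p * s)) := by
  obtain ⟨c₀, c₁, c₂, c₃, c₄, c₅, c₆, c₇, h⟩ := exists_coords_of_mem_fieldLplus hy
  refine ⟨c₀, c₁, c₂, c₃, c₄, c₅, c₆, c₇, ?_⟩
  -- The multipliers are given as complex numbers; they equal ±1 when the square root is nonzero, so
  -- σ fixes them.
  have hpm : ∀ n (e : ℂ), τ (rt n) = e * rt n → rt n ≠ 0 → σ e = e := by
    intro n e he h0
    rcases map_rt τ n with h1 | h1
    · have : e = 1 := mul_right_cancel₀ h0 (by rw [← he, h1, one_mul])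
      simp [this]
    · have : e = -1 := mul_right_cancel₀ h0 (by rw [← he, h1, neg_one_mul])
      simp [this]
  have h1 := congrArg σ h
  have h2 := congrArg τ h
  have h3 := congrArg σ h2
  have hcomm : ∀ n (e e' : ℂ), σ (rt n) = e * rt n → τ (rt n) = e' * rt n →
      σ (e' * rt n) = e * e' * rt n := by
    intro n e e' he he'
    by_cases h0 : rt n = 0
    · simp [h0]
    · rw [map_mul, hpm n e' he' h0, he]; ring
  have k1 := hcomm _ _ _ ha ha'
  have k2 := hcomm _ _ _ hb hb'
  have k3 := hcomm _ _ _ hc hc'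
  simp only [map_add, map_mul, map_ratCast, ha, hb, hc, ha', hb', hc'] at h1 h2 h3 k1 k2 k3
  simp only [k1, k2, k3] at h3
  rw [hσ] at h1
  rw [hτ] at h2
  rw [hτ, hσ] at h3
  -- Sum of the four conjugate expansions of y. A factor (1 + a)(1 + a') with a, a' = ±1 vanishes
  -- unless both are 1, which leaves only the basis elements fixed by σ and τ.
  linear_combination h + h1 + h2 + h3

end MultiquadraticUnits

/-! ### Norms to the quadratic subfields and the units of L⁺ -/

namespace MultiquadraticUnits

variable {p q s : ℕ}

/-- The product of the conjugates of `x` under the group generated by `σ` and `τ`. -/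
def normUnder (σ τ : ℂ →+* ℂ) (x : ℂ) : ℂ := x * σ x * τ x * σ (τ x)

theorem IsUnitIn.map_fieldLplus {x : ℂ} (hx : IsUnitIn (fieldLplus p q s) x) (σ : ℂ →+* ℂ) :
    IsUnitIn (fieldLplus p q s) (σ x) :=
  ⟨(map_ne_zero σ).2 hx.1, map_mem_fieldLplus σ hx.2.1, isIntegral_map hx.2.2.1, by
    rw [← map_inv₀]; exact isIntegral_map hx.2.2.2⟩

theorem isUnitIn_normUnder {x : ℂ} (hx : IsUnitIn (fieldLplus p q s) x) (σ τ : ℂ →+* ℂ) :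
    IsUnitIn (fieldLplus p q s) (normUnder σ τ x) :=
  ((hx.mul (hx.map_fieldLplus σ)).mul (hx.map_fieldLplus τ)).mul
    ((hx.map_fieldLplus τ).map_fieldLplus σ)

theorem map_normUnder_left {x : ℂ} (hx : x ∈ fieldLplus p q s) (σ τ : ℂ →+* ℂ) :
    σ (normUnder σ τ x) = normUnder σ τ x := by
  simp only [normUnder, map_mul, map_map_self_of_mem_fieldLplus σ hx,
    map_map_self_of_mem_fieldLplus σ (map_mem_fieldLplus τ hx)]
  ring

theorem map_normUnder_right {x : ℂ} (hx : x ∈ fieldLplus p q s) (σ τ : ℂ →+* ℂ) :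
    τ (normUnder σ τ x) = normUnder σ τ x := by
  simp only [normUnder, map_mul, map_map_self_of_mem_fieldLplus τ hx,
    map_map_comm_of_mem_fieldLplus τ σ hx,
    map_map_comm_of_mem_fieldLplus τ σ (map_mem_fieldLplus τ hx)]
  ring

/-- If `normUnder σ τ` takes values in `ℚ(√m)`, it takes units to `±ε_m^ℤ`. -/
theorem exists_zpow_of_normUnder {m : ℕ} (hm : ¬ IsSquare m) {x : ℂ}
    (hx : IsUnitIn (fieldLplus p q s) x) {σ τ : ℂ →+* ℂ}
    (h : ∀ y ∈ fieldLplus p q s, σ y = y → τ y = y → ∃ a b : ℚ, 4 * y = a + b * rt m) :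
    ∃ n : ℤ, normUnder σ τ x = (fundUnit m : ℂ) ^ n ∨ normUnder σ τ x = -(fundUnit m : ℂ) ^ n := by
  have hN := isUnitIn_normUnder hx σ τ
  apply exists_zpow_fundUnit hm
  refine ⟨hN.1, ?_, hN.2.2⟩
  obtain ⟨a, b, hab⟩ := h _ hN.2.1 (map_normUnder_left hx.2.1 σ τ) (map_normUnder_right hx.2.1 σ τ)
  refine mem_quadField_iff.2 ⟨a / 4, b / 4, ?_⟩
  change _ = _ + _ * rt m
  push_cast
  linear_combination hab / 4

section

variable (f : SignFlips p q s) {x : ℂ} (hx : IsUnitIn (fieldLplus p q s) x)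
include hx

theorem exists_norm_two : ∃ n : ℤ, normUnder f.fq f.fs x = (fundUnit 2 : ℂ) ^ n ∨
    normUnder f.fq f.fs x = -(fundUnit 2 : ℂ) ^ n := by
  refine exists_zpow_of_normUnder
    (not_isSquare_of_squarefree Nat.prime_two.squarefree (by norm_num)) hx fun y hy h1 h2 => ?_
  obtain ⟨c₀, c₁, c₂, c₃, c₄, c₅, c₆, c₇, hc⟩ := exists_coords_of_fixed hy h1 h2
    (a := 1) (b := -1) (c := 1) (a' := 1) (b' := 1) (c' := -1) (by simp) (by simp [rt_mul])
    (by simp [rt_mul]) (by simp) (by simp [rt_mul]) (by simp [rt_mul])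
  refine ⟨4 * c₀, 4 * c₁, ?_⟩
  rw [hc]; push_cast; ring

/-- The seven factors are the norms for the seven subgroups of order 4 of (ℤ/2)³. The identity lies
in all seven and every other element in exactly three, so the product is x⁷ times the cubes of the
other conjugates, that is, x⁴ times the cube of the full norm. -/
theorem prod_normUnder :
    normUnder f.fq f.fs x * normUnder f.f2 f.fs x * normUnder (f.f2.comp f.fq) f.fs x *
      normUnder f.f2 f.fq x * normUnder (f.f2.comp f.fs) f.fq x *
      normUnder f.f2 (f.fq.comp f.fs) x * normUnder (f.f2.comp f.fq) (f.fq.comp f.fs) x =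
    x ^ 4 * (normUnder f.fq f.fs x * f.f2 (normUnder f.fq f.fs x)) ^ 3 := by
  have h1 : f.fs (f.fq x) = f.fq (f.fs x) := map_map_comm_of_mem_fieldLplus _ _ hx.2.1
  have h2 : f.fq (f.fq (f.fs x)) = f.fs x :=
    map_map_self_of_mem_fieldLplus f.fq (map_mem_fieldLplus f.fs hx.2.1)
  simp only [normUnder, RingHom.comp_apply, map_mul, h1, h2]
  ring

end

section

variable [Fact p.Prime] [Fact q.Prime] [Fact s.Prime] (h : PrimeTriple p q s) (f : SignFlips p q s)
  {x : ℂ} (hx : IsUnitIn (fieldLplus p q s) x)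
include h f hx

theorem exists_norm_pq : ∃ n : ℤ, normUnder f.f2 f.fs x = (fundUnit (p * q) : ℂ) ^ n ∨
    normUnder f.f2 f.fs x = -(fundUnit (p * q) : ℂ) ^ n := by
  refine exists_zpow_of_normUnder h.not_isSquare_pq hx fun y hy h1 h2 => ?_
  obtain ⟨c₀, c₁, c₂, c₃, c₄, c₅, c₆, c₇, hc⟩ := exists_coords_of_fixed hy h1 h2
    (a := -1) (b := 1) (c := 1) (a' := 1) (b' := 1) (c' := -1) (by simp) (by simp [rt_mul])
    (by simp [rt_mul]) (by simp) (by simp [rt_mul]) (by simp [rt_mul])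
  refine ⟨4 * c₀, 4 * c₂, ?_⟩
  rw [hc]; push_cast; ring

theorem exists_norm_ps : ∃ n : ℤ, normUnder f.f2 f.fq x = (fundUnit (p * s) : ℂ) ^ n ∨
    normUnder f.f2 f.fq x = -(fundUnit (p * s) : ℂ) ^ n := by
  refine exists_zpow_of_normUnder h.not_isSquare_ps hx fun y hy h1 h2 => ?_
  obtain ⟨c₀, c₁, c₂, c₃, c₄, c₅, c₆, c₇, hc⟩ := exists_coords_of_fixed hy h1 h2
    (a := -1) (b := 1) (c := 1) (a' := 1) (b' := -1) (c' := 1) (by simp) (by simp [rt_mul])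
    (by simp [rt_mul]) (by simp) (by simp [rt_mul]) (by simp [rt_mul])
  refine ⟨4 * c₀, 4 * c₄, ?_⟩
  rw [hc]; push_cast; ring

theorem exists_norm_two_pq :
    ∃ n : ℤ, normUnder (f.f2.comp f.fq) f.fs x = (fundUnit (2 * p * q) : ℂ) ^ n ∨
      normUnder (f.f2.comp f.fq) f.fs x = -(fundUnit (2 * p * q) : ℂ) ^ n := by
  refine exists_zpow_of_normUnder h.not_isSquare_two_pq hx fun y hy h1 h2 => ?_
  obtain ⟨c₀, c₁, c₂, c₃, c₄, c₅, c₆, c₇, hc⟩ := exists_coords_of_fixed hy h1 h2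
    (a := -1) (b := -1) (c := 1) (a' := 1) (b' := 1) (c' := -1) (by simp) (by simp [rt_mul])
    (by simp [rt_mul]) (by simp) (by simp [rt_mul]) (by simp [rt_mul])
  refine ⟨4 * c₀, 4 * c₃, ?_⟩
  rw [hc, mul_assoc 2 p q, rt_mul 2]; push_cast; ring

theorem exists_norm_two_ps :
    ∃ n : ℤ, normUnder (f.f2.comp f.fs) f.fq x = (fundUnit (2 * p * s) : ℂ) ^ n ∨
      normUnder (f.f2.comp f.fs) f.fq x = -(fundUnit (2 * p * s) : ℂ) ^ n := by
  refine exists_zpow_of_normUnder h.not_isSquare_two_ps hx fun y hy h1 h2 => ?_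
  obtain ⟨c₀, c₁, c₂, c₃, c₄, c₅, c₆, c₇, hc⟩ := exists_coords_of_fixed hy h1 h2
    (a := -1) (b := 1) (c := -1) (a' := 1) (b' := -1) (c' := 1) (by simp) (by simp [rt_mul])
    (by simp [rt_mul]) (by simp) (by simp [rt_mul]) (by simp [rt_mul])
  refine ⟨4 * c₀, 4 * c₅, ?_⟩
  rw [hc, mul_assoc 2 p s, rt_mul 2]; push_cast; ring

theorem exists_norm_qs :
    ∃ n : ℤ, normUnder f.f2 (f.fq.comp f.fs) x = (fundUnit (q * s) : ℂ) ^ n ∨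
      normUnder f.f2 (f.fq.comp f.fs) x = -(fundUnit (q * s) : ℂ) ^ n := by
  refine exists_zpow_of_normUnder h.not_isSquare_qs hx fun y hy h1 h2 => ?_
  obtain ⟨c₀, c₁, c₂, c₃, c₄, c₅, c₆, c₇, hc⟩ := exists_coords_of_fixed hy h1 h2
    (a := -1) (b := 1) (c := 1) (a' := 1) (b' := -1) (c' := -1) (by simp) (by simp [rt_mul])
    (by simp [rt_mul]) (by simp) (by simp [rt_mul]) (by simp [rt_mul])
  -- The factor p comes from √(pq)·√(ps) = p√(qs).
  refine ⟨4 * c₀, 4 * c₆ * p, ?_⟩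
  rw [hc]; push_cast; rw [← rt_sq p]; simp only [rt_mul]; ring

theorem exists_norm_two_qs :
    ∃ n : ℤ,
      normUnder (f.f2.comp f.fq) (f.fq.comp f.fs) x = (fundUnit (2 * q * s) : ℂ) ^ n ∨
      normUnder (f.f2.comp f.fq) (f.fq.comp f.fs) x = -(fundUnit (2 * q * s) : ℂ) ^ n := by
  refine exists_zpow_of_normUnder h.not_isSquare_two_qs hx fun y hy h1 h2 => ?_
  obtain ⟨c₀, c₁, c₂, c₃, c₄, c₅, c₆, c₇, hc⟩ := exists_coords_of_fixed hy h1 h2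
    (a := -1) (b := -1) (c := 1) (a' := 1) (b' := -1) (c' := -1) (by simp) (by simp [rt_mul])
    (by simp [rt_mul]) (by simp) (by simp [rt_mul]) (by simp [rt_mul])
  refine ⟨4 * c₀, 4 * c₇ * p, ?_⟩
  rw [hc]; push_cast; rw [← rt_sq p]; simp only [rt_mul]; ring

/-- Each of the seven norms is ±ε_m^k and the full norm is ±1, so x⁴ is ± a monomial; x is real, so
the sign is +. The exponents of the √ε_m are doubled because powers of ε_m itself occur. -/
theorem exists_pow_four_eq :
    ∃ n A B C D E F : ℤ, x ^ 4 = unitMonomial p q s n (2 * A) (2 * B) (2 * C) (2 * D) (2 * E) (2 * F) := by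
  obtain ⟨n, hn⟩ := exists_norm_two f hx
  obtain ⟨A, hA⟩ := exists_norm_pq h f hx
  obtain ⟨B, hB⟩ := exists_norm_two_pq h f hx
  obtain ⟨C, hC⟩ := exists_norm_ps h f hx
  obtain ⟨D, hD⟩ := exists_norm_two_ps h f hx
  obtain ⟨E, hE⟩ := exists_norm_qs h f hx
  obtain ⟨F, hF⟩ := exists_norm_two_qs h f hx
  refine ⟨n, A, B, C, D, E, F, ?_⟩
  have hP := prod_normUnder f hx
  have h0 : (fundUnit 2 : ℂ) ≠ 0 := by exact_mod_cast fundUnit_two_pos.ne'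
  have hN : normUnder f.fq f.fs x * f.f2 (normUnder f.fq f.fs x) = 1 ∨
      normUnder f.fq f.fs x * f.f2 (normUnder f.fq f.fs x) = -1 := by
    have h1 : (fundUnit 2 : ℂ) ^ n * f.f2 ((fundUnit 2 : ℂ) ^ n) = (-1) ^ n := by
      rw [map_zpow₀, map_fundUnit_two_of_neg f.f2_two, mul_zpow, inv_zpow, mul_left_comm,
        mul_inv_cancel₀ (zpow_ne_zero _ h0), mul_one]
    have h2 : normUnder f.fq f.fs x * f.f2 (normUnder f.fq f.fs x) = (-1) ^ n := by
      rcases hn with hn | hn <;> rw [hn]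
      · exact h1
      · rw [_root_.map_neg, neg_mul_neg]; exact h1
    rw [h2]
    rcases Int.even_or_odd n with hn | hn
    · exact Or.inl hn.neg_one_zpow
    · exact Or.inr hn.neg_one_zpow
  have hmon : unitMonomial p q s n (2 * A) (2 * B) (2 * C) (2 * D) (2 * E) (2 * F) =
      (fundUnit 2 : ℂ) ^ n * (fundUnit (p * q) : ℂ) ^ A * (fundUnit (2 * p * q) : ℂ) ^ B *
      (fundUnit (p * s) : ℂ) ^ C * (fundUnit (2 * p * s) : ℂ) ^ D * (fundUnit (q * s) : ℂ) ^ E *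
      (fundUnit (2 * q * s) : ℂ) ^ F := by
    rw [← rtUnit_sq h.not_isSquare_pq, ← rtUnit_sq h.not_isSquare_two_pq,
      ← rtUnit_sq h.not_isSquare_ps, ← rtUnit_sq h.not_isSquare_two_ps,
      ← rtUnit_sq h.not_isSquare_qs, ← rtUnit_sq h.not_isSquare_two_qs]
    simp only [unitMonomial, zpow_mul, zpow_ofNat]
  have hpm : x ^ 4 = unitMonomial p q s n (2 * A) (2 * B) (2 * C) (2 * D) (2 * E) (2 * F) ∨
      x ^ 4 = -unitMonomial p q s n (2 * A) (2 * B) (2 * C) (2 * D) (2 * E) (2 * F) := by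
    have hor : ∀ {u v u' v' : ℂ}, (u = v ∨ u = -v) → (u' = v' ∨ u' = -v') →
        (u * u' = v * v' ∨ u * u' = -(v * v')) := by
      rintro u v u' v' (rfl | rfl) (rfl | rfl) <;> simp
    have h1 := hor (hor (hor (hor (hor (hor hn hA) hB) hC) hD) hE) hF
    rw [hP, ← hmon] at h1
    rcases hN with h2 | h2 <;> rw [h2] at h1
    · simpa using h1
    · rcases h1 with h1 | h1
      · right; linear_combination -h1
      · left; linear_combination -h1
  rcases hpm with h1 | h1
  · exact h1
  · exfalso
    obtain ⟨r, hr, h2⟩ := unitMonomial_pos h n (2 * A) (2 * B) (2 * C) (2 * D) (2 * E) (2 * F)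
    obtain ⟨y, rfl⟩ := exists_real_of_mem_fieldLplus hx.2.1
    rw [h2] at h1
    have h3 : y ^ 4 = -r := by exact_mod_cast h1
    nlinarith [sq_nonneg (y ^ 2)]

end

variable [Fact p.Prime] [Fact q.Prime] [Fact s.Prime]

theorem unitMonomial_two_mul (h : PrimeTriple p q s) (a A B C D E F : ℤ) :
    unitMonomial p q s (a + a) (A + A) (B + B) (C + C) (D + D) (E + E) (F + F) =
      unitMonomial p q s a A B C D E F ^ 2 := by
  rw [sq, unitMonomial_mul h]

/-- Two successive square roots of the monomial for x⁴: the first needs only that the exponent of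
ε_2 is even, the second uses the parity conditions with δ = 1. Signs are settled by reality of x,
except the last, which remains free. -/
theorem exists_eq_unitMonomial (h : PrimeTriple p q s) {x : ℂ}
    (hx : IsUnitIn (fieldLplus p q s) x) :
    ∃ a A B C D E F : ℤ, Even (A + B + C + D + E + F) ∧
      (x = unitMonomial p q s a A B C D E F ∨ x = -unitMonomial p q s a A B C D E F) := by
  obtain ⟨f⟩ := h.nonempty_signFlips
  obtain ⟨n, A, B, C, D, E, F, hn⟩ := exists_pow_four_eq h f hx
  have hx2 : x ^ 2 ∈ fieldLplus p q s := pow_mem hx.2.1 2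
  have hn2 : Even n := by
    -- `f2` sends x⁴ to (-1)^n times a positive number, and this is the square of the real number
    -- `f2`(x²).
    obtain ⟨r, hr, h1⟩ := unitMonomial_pos h (-n) (2 * A) (-(2 * B)) (2 * C) (-(2 * D)) (2 * E)
      (-(2 * F))
    have h2 : Even (n + 2 * A + 2 * B + 2 * C + 2 * D) := by
      apply even_of_sq_eq (exists_real_of_mem_fieldLplus (map_mem_fieldLplus f.f2 hx2)) hr
      rw [← map_pow, ← pow_mul, hn, f2_unitMonomial h f, h1]
    rw [Int.even_iff] at h2 ⊢
    omega
  obtain ⟨a, rfl⟩ := hn2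
  have hsq : x ^ 2 = unitMonomial p q s a A B C D E F := by
    have h1 : (x ^ 2) ^ 2 = unitMonomial p q s a A B C D E F ^ 2 := by
      rw [← pow_mul, hn, ← unitMonomial_two_mul h]; simp only [two_mul]
    rcases sq_eq_sq_iff_eq_or_eq_neg.1 h1 with h2 | h2
    · exact h2
    · exfalso
      obtain ⟨r, hr, h3⟩ := unitMonomial_pos h a A B C D E F
      obtain ⟨y, rfl⟩ := exists_real_of_mem_fieldLplus hx.2.1
      rw [h3] at h2
      have h3 : y ^ 2 = -r := by exact_mod_cast h2
      nlinarith [sq_nonneg y]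
  have hpar := parity_of_sq_eq h f hx.2.1 (δ := 1) (δ' := 1) (w := 1) (k := 0) one_pos one_pos
    (by norm_num) (by simp) (by simp) (by simp) (by simp) (by simp) (by simp) (by simp) (by simp)
    (show x ^ 2 = ((1 : ℝ) : ℂ) * unitMonomial p q s a A B C D E F by rw [hsq]; simp)
  obtain ⟨h1, h2, h3, h4, h5, h6, h7⟩ := hpar
  have hev : Even a ∧ Even A ∧ Even B ∧ Even C ∧ Even D ∧ Even E ∧ Even F := by
    simp only [Int.even_iff] at *; omega
  obtain ⟨⟨a, rfl⟩, ⟨A, rfl⟩, ⟨B, rfl⟩, ⟨C, rfl⟩, ⟨D, rfl⟩, ⟨E, rfl⟩, ⟨F, rfl⟩⟩ := hev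
  rw [unitMonomial_two_mul h] at hsq
  have hpm := sq_eq_sq_iff_eq_or_eq_neg.1 hsq
  refine ⟨a, A, B, C, D, E, F, ?_, hpm⟩
  apply sum_even_of_unitMonomial_mem h (a := a)
  rcases hpm with h1 | h1
  · rw [← h1]; exact hx.2.1
  · rw [← neg_eq_iff_eq_neg.2 h1]; exact neg_mem hx.2.1

end MultiquadraticUnits

/-! ### Generators of the unit group of L⁺ -/

namespace MultiquadraticUnits

variable {p q s : ℕ}

/-- `z` is the value of an element of `gen S`. -/
def InGen (S : Set ℂ) (z : ℂ) : Prop := ∃ u ∈ gen S, (u : ℂ) = z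

namespace InGen

variable {S : Set ℂ} {z w : ℂ}

theorem of_mem (hz : z ∈ S) (h0 : z ≠ 0) : InGen S z :=
  ⟨Units.mk0 z h0, mem_gen (by simpa using hz), rfl⟩

theorem one : InGen S 1 := ⟨1, one_mem _, rfl⟩

theorem mul (hz : InGen S z) (hw : InGen S w) : InGen S (z * w) := by
  obtain ⟨u, hu, rfl⟩ := hz
  obtain ⟨v, hv, rfl⟩ := hw
  exact ⟨u * v, mul_mem hu hv, rfl⟩

theorem inv (hz : InGen S z) : InGen S z⁻¹ := by
  obtain ⟨u, hu, rfl⟩ := hz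
  exact ⟨u⁻¹, inv_mem hu, by simp⟩

theorem zpow (hz : InGen S z) (n : ℤ) : InGen S (z ^ n) := by
  obtain ⟨u, hu, rfl⟩ := hz
  exact ⟨u ^ n, zpow_mem hu n, by simp⟩

theorem mem_gen {u : ℂˣ} (h : InGen S u) : u ∈ gen S := by
  obtain ⟨v, hv, h⟩ := h
  rwa [← Units.ext h]

end InGen

theorem gen_le_unitGroup {S : Set ℂ} {K : IntermediateField ℚ ℂ} (h : ∀ z ∈ S, IsUnitIn K z) :
    gen S ≤ unitGroup K :=
  gen_le_iff.2 fun u hu => mem_unitGroup_iff_isUnitIn.2 (h u hu)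

theorem unitGroup_le_gen {S : Set ℂ} {K : IntermediateField ℚ ℂ}
    (h : ∀ z, IsUnitIn K z → InGen S z) : unitGroup K ≤ gen S :=
  fun u hu => (h u (mem_unitGroup_iff_isUnitIn.1 hu)).mem_gen

theorem sqrtUnits_eq {m : ℕ} (hm : ¬ IsSquare m) (n : ℕ) :
    (sqrtUnits m n : ℂ) = rtUnit m * rtUnit n := by
  rw [sqrtUnits, rtUnit, rtUnit, Real.sqrt_mul (one_pos.trans (one_lt_fundUnit hm)).le]
  push_cast; rfl

theorem isUnitIn_fundUnit_two_fieldLplus : IsUnitIn (fieldLplus p q s) (fundUnit 2) :=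
  isUnitIn_fundUnit_two.mono quadField_two_le

variable [Fact p.Prime] [Fact q.Prime] [Fact s.Prime]

theorem inGen_unitMonomial (h : PrimeTriple p q s) {S : Set ℂ}
    (h2 : InGen S (fundUnit 2)) (hA : InGen S (fundUnit (p * q)))
    (hAB : InGen S (sqrtUnits (p * q) (2 * p * q))) (hCD : InGen S (sqrtUnits (p * s) (2 * p * s)))
    (hEF : InGen S (sqrtUnits (q * s) (2 * q * s))) (hAC : InGen S (sqrtUnits (p * q) (p * s)))
    (hAE : InGen S (sqrtUnits (p * q) (q * s))) {a A B C D E F : ℤ}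
    (hsum : Even (A + B + C + D + E + F)) : InGen S (unitMonomial p q s a A B C D E F) := by
  obtain ⟨k, hk⟩ := hsum
  -- The change of exponents is triangular: B, D, F, C - D and E - F are the exponents of the five
  -- mixed square roots. They account for part of A, and the rest is even by the condition on the
  -- sum, hence a power of ε_{pq}.
  obtain ⟨j, rfl⟩ : ∃ j, A = B + (C - D) + (E - F) + (j + j) := ⟨k - B - C - E, by omega⟩
  have hA0 := rtUnit_ne_zero h.not_isSquare_pq
  have hB0 := rtUnit_ne_zero h.not_isSquare_two_pq
  have hC0 := rtUnit_ne_zero h.not_isSquare_ps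
  have hD0 := rtUnit_ne_zero h.not_isSquare_two_ps
  have hE0 := rtUnit_ne_zero h.not_isSquare_qs
  have hF0 := rtUnit_ne_zero h.not_isSquare_two_qs
  rw [sqrtUnits_eq h.not_isSquare_pq] at hAB hAC hAE
  rw [sqrtUnits_eq h.not_isSquare_ps] at hCD
  rw [sqrtUnits_eq h.not_isSquare_qs] at hEF
  rw [← rtUnit_sq h.not_isSquare_pq] at hA
  convert ((((((h2.zpow a).mul (hAB.zpow B)).mul (hCD.zpow D)).mul (hEF.zpow F)).mul
    (hAC.zpow (C - D))).mul (hAE.zpow (E - F))).mul (hA.zpow j) using 1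
  have e1 : rtUnit (p * s) ^ C = rtUnit (p * s) ^ D * rtUnit (p * s) ^ (C - D) := by
    rw [← zpow_add₀ hC0]; congr 1; ring
  have e2 : rtUnit (q * s) ^ E = rtUnit (q * s) ^ F * rtUnit (q * s) ^ (E - F) := by
    rw [← zpow_add₀ hE0]; congr 1; ring
  simp only [unitMonomial]
  rw [e1, e2]
  simp only [zpow_add₀ hA0, mul_zpow, sq]
  ring

section Generators

variable (h : PrimeTriple p q s)
include h

theorem isUnitIn_fundUnit_pq : IsUnitIn (fieldLplus p q s) (fundUnit (p * q)) := by
  convert isUnitIn_unitMonomial h (a := 0) (A := 2) (B := 0) (C := 0) (D := 0) (E := 0) (F := 0)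
    (by decide) using 1
  rw [← rtUnit_sq h.not_isSquare_pq]; simp [unitMonomial]

theorem isUnitIn_sqrtUnits_pq_two_pq :
    IsUnitIn (fieldLplus p q s) (sqrtUnits (p * q) (2 * p * q)) := by
  convert isUnitIn_unitMonomial h (a := 0) (A := 1) (B := 1) (C := 0) (D := 0) (E := 0) (F := 0)
    (by decide) using 1
  rw [sqrtUnits_eq h.not_isSquare_pq]; simp [unitMonomial]

theorem isUnitIn_sqrtUnits_ps_two_ps :
    IsUnitIn (fieldLplus p q s) (sqrtUnits (p * s) (2 * p * s)) := by
  convert isUnitIn_unitMonomial h (a := 0) (A := 0) (B := 0) (C := 1) (D := 1) (E := 0) (F := 0)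
    (by decide) using 1
  rw [sqrtUnits_eq h.not_isSquare_ps]; simp [unitMonomial]

theorem isUnitIn_sqrtUnits_qs_two_qs :
    IsUnitIn (fieldLplus p q s) (sqrtUnits (q * s) (2 * q * s)) := by
  convert isUnitIn_unitMonomial h (a := 0) (A := 0) (B := 0) (C := 0) (D := 0) (E := 1) (F := 1)
    (by decide) using 1
  rw [sqrtUnits_eq h.not_isSquare_qs]; simp [unitMonomial]

theorem isUnitIn_sqrtUnits_pq_ps :
    IsUnitIn (fieldLplus p q s) (sqrtUnits (p * q) (p * s)) := by
  convert isUnitIn_unitMonomial h (a := 0) (A := 1) (B := 0) (C := 1) (D := 0) (E := 0) (F := 0)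
    (by decide) using 1
  rw [sqrtUnits_eq h.not_isSquare_pq]; simp [unitMonomial]

theorem isUnitIn_sqrtUnits_pq_qs :
    IsUnitIn (fieldLplus p q s) (sqrtUnits (p * q) (q * s)) := by
  convert isUnitIn_unitMonomial h (a := 0) (A := 1) (B := 0) (C := 0) (D := 0) (E := 1) (F := 0)
    (by decide) using 1
  rw [sqrtUnits_eq h.not_isSquare_pq]; simp [unitMonomial]

theorem inGen_of_isUnitIn_fieldLplus {S : Set ℂ} (hneg : InGen S (-1))
    (h2 : InGen S (fundUnit 2)) (hA : InGen S (fundUnit (p * q)))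
    (hAB : InGen S (sqrtUnits (p * q) (2 * p * q))) (hCD : InGen S (sqrtUnits (p * s) (2 * p * s)))
    (hEF : InGen S (sqrtUnits (q * s) (2 * q * s))) (hAC : InGen S (sqrtUnits (p * q) (p * s)))
    (hAE : InGen S (sqrtUnits (p * q) (q * s))) {x : ℂ} (hx : IsUnitIn (fieldLplus p q s) x) :
    InGen S x := by
  obtain ⟨a, A, B, C, D, E, F, hsum, rfl | rfl⟩ := exists_eq_unitMonomial h hx
  · exact inGen_unitMonomial h h2 hA hAB hCD hEF hAC hAE hsum
  · rw [← neg_one_mul]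
    exact hneg.mul (inGen_unitMonomial h h2 hA hAB hCD hEF hAC hAE hsum)

theorem unitGroup_fieldLplus : unitGroup (fieldLplus p q s) =
    gen {-1, (fundUnit 2 : ℂ), (fundUnit (p * q) : ℂ),
      (sqrtUnits (p * q) (2 * p * q) : ℂ), (sqrtUnits (p * s) (2 * p * s) : ℂ),
      (sqrtUnits (q * s) (2 * q * s) : ℂ), (sqrtUnits (p * q) (p * s) : ℂ),
      (sqrtUnits (p * q) (q * s) : ℂ)} := by
  have g0 : IsUnitIn (fieldLplus p q s) (-1) := IsUnitIn.one.neg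
  have g1 := isUnitIn_fundUnit_two_fieldLplus (p := p) (q := q) (s := s)
  have g2 := isUnitIn_fundUnit_pq h
  have g3 := isUnitIn_sqrtUnits_pq_two_pq h
  have g4 := isUnitIn_sqrtUnits_ps_two_ps h
  have g5 := isUnitIn_sqrtUnits_qs_two_qs h
  have g6 := isUnitIn_sqrtUnits_pq_ps h
  have g7 := isUnitIn_sqrtUnits_pq_qs h
  refine le_antisymm (unitGroup_le_gen fun z hz => ?_) (gen_le_unitGroup ?_)
  · exact inGen_of_isUnitIn_fieldLplus h (.of_mem (by simp) g0.1) (.of_mem (by simp) g1.1)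
      (.of_mem (by simp) g2.1) (.of_mem (by simp) g3.1) (.of_mem (by simp) g4.1)
      (.of_mem (by simp) g5.1) (.of_mem (by simp) g6.1) (.of_mem (by simp) g7.1) hz
  · rintro z (rfl | rfl | rfl | rfl | rfl | rfl | rfl | rfl) <;> assumption

end Generators

end MultiquadraticUnits

/-! ### The field L and complex conjugation -/

namespace MultiquadraticUnits

variable {p q s ℓ : ℕ}

/-- `√(-ℓ)`. -/
noncomputable def imRt (ℓ : ℕ) : ℂ := Complex.I * rt ℓ

theorem imRt_sq (ℓ : ℕ) : imRt ℓ ^ 2 = -ℓ := by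
  rw [imRt, mul_pow, Complex.I_sq, rt_sq]; ring

theorem conj_imRt (ℓ : ℕ) : (starRingEnd ℂ) (imRt ℓ) = -imRt ℓ := by
  rw [imRt, map_mul, Complex.conj_I, conj_rt]; ring

theorem map_imRt (σ : ℂ →+* ℂ) (ℓ : ℕ) : σ (imRt ℓ) = imRt ℓ ∨ σ (imRt ℓ) = -imRt ℓ := by
  apply sq_eq_sq_iff_eq_or_eq_neg.1
  rw [← map_pow, imRt_sq, _root_.map_neg, map_natCast]

theorem fieldL_eq (p q s ℓ : ℕ) : fieldL p q s ℓ =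
    IntermediateField.adjoin ℚ (insert (imRt ℓ) {rt 2, rt (p * q), rt (p * s)}) := by
  rw [fieldL]
  congr 1
  ext z
  simp [imRt, rt]
  tauto

theorem fieldLplus_le_fieldL : fieldLplus p q s ≤ fieldL p q s ℓ := by
  rw [fieldLplus_eq, fieldL_eq]
  exact IntermediateField.adjoin.mono _ _ _ (Set.subset_insert _ _)

theorem imRt_mem : imRt ℓ ∈ fieldL p q s ℓ := by
  rw [fieldL_eq]; exact IntermediateField.subset_adjoin _ _ (Set.mem_insert _ _)

theorem exists_eq_add_mul_imRt {y : ℂ} (hy : y ∈ fieldL p q s ℓ) :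
    ∃ a ∈ fieldLplus p q s, ∃ b ∈ fieldLplus p q s, y = a + b * imRt ℓ := by
  rw [fieldL_eq] at hy
  rw [fieldLplus_eq]
  exact exists_eq_add_mul_of_mem_adjoin_insert (by rw [imRt_sq]; exact neg_mem (natCast_mem _ ℓ)) hy

theorem map_eq_of_mem_fieldL {σ τ : ℂ →+* ℂ} (h : ∀ n, σ (rt n) = τ (rt n))
    (hℓ : σ (imRt ℓ) = τ (imRt ℓ)) {y : ℂ} (hy : y ∈ fieldL p q s ℓ) : σ y = τ y := by
  rw [fieldL_eq] at hy
  refine ringHom_eq_of_mem_adjoin ?_ hy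
  rintro x (rfl | rfl | rfl | rfl)
  exacts [hℓ, h _, h _, h _]

theorem map_map_self_of_mem_fieldL (σ : ℂ →+* ℂ) {y : ℂ} (hy : y ∈ fieldL p q s ℓ) :
    σ (σ y) = y := by
  refine map_eq_of_mem_fieldL (σ := σ.comp σ) (τ := RingHom.id ℂ) (fun n => ?_) ?_ hy
  · rcases map_rt σ n with h | h <;> simp [h]
  · rcases map_imRt σ ℓ with h | h <;> simp [h]

theorem map_conj_of_mem_fieldL (σ : ℂ →+* ℂ) {y : ℂ} (hy : y ∈ fieldL p q s ℓ) :
    σ ((starRingEnd ℂ) y) = (starRingEnd ℂ) (σ y) := by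
  refine map_eq_of_mem_fieldL (σ := σ.comp (starRingEnd ℂ)) (τ := (starRingEnd ℂ).comp σ)
    (fun n => ?_) ?_ hy
  · rcases map_rt σ n with h | h <;> simp [h, conj_rt]
  · rcases map_imRt σ ℓ with h | h <;> simp [h, conj_imRt]

theorem conj_mem_fieldL {y : ℂ} (hy : y ∈ fieldL p q s ℓ) :
    (starRingEnd ℂ) y ∈ fieldL p q s ℓ := by
  obtain ⟨a, ha, b, hb, rfl⟩ := exists_eq_add_mul_imRt hy
  rw [map_add, map_mul, conj_imRt, conj_eq_of_mem_fieldLplus ha, conj_eq_of_mem_fieldLplus hb]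
  exact add_mem (fieldLplus_le_fieldL ha) (mul_mem (fieldLplus_le_fieldL hb) (neg_mem imRt_mem))

theorem mem_fieldLplus_of_conj_eq {y : ℂ} (hy : y ∈ fieldL p q s ℓ)
    (h : (starRingEnd ℂ) y = y) : y ∈ fieldLplus p q s := by
  obtain ⟨a, ha, b, hb, rfl⟩ := exists_eq_add_mul_imRt hy
  rw [map_add, map_mul, conj_imRt, conj_eq_of_mem_fieldLplus ha,
    conj_eq_of_mem_fieldLplus hb] at h
  rw [show a + b * imRt ℓ = a by linear_combination -h / 2]
  exact ha

theorem exists_eq_mul_imRt_of_conj_eq_neg {y : ℂ} (hy : y ∈ fieldL p q s ℓ)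
    (h : (starRingEnd ℂ) y = -y) : ∃ b ∈ fieldLplus p q s, y = b * imRt ℓ := by
  obtain ⟨a, ha, b, hb, rfl⟩ := exists_eq_add_mul_imRt hy
  rw [map_add, map_mul, conj_imRt, conj_eq_of_mem_fieldLplus ha,
    conj_eq_of_mem_fieldLplus hb] at h
  exact ⟨b, hb, by linear_combination h / 2⟩

theorem IsUnitIn.conj {u : ℂ} (hu : IsUnitIn (fieldL p q s ℓ) u) :
    IsUnitIn (fieldL p q s ℓ) ((starRingEnd ℂ) u) :=
  ⟨(map_ne_zero _).2 hu.1, conj_mem_fieldL hu.2.1, isIntegral_map hu.2.2.1, by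
    rw [← map_inv₀]; exact isIntegral_map hu.2.2.2⟩

theorem finiteDimensional_fieldL : FiniteDimensional ℚ (fieldL p q s ℓ) := by
  rw [fieldL_eq]
  have hrt : ∀ n, IsIntegral ℚ (rt n) := fun n => IsIntegral.of_pow two_pos (by
    rw [rt_sq]; exact_mod_cast isIntegral_algebraMap (R := ℚ) (A := ℂ) (x := (n : ℚ)))
  have him : IsIntegral ℚ (imRt ℓ) := IsIntegral.of_pow two_pos (by
    rw [imRt_sq]; exact_mod_cast isIntegral_algebraMap (R := ℚ) (A := ℂ) (x := (-ℓ : ℚ)))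
  apply IntermediateField.finiteDimensional_adjoin
  rintro x (rfl | rfl | rfl | rfl)
  exacts [him, hrt _, hrt _, hrt _]

/-- The quotient of a unit by its complex conjugate is a root of unity. -/
theorem exists_pow_div_conj_eq_one {u : ℂ} (hu : IsUnitIn (fieldL p q s ℓ) u) :
    ∃ n : ℕ, 0 < n ∧ (u / (starRingEnd ℂ) u) ^ n = 1 := by
  have hfin : FiniteDimensional ℚ (fieldL p q s ℓ) := finiteDimensional_fieldL
  have : NumberField (fieldL p q s ℓ) := ⟨⟩
  have hw := hu.div hu.conj
  let w : fieldL p q s ℓ := ⟨_, hw.2.1⟩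
  have hwi : IsIntegral ℤ w := (isIntegral_algHom_iff (algebraMap (fieldL p q s ℓ) ℂ).toIntAlgHom
    (algebraMap (fieldL p q s ℓ) ℂ).injective).1 hw.2.2.1
  -- Kronecker's theorem. Every embedding extends to an endomorphism of ℂ that commutes with complex
  -- conjugation on L, so all conjugates of u/ū have absolute value 1.
  obtain ⟨n, hn, h⟩ := NumberField.Embeddings.pow_eq_one_of_norm_eq_one (fieldL p q s ℓ) ℂ hwi
    (fun φ => by
      obtain ⟨σ, hσ⟩ := exists_ringHom_extending φ
      rw [← hσ w]
      change ‖σ (u / (starRingEnd ℂ) u)‖ = 1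
      rw [map_div₀, map_conj_of_mem_fieldL σ hu.2.1, norm_div, RCLike.norm_conj]
      exact div_self (norm_ne_zero_iff.2 ((map_ne_zero σ).2 hu.1)))
  refine ⟨n, hn, ?_⟩
  have := congrArg Subtype.val h
  simpa [w] using this

/-- w and w^k are both primitive n-th roots of unity, so they have the same minimal polynomial, the
n-th cyclotomic one. -/
theorem exists_ringHom_pow {w : ℂ} {n k : ℕ} (hw : IsPrimitiveRoot w n) (hn : 0 < n)
    (hk : k.Coprime n) : ∃ σ : ℂ →+* ℂ, σ w = w ^ k := by
  apply exists_ringHom_of_aeval_minpoly_eq_zero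
  · exact (hw.isIntegral hn).tower_top
  · rw [← Polynomial.cyclotomic_eq_minpoly_rat hw hn,
      Polynomial.cyclotomic_eq_minpoly_rat (hw.pow_of_coprime k hk) hn]
    exact minpoly.aeval _ _

/-- Roots of unity on which every automorphism is an involution have order dividing `24`. -/
theorem pow_twentyFour_eq_one {w : ℂ} (hσ : ∀ σ : ℂ →+* ℂ, σ (σ w) = w) {n : ℕ} (hn : 0 < n)
    (hw : w ^ n = 1) : w ^ 24 = 1 := by
  have hfo : IsOfFinOrder w := isOfFinOrder_iff_pow_eq_one.2 ⟨n, hn, hw⟩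
  have hpos := hfo.orderOf_pos
  have hprim := IsPrimitiveRoot.orderOf w
  have key : ∀ {z : ℂ} {N k : ℕ}, IsPrimitiveRoot z N → 0 < N → k.Coprime N →
      (∀ σ : ℂ →+* ℂ, σ (σ z) = z) → z ^ (k * k) = z := by
    intro z N k hz hN hk hσ
    obtain ⟨σ, h⟩ := exists_ringHom_pow hz hN hk
    rw [pow_mul, ← h, ← map_pow, ← h, hσ]
  -- If σ raises a root of order N to the power k, then σ² = 1 gives k² ≡ 1 mod N. Taking k = 2
  -- rules out N = 5; then k = 5 is prime to the order of w, which divides 5² - 1 = 24.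
  by_cases h5 : 5 ∣ orderOf w
  · exfalso
    obtain ⟨m, hm⟩ := h5
    have hz := hprim.pow hpos (show orderOf w = m * 5 by rw [hm, mul_comm])
    have h1 := key hz (by norm_num) (show Nat.Coprime 2 5 by norm_num) fun σ => by
      rw [map_pow, map_pow, hσ]
    have h0 : w ^ m ≠ 0 := hz.ne_zero (by norm_num)
    have h2 : (w ^ m) ^ 3 = 1 := mul_right_cancel₀ h0 (by rw [one_mul, ← pow_succ]; exact h1)
    have := hz.dvd_of_pow_eq_one 3 h2
    omega
  · have h1 := key hprim hpos (((Nat.Prime.coprime_iff_not_dvd (by norm_num)).2 h5)) hσ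
    have h0 : w ≠ 0 := hprim.ne_zero hpos.ne'
    exact mul_right_cancel₀ h0 (by rw [one_mul, ← pow_succ]; exact h1)

/-! ### Roots of unity in L -/

section SquareClasses

variable [Fact p.Prime] [Fact q.Prime] [Fact s.Prime] (h : PrimeTriple p q s) {n : ℕ}
  (hsf : Squarefree n) (hodd : Odd n) (hnp : n.Coprime p) (hnq : n.Coprime q)
  (hns : n.Coprime s)
include h hsf hodd hnp hnq hns

theorem exists_flip_of_coprime (hn1 : n ≠ 1) (T : Finset (Fin 5)) :
    ∃ σ : ℂ →+* ℂ, (∀ i ∈ T, σ (rt (![2, p, q, s, n] i)) = -rt (![2, p, q, s, n] i)) ∧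
      ∀ i ∉ T, σ (rt (![2, p, q, s, n] i)) = rt (![2, p, q, s, n] i) := by
  have hp : p.Prime := Fact.out
  have hq : q.Prime := Fact.out
  have hs : s.Prime := Fact.out
  have h1 := (Nat.coprime_primes Nat.prime_two hp).2 h.p_ne_two.symm
  have h2 := (Nat.coprime_primes Nat.prime_two hq).2 h.q_ne_two.symm
  have h3 := (Nat.coprime_primes Nat.prime_two hs).2 h.s_ne_two.symm
  have h4 := (Nat.coprime_primes hp hq).2 h.p_ne_q
  have h5 := (Nat.coprime_primes hp hs).2 h.p_ne_s
  have h6 := (Nat.coprime_primes hq hs).2 h.q_ne_s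
  have h7 : Nat.Coprime 2 n := Nat.coprime_two_left.2 hodd
  refine exists_ringHom_rt_signs _ ?_ ?_ ?_ T
  · intro i
    fin_cases i
    exacts [Nat.prime_two.squarefree, hp.squarefree, hq.squarefree, hs.squarefree, hsf]
  · intro i
    fin_cases i
    exacts [Nat.prime_two.ne_one, hp.ne_one, hq.ne_one, hs.ne_one, hn1]
  · intro i j hij
    fin_cases i <;> fin_cases j <;>
      first
      | exact absurd rfl hij
      | exact h1 | exact h2 | exact h3 | exact h4 | exact h5 | exact h6 | exact h7
      | exact hnp | exact hnq | exact hns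
      | exact h1.symm | exact h2.symm | exact h3.symm | exact h4.symm | exact h5.symm
      | exact h6.symm | exact h7.symm | exact hnp.symm | exact hnq.symm | exact hns.symm

theorem exists_ringHom_neg_rt (hn1 : n ≠ 1) : ∃ σ : ℂ →+* ℂ, σ (rt n) = -rt n ∧
    σ (rt 2) = rt 2 ∧ σ (rt p) = rt p ∧ σ (rt q) = rt q ∧ σ (rt s) = rt s := by
  obtain ⟨σ, h1, h2⟩ := exists_flip_of_coprime h hsf hodd hnp hnq hns hn1 {4}
  exact ⟨σ, h1 4 (by simp), h2 0 (by simp), h2 1 (by simp), h2 2 (by simp), h2 3 (by simp)⟩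

theorem rt_not_mem_fieldLplus (hn1 : n ≠ 1) : rt n ∉ fieldLplus p q s := by
  intro hmem
  obtain ⟨σ, h0, h2, h3, h4, h5⟩ := exists_ringHom_neg_rt h hsf hodd hnp hnq hns hn1
  have := map_eq_of_mem_fieldLplus (σ := σ) (τ := RingHom.id ℂ) (by simp [h2])
    (by simp [rt_mul, h3, h4]) (by simp [rt_mul, h3, h5]) hmem
  rw [h0] at this
  exact rt_ne_zero hsf.ne_zero (self_eq_neg.1 this.symm)

/-- Negating √p, √q and √s while fixing √2 and √n is the identity on L⁺ but negates √s√n. The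
statement is needed when s = 3, where n is prime to 3 but 3n is not prime to s. -/
theorem rt_s_mul_rt_not_mem_fieldLplus : rt s * rt n ∉ fieldLplus p q s := by
  intro hmem
  obtain ⟨σ, h0, h2, h3, h4, h5⟩ : ∃ σ : ℂ →+* ℂ, σ (rt n) = rt n ∧ σ (rt 2) = rt 2 ∧
      σ (rt p) = -rt p ∧ σ (rt q) = -rt q ∧ σ (rt s) = -rt s := by
    by_cases hn1 : n = 1
    · obtain ⟨f⟩ := h.nonempty_signFlips
      exact ⟨f.fp.comp (f.fq.comp f.fs), by simp [hn1, rt_one], by simp, by simp, by simp, by simp⟩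
    · obtain ⟨σ, h1, h2⟩ := exists_flip_of_coprime h hsf hodd hnp hnq hns hn1 {1, 2, 3}
      exact ⟨σ, h2 4 (by simp), h2 0 (by simp), h1 1 (by simp), h1 2 (by simp), h1 3 (by simp)⟩
  have := map_eq_of_mem_fieldLplus (σ := σ) (τ := RingHom.id ℂ) (by simp [h2])
    (by simp [rt_mul, h3, h4]) (by simp [rt_mul, h3, h5]) hmem
  rw [map_mul, h0, h5, neg_mul] at this
  exact mul_ne_zero (rt_ne_zero (Fact.out : s.Prime).ne_zero) (rt_ne_zero hsf.ne_zero)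
    (self_eq_neg.1 this.symm)

theorem I_not_mem_fieldL (hn1 : n ≠ 1) : Complex.I ∉ fieldL p q s n := by
  intro hI
  obtain ⟨b, hb, hIb⟩ := exists_eq_mul_imRt_of_conj_eq_neg hI Complex.conj_I
  refine rt_not_mem_fieldLplus h hsf hodd hnp hnq hns hn1 ?_
  have h1 : b * rt n = 1 := by
    apply mul_left_cancel₀ Complex.I_ne_zero
    rw [imRt] at hIb
    linear_combination -hIb
  rw [← inv_eq_of_mul_eq_one_right h1]
  exact inv_mem hb

/-- The hypothesis puts √3√n in L⁺. If n = 3k, then √k ∈ L⁺ forces k = 1. If 3 does not divide n,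
then √(3n) ∈ L⁺ is excluded by sign changes, with s = 3 treated apart; the congruences modulo 8 keep
p and q different from 3. -/
theorem eq_three_of_imRt_three_mem (hmem : imRt 3 ∈ fieldL p q s n) : n = 3 := by
  obtain ⟨b, hb, hIb⟩ := exists_eq_mul_imRt_of_conj_eq_neg hmem (conj_imRt 3)
  have h1 : rt 3 = b * rt n := by
    apply mul_left_cancel₀ Complex.I_ne_zero
    rw [imRt, imRt] at hIb
    linear_combination hIb
  have h2 : rt 3 * rt n ∈ fieldLplus p q s := by
    rw [h1, mul_assoc, ← sq, rt_sq]
    exact mul_mem hb (natCast_mem _ n)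
  by_cases h3 : 3 ∣ n
  · obtain ⟨k, rfl⟩ := h3
    have hk : rt k ∈ fieldLplus p q s := by
      have : rt k = (rt 3 * rt (3 * k)) / 3 := by
        rw [rt_mul, ← mul_assoc, ← sq, rt_sq]; push_cast; ring
      rw [this]
      exact div_mem h2 (ofNat_mem _ 3)
    by_contra hne
    exact rt_not_mem_fieldLplus h (hsf.squarefree_of_dvd (dvd_mul_left k 3))
      (Nat.odd_mul.1 hodd).2 (hnp.coprime_dvd_left (dvd_mul_left k 3))
      (hnq.coprime_dvd_left (dvd_mul_left k 3)) (hns.coprime_dvd_left (dvd_mul_left k 3))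
      (by rintro rfl; exact hne rfl) hk
  · exfalso
    by_cases hs3 : s = 3
    · rw [← hs3] at h2
      exact rt_s_mul_rt_not_mem_fieldLplus h hsf hodd hnp hnq hns h2
    · have hc : ∀ r : ℕ, r.Prime → r ≠ 3 → n.Coprime r → (3 * n).Coprime r := fun r hr hr3 hnr =>
        Nat.Coprime.mul_left ((Nat.coprime_primes Nat.prime_three hr).2 hr3.symm) hnr
      rw [← rt_mul] at h2
      refine rt_not_mem_fieldLplus h ?_ (Odd.mul (by decide) hodd) (hc p Fact.out ?_ hnp)
        (hc q Fact.out ?_ hnq) (hc s Fact.out hs3 hns) (by omega) h2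
      · exact (Nat.squarefree_mul ((Nat.Prime.coprime_iff_not_dvd Nat.prime_three).2 h3)).2
          ⟨Nat.prime_three.squarefree, hsf⟩
      · have := h.p_mod; omega
      · have := h.q_mod; omega

theorem eq_three_of_cube_root_mem {ω : ℂ} (hω : ω ∈ fieldL p q s n) (h3 : ω ^ 3 = 1) (h1 : ω ≠ 1) :
    n = 3 := by
  apply eq_three_of_imRt_three_mem h hsf hodd hnp hnq hns
  have h2 : (2 * ω + 1) ^ 2 = imRt 3 ^ 2 := by
    rw [imRt_sq]
    have : ω ^ 2 + ω + 1 = 0 := by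
      apply mul_left_cancel₀ (sub_ne_zero.2 h1)
      linear_combination h3
    push_cast
    linear_combination 4 * this
  have hm : 2 * ω + 1 ∈ fieldL p q s n := add_mem (mul_mem (ofNat_mem _ 2) hω) (one_mem _)
  rcases sq_eq_sq_iff_eq_or_eq_neg.1 h2 with h4 | h4
  · rwa [← h4]
  · rw [← neg_eq_iff_eq_neg.2 h4]; exact neg_mem hm

theorem pow_six_eq_one_of_mem_fieldL (hn1 : n ≠ 1) {w : ℂ} (hw : w ∈ fieldL p q s n) {N : ℕ}
    (hN : 0 < N) (hwN : w ^ N = 1) : w ^ 6 = 1 := by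
  have h24 := pow_twentyFour_eq_one (fun σ => map_map_self_of_mem_fieldL σ hw) hN hwN
  have key : ∀ {z : ℂ}, z ∈ fieldL p q s n → z ^ 4 = 1 → z ^ 2 = 1 := by
    intro z hz h4
    have h1 : (z ^ 2 - 1) * (z ^ 2 + 1) = 0 := by linear_combination h4
    rcases mul_eq_zero.1 h1 with h2 | h2
    · exact sub_eq_zero.1 h2
    · exfalso
      have h3 : z ^ 2 = Complex.I ^ 2 := by rw [Complex.I_sq]; linear_combination h2
      apply I_not_mem_fieldL h hsf hodd hnp hnq hns hn1
      rcases sq_eq_sq_iff_eq_or_eq_neg.1 h3 with h4 | h4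
      · rwa [← h4]
      · rw [← neg_eq_iff_eq_neg.2 h4]; exact neg_mem hz
  have h12 : (w ^ 6) ^ 2 = 1 := key (pow_mem hw 6) (by rw [← pow_mul]; exact h24)
  have h6 : (w ^ 3) ^ 2 = 1 := key (pow_mem hw 3) (by rw [← pow_mul]; rw [← pow_mul] at h12; exact h12)
  rwa [← pow_mul] at h6

theorem pow_eight_eq_one_of_mem_fieldL (hn3 : n ≠ 3) {w : ℂ} (hw : w ∈ fieldL p q s n) {N : ℕ}
    (hN : 0 < N) (hwN : w ^ N = 1) : w ^ 8 = 1 := by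
  have h24 := pow_twentyFour_eq_one (fun σ => map_map_self_of_mem_fieldL σ hw) hN hwN
  by_contra h8
  exact hn3 (eq_three_of_cube_root_mem h hsf hodd hnp hnq hns (pow_mem hw 8)
    (by rw [← pow_mul]; exact h24) h8)

end SquareClasses

end MultiquadraticUnits

/-! ### Explicit roots of unity and the monomials u·ū -/

namespace MultiquadraticUnits

variable {p q s ℓ : ℕ}

theorem isPrimitiveRoot_zeta {n : ℕ} (hn : n ≠ 0) : IsPrimitiveRoot (zeta n) n :=
  Complex.isPrimitiveRoot_exp n hn

theorem conj_zeta (n : ℕ) : (starRingEnd ℂ) (zeta n) = (zeta n)⁻¹ := by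
  rw [zeta, ← Complex.exp_conj, ← Complex.exp_neg]
  congr 1
  simp [neg_div, Complex.conj_ofNat]

theorem zeta_ne_zero (n : ℕ) : zeta n ≠ 0 := Complex.exp_ne_zero _

theorem zeta_eight_eq : zeta 8 = rt 2 / 2 + rt 2 / 2 * Complex.I := by
  have : (2 * Real.pi * Complex.I / (8 : ℕ) : ℂ) = ((Real.pi / 4 : ℝ) : ℂ) * Complex.I := by
    push_cast; ring
  rw [zeta, this, Complex.exp_mul_I, ← Complex.ofReal_cos, ← Complex.ofReal_sin,
    Real.cos_pi_div_four, Real.sin_pi_div_four, rt]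
  push_cast; ring

theorem zeta_six_eq : zeta 6 = 1 / 2 + imRt 3 / 2 := by
  have : (2 * Real.pi * Complex.I / (6 : ℕ) : ℂ) = ((Real.pi / 3 : ℝ) : ℂ) * Complex.I := by
    push_cast; ring
  rw [zeta, this, Complex.exp_mul_I, ← Complex.ofReal_cos, ← Complex.ofReal_sin,
    Real.cos_pi_div_three, Real.sin_pi_div_three, imRt, rt]
  push_cast; ring

theorem isUnitIn_of_pow_eq_one {K : IntermediateField ℚ ℂ} {z : ℂ} {n : ℕ} (hn : 0 < n)
    (hz : z ∈ K) (h : z ^ n = 1) : IsUnitIn K z :=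
  IsUnitIn.of_pow hn hz (h ▸ IsUnitIn.one)

theorem isUnitIn_fieldLplus_of_conj_eq {u : ℂ} (hu : IsUnitIn (fieldL p q s ℓ) u)
    (h : (starRingEnd ℂ) u = u) : IsUnitIn (fieldLplus p q s) u :=
  ⟨hu.1, mem_fieldLplus_of_conj_eq hu.2.1 h, hu.2.2⟩

theorem exists_eta_pow_eq_neg_one (ℓ : ℕ) : ∃ n : ℕ, eta ℓ ^ n = -1 := by
  unfold eta
  split_ifs with h3
  · have := (isPrimitiveRoot_zeta (n := 6) (by norm_num)).pow_of_dvd (p := 3) (by norm_num)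
      (by norm_num)
    exact ⟨3, this.eq_neg_one_of_two_right⟩
  · exact ⟨1, by simp⟩

theorem I_mem_fieldL : Complex.I ∈ fieldL p q s 1 := by
  have := imRt_mem (p := p) (q := q) (s := s) (ℓ := 1)
  rwa [imRt, rt_one, mul_one] at this

theorem isUnitIn_zeta_eight : IsUnitIn (fieldL p q s 1) (zeta 8) := by
  refine isUnitIn_of_pow_eq_one (n := 8) (by norm_num) ?_
    (isPrimitiveRoot_zeta (by norm_num)).pow_eq_one
  rw [zeta_eight_eq]
  have h2 : rt 2 / 2 ∈ fieldL p q s 1 := div_mem (fieldLplus_le_fieldL rt_two_mem) (ofNat_mem _ 2)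
  exact add_mem h2 (mul_mem h2 I_mem_fieldL)

theorem rt_two_sq : rt 2 ^ 2 = 2 := by rw [rt_sq]; simp

/-- Up to squares in L, ζ₈ may be replaced by 2 + √2, a positive element of ℚ(√2) of norm 2. -/
theorem one_add_zeta_eight_sq : (1 + zeta 8) ^ 2 = zeta 8 * (2 + rt 2) := by
  rw [zeta_eight_eq]
  linear_combination (-(1 / 4 : ℂ) + (1 / 4) * Complex.I ^ 2) * rt_two_sq + (1 / 2 : ℂ) * Complex.I_sq

theorem mixedRoot_sq_eq_mul (p q s b : ℕ) :
    mixedRoot p q s b ^ 2 = zeta 8 * (fundUnit (p * q) : ℂ) ^ b *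
      (sqrtUnits (p * q) (2 * p * q) : ℂ) * (sqrtUnits (q * s) (2 * q * s) : ℂ) := by
  rw [mixedRoot, Complex.sqrt]
  exact Complex.cpow_nat_inv_pow _ two_ne_zero

variable [Fact p.Prime] [Fact q.Prime] [Fact s.Prime]

/-- The unit `u ū` of `L⁺` is a monomial. -/
theorem exists_mul_conj_eq_unitMonomial (h : PrimeTriple p q s) {u : ℂ}
    (hu : IsUnitIn (fieldL p q s ℓ) u) :
    ∃ a A B C D E F : ℤ, u * (starRingEnd ℂ) u = unitMonomial p q s a A B C D E F := by
  have hv : IsUnitIn (fieldLplus p q s) (u * (starRingEnd ℂ) u) :=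
    isUnitIn_fieldLplus_of_conj_eq (hu.mul hu.conj) (by simp [mul_comm])
  obtain ⟨a, A, B, C, D, E, F, -, h1 | h1⟩ := exists_eq_unitMonomial h hv
  · exact ⟨a, A, B, C, D, E, F, h1⟩
  · exfalso
    obtain ⟨r, hr, h2⟩ := unitMonomial_pos h a A B C D E F
    rw [h2, Complex.mul_conj] at h1
    have h3 : Complex.normSq u = -r := by exact_mod_cast h1
    linarith [Complex.normSq_nonneg u]

/-! ### The unit group of L for ℓ ≠ 1 -/

section NeOne

variable (h : PrimeTriple p q s) (hsf : Squarefree ℓ) (hodd : Odd ℓ) (hℓp : ℓ.Coprime p)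
  (hℓq : ℓ.Coprime q) (hℓs : ℓ.Coprime s) (hℓ1 : ℓ ≠ 1)
include h hsf hodd hℓp hℓq hℓs hℓ1

/-- No unit of `L` is purely imaginary when `ℓ ≠ 1`. -/
theorem conj_ne_neg_of_isUnitIn {u : ℂ} (hu : IsUnitIn (fieldL p q s ℓ) u) :
    (starRingEnd ℂ) u ≠ -u := by
  intro hconj
  obtain ⟨b, hb, hub⟩ := exists_eq_mul_imRt_of_conj_eq_neg hu.2.1 hconj
  obtain ⟨a, A, B, C, D, E, F, hv⟩ := exists_mul_conj_eq_unitMonomial h hu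
  obtain ⟨f⟩ := h.nonempty_signFlips
  have hℓ0 : (0 : ℝ) < ℓ := by exact_mod_cast Nat.pos_of_ne_zero hsf.ne_zero
  -- For u = b√(-ℓ) one has u·ū = ℓb², so (ℓb)² is ℓ times a monomial and the parity conditions
  -- apply with δ = ℓ.
  have hX : (ℓ * b : ℂ) ∈ fieldLplus p q s := mul_mem (natCast_mem _ ℓ) hb
  have hXY : (ℓ * b : ℂ) ^ 2 = ((ℓ : ℝ) : ℂ) * unitMonomial p q s a A B C D E F := by
    rw [← hv, hconj, hub]
    push_cast
    linear_combination ((ℓ : ℂ) * b ^ 2) * imRt_sq ℓ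
  obtain ⟨h1, h2, h3, h4, h5, h6, h7⟩ := parity_of_sq_eq h f hX (δ := ℓ) (δ' := ℓ) (w := ℓ)
    (k := 0) hℓ0 hℓ0 (by ring) (by simp) (by simp) (by simp) (by simp) (by simp) (by simp)
    (by simp) (by simp) hXY
  have hev : Even a ∧ Even A ∧ Even B ∧ Even C ∧ Even D ∧ Even E ∧ Even F := by
    simp only [Int.even_iff] at *; omega
  obtain ⟨⟨a, rfl⟩, ⟨A, rfl⟩, ⟨B, rfl⟩, ⟨C, rfl⟩, ⟨D, rfl⟩, ⟨E, rfl⟩, ⟨F, rfl⟩⟩ := hev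
  rw [unitMonomial_two_mul h] at hXY
  have hsq : (ℓ * b : ℂ) ^ 2 = (rt ℓ * unitMonomial p q s a A B C D E F) ^ 2 := by
    rw [hXY, mul_pow, rt_sq]; simp
  -- Now ℓb is ±√ℓ times a monomial. A sign change of √ℓ alone fixes ℓb ∈ L⁺; it also fixes the
  -- monomial, which need not lie in L⁺, because it fixes √2, √p, √q and √s. Hence it would both fix
  -- and negate the product.
  obtain ⟨σ, k0, k2, k3, k4, k5⟩ := exists_ringHom_neg_rt h hsf hodd hℓp hℓq hℓs hℓ1
  have hσX : σ (ℓ * b) = ℓ * b := map_eq_of_mem_fieldLplus (τ := RingHom.id ℂ) (by simp [k2])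
    (by simp [rt_mul, k3, k4]) (by simp [rt_mul, k3, k5]) hX
  have hσm : σ (unitMonomial p q s a A B C D E F) = unitMonomial p q s a A B C D E F := by
    have e2 := map_fundUnit_two_of_fix k2
    have eA := h.hasSqrtForm_pq.map_fix (σ := σ) (by simp [rt_mul, k2, k4]) (by simp [rt_mul, k2, k3])
    have eB := h.hasSqrtForm_two_pq.map_fix (σ := σ) (by simp [rt_mul, k2, k4]) k3
    have eC := h.hasSqrtForm_ps.map_fix (σ := σ) (by simp [rt_mul, k2, k3]) (by simp [rt_mul, k2, k5])
    have eD := h.hasSqrtForm_two_ps.map_fix (σ := σ) (by simp [rt_mul, k2, k5]) k3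
    have eE := h.hasSqrtForm_qs.map_fix (σ := σ) k4 k5
    have eF := h.hasSqrtForm_two_qs.map_fix (σ := σ) k4 (by simp [rt_mul, k2, k5])
    simp only [unitMonomial, map_mul, map_zpow₀, e2, eA, eB, eC, eD, eE, eF]
  have hne : rt ℓ * unitMonomial p q s a A B C D E F ≠ 0 :=
    mul_ne_zero (rt_ne_zero hsf.ne_zero) (unitMonomial_ne_zero h a A B C D E F)
  have hneg : σ (rt ℓ * unitMonomial p q s a A B C D E F) =
      -(rt ℓ * unitMonomial p q s a A B C D E F) := by
    rw [map_mul, k0, hσm, neg_mul]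
  rcases sq_eq_sq_iff_eq_or_eq_neg.1 hsq with h8 | h8
  · rw [← h8, hσX, h8] at hneg
    exact hne (self_eq_neg.1 hneg)
  · rw [← neg_eq_iff_eq_neg.2 h8, _root_.map_neg, hσX, neg_eq_iff_eq_neg.2 h8] at hneg
    exact hne (self_eq_neg.1 hneg)

theorem unitGroup_fieldL_of_ne_one : unitGroup (fieldL p q s ℓ) =
    gen {eta ℓ, (fundUnit 2 : ℂ), (fundUnit (p * q) : ℂ),
      (sqrtUnits (p * q) (2 * p * q) : ℂ), (sqrtUnits (p * s) (2 * p * s) : ℂ),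
      (sqrtUnits (q * s) (2 * q * s) : ℂ), (sqrtUnits (p * q) (p * s) : ℂ),
      (sqrtUnits (p * q) (q * s) : ℂ)} := by
  have hle : fieldLplus p q s ≤ fieldL p q s ℓ := fieldLplus_le_fieldL
  have g0 : IsUnitIn (fieldL p q s ℓ) (eta ℓ) := by
    unfold eta
    split_ifs with h3
    · refine isUnitIn_of_pow_eq_one (n := 6) (by norm_num) ?_
        (isPrimitiveRoot_zeta (by norm_num)).pow_eq_one
      rw [zeta_six_eq]
      subst h3
      exact add_mem (div_mem (one_mem _) (ofNat_mem _ 2)) (div_mem imRt_mem (ofNat_mem _ 2))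
    · exact IsUnitIn.one.neg
  have g1 := isUnitIn_fundUnit_two_fieldLplus (p := p) (q := q) (s := s)
  have g2 := isUnitIn_fundUnit_pq h
  have g3 := isUnitIn_sqrtUnits_pq_two_pq h
  have g4 := isUnitIn_sqrtUnits_ps_two_ps h
  have g5 := isUnitIn_sqrtUnits_qs_two_qs h
  have g6 := isUnitIn_sqrtUnits_pq_ps h
  have g7 := isUnitIn_sqrtUnits_pq_qs h
  refine le_antisymm (unitGroup_le_gen fun u hu => ?_) (gen_le_unitGroup ?_)
  · set S : Set ℂ := {eta ℓ, (fundUnit 2 : ℂ), (fundUnit (p * q) : ℂ),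
      (sqrtUnits (p * q) (2 * p * q) : ℂ), (sqrtUnits (p * s) (2 * p * s) : ℂ),
      (sqrtUnits (q * s) (2 * q * s) : ℂ), (sqrtUnits (p * q) (p * s) : ℂ),
      (sqrtUnits (p * q) (q * s) : ℂ)} with hS
    have hη : InGen S (eta ℓ) := .of_mem (by simp [hS]) g0.1
    obtain ⟨N, hN, hwN⟩ := exists_pow_div_conj_eq_one hu
    have hwu := hu.div hu.conj
    have hcu : (starRingEnd ℂ) u ≠ 0 := hu.conj.1
    set w := u / (starRingEnd ℂ) u with hw
    have hw6 := pow_six_eq_one_of_mem_fieldL h hsf hodd hℓp hℓq hℓs hℓ1 hwu.2.1 hN hwN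
    have hwc : (starRingEnd ℂ) w = w⁻¹ := by
      rw [hw, map_div₀, Complex.conj_conj, inv_div]
    have huw : u = w * (starRingEnd ℂ) u := by rw [hw, div_mul_cancel₀ _ hcu]
    -- Multiplying u by w turns the quotient u/ū = w into w³, and w³ = ±1 because w⁶ = 1: the new
    -- unit is real or purely imaginary.
    have hconj : u * w = w ^ 3 * (starRingEnd ℂ) (u * w) := by
      rw [map_mul, hwc]
      have := hwu.1
      field_simp
      linear_combination huw
    have hwgen : InGen S w := by
      by_cases h3 : ℓ = 3
      · obtain ⟨i, -, hi⟩ := (isPrimitiveRoot_zeta (n := 6) (by norm_num)).eq_pow_of_pow_eq_one hw6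
        rw [← hi, ← zpow_natCast]
        rw [eta, if_pos h3] at hη
        exact hη.zpow i
      · rw [eta, if_neg h3] at hη
        have hw2 : w ^ 2 = 1 := by
          by_contra hne
          exact h3 (eq_three_of_cube_root_mem h hsf hodd hℓp hℓq hℓs (pow_mem hwu.2.1 2)
            (by rw [← pow_mul]; exact hw6) hne)
        rcases sq_eq_sq_iff_eq_or_eq_neg.1 (hw2.trans (one_pow 2).symm) with h1 | h1
        · rw [h1]; exact .one
        · rw [h1]; exact hη
    have hu' := hu.mul hwu
    have hreal : (starRingEnd ℂ) (u * w) = u * w := by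
      have h1 : (w ^ 3 - 1) * (w ^ 3 + 1) = 0 := by linear_combination hw6
      rcases mul_eq_zero.1 h1 with h2 | h2
      · rw [sub_eq_zero.1 h2, one_mul] at hconj
        exact hconj.symm
      · rw [eq_neg_of_add_eq_zero_left h2, neg_one_mul] at hconj
        exact absurd (neg_eq_iff_eq_neg.1 hconj.symm)
          (conj_ne_neg_of_isUnitIn h hsf hodd hℓp hℓq hℓs hℓ1 hu')
    obtain ⟨n, hn⟩ := exists_eta_pow_eq_neg_one ℓ
    have hgen : InGen S (u * w) := inGen_of_isUnitIn_fieldLplus h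
      (by rw [← hn, ← zpow_natCast]; exact hη.zpow n) (.of_mem (by simp [hS]) g1.1)
      (.of_mem (by simp [hS]) g2.1) (.of_mem (by simp [hS]) g3.1) (.of_mem (by simp [hS]) g4.1)
      (.of_mem (by simp [hS]) g5.1) (.of_mem (by simp [hS]) g6.1) (.of_mem (by simp [hS]) g7.1)
      (isUnitIn_fieldLplus_of_conj_eq hu' hreal)
    have := hgen.mul hwgen.inv
    rwa [mul_assoc, mul_inv_cancel₀ hwu.1, mul_one] at this
  · rintro z (rfl | rfl | rfl | rfl | rfl | rfl | rfl | rfl)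
    exacts [g0, g1.mono hle, g2.mono hle, g3.mono hle, g4.mono hle, g5.mono hle, g6.mono hle,
      g7.mono hle]

end NeOne

/-! ### The unit group of L for ℓ = 1 -/

section One

/-- Up to a power of `ζ₈`, a unit of `L` is real or has argument that of a square root of `ζ₈`. -/
theorem exists_zeta_eight_zpow_mul (h : PrimeTriple p q s) {u : ℂ}
    (hu : IsUnitIn (fieldL p q s 1) u) :
    (∃ (i : ℕ) (x : ℂ), IsUnitIn (fieldLplus p q s) x ∧ u = zeta 8 ^ i * x) ∨
    ∃ (i : ℕ) (x : ℂ), IsUnitIn (fieldL p q s 1) x ∧ x = zeta 8 * (starRingEnd ℂ) x ∧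
      u = zeta 8 ^ i * x := by
  obtain ⟨N, hN, hwN⟩ := exists_pow_div_conj_eq_one hu
  have hcu : (starRingEnd ℂ) u ≠ 0 := hu.conj.1
  have hwu := hu.div hu.conj
  have hw8 := pow_eight_eq_one_of_mem_fieldL h squarefree_one odd_one (Nat.coprime_one_left p)
    (Nat.coprime_one_left q) (Nat.coprime_one_left s) (by norm_num) hwu.2.1 hN hwN
  obtain ⟨j, -, hj⟩ := (isPrimitiveRoot_zeta (n := 8) (by norm_num)).eq_pow_of_pow_eq_one hw8
  rw [eq_div_iff hcu] at hj
  have hζ : ∀ i : ℕ, IsUnitIn (fieldL p q s 1) (zeta 8 ^ i) := fun i => isUnitIn_zeta_eight.pow i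
  have hz0 := zeta_ne_zero 8
  -- Dividing u by ζ₈^i divides u/ū = ζ₈^j by ζ₈^(2i), so only the parity of j matters.
  rcases Nat.even_or_odd' j with ⟨i, rfl | rfl⟩
  · left
    refine ⟨i, u / zeta 8 ^ i, isUnitIn_fieldLplus_of_conj_eq (hu.div (hζ i)) ?_, ?_⟩
    · rw [map_div₀, map_pow, conj_zeta, inv_pow, div_inv_eq_mul, eq_div_iff (pow_ne_zero i hz0)]
      linear_combination hj
    · field_simp
  · right
    refine ⟨i, u / zeta 8 ^ i, hu.div (hζ i), ?_, ?_⟩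
    · rw [map_div₀, map_pow, conj_zeta, inv_pow, div_inv_eq_mul, div_eq_iff (pow_ne_zero i hz0)]
      linear_combination -hj
    · field_simp

theorem mixedRoot_sq (h : PrimeTriple p q s) {b : ℕ} :
    mixedRoot p q s b ^ 2 = zeta 8 * unitMonomial p q s 0 (2 * b + 1) 1 0 0 1 1 := by
  have hA := rtUnit_ne_zero h.not_isSquare_pq
  rw [mixedRoot_sq_eq_mul, sqrtUnits_eq h.not_isSquare_pq, sqrtUnits_eq h.not_isSquare_qs,
    ← rtUnit_sq h.not_isSquare_pq]
  simp only [unitMonomial, zpow_add₀ hA, zpow_mul, zpow_natCast, zpow_ofNat]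
  ring

/-- β² = ζ₈r with r > 0, so β·β̄ = r and β² = ζ₈·β·β̄. The choice of square root plays no part. -/
theorem mixedRoot_conj (h : PrimeTriple p q s) {b : ℕ} :
    mixedRoot p q s b = zeta 8 * (starRingEnd ℂ) (mixedRoot p q s b) := by
  obtain ⟨r, hr, h1⟩ := unitMonomial_pos h 0 (2 * b + 1) 1 0 0 1 1
  have hsq := mixedRoot_sq h (b := b)
  rw [h1] at hsq
  set β := mixedRoot p q s b
  have hz0 := zeta_ne_zero 8
  have hβ : β ≠ 0 := by
    rintro h0
    rw [h0] at hsq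
    have hr0 : (r : ℂ) ≠ 0 := by exact_mod_cast hr.ne'
    exact mul_ne_zero hz0 hr0 (by rw [← hsq]; simp)
  have hsq' := congrArg (starRingEnd ℂ) hsq
  rw [map_pow, map_mul, conj_zeta, Complex.conj_ofReal] at hsq'
  have hn : (β * (starRingEnd ℂ) β) ^ 2 = (r : ℂ) ^ 2 := by
    rw [mul_pow, hsq, hsq']; field_simp
  have hn' : β * (starRingEnd ℂ) β = r := by
    rcases sq_eq_sq_iff_eq_or_eq_neg.1 hn with h2 | h2
    · exact h2
    · exfalso
      rw [Complex.mul_conj] at h2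
      have h3 : Complex.normSq β = -r := by exact_mod_cast h2
      linarith [Complex.normSq_nonneg β]
  apply mul_left_cancel₀ hβ
  rw [mul_left_comm, hn', ← hsq, sq]

/-- From u = ζ₈ū one gets u² = ζ₈·u·ū with u·ū a monomial. The parity conditions fix the exponents
modulo 2, so u is ±β_b up to a monomial in L⁺. -/
theorem exists_isUnitIn_mixedRoot (h : PrimeTriple p q s) {u : ℂ}
    (hu : IsUnitIn (fieldL p q s 1) u) (hconj : u = zeta 8 * (starRingEnd ℂ) u) :
    IsUnitIn (fieldL p q s 1) (mixedRoot p q s 0) ∨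
      IsUnitIn (fieldL p q s 1) (mixedRoot p q s 1) := by
  obtain ⟨f⟩ := h.nonempty_signFlips
  obtain ⟨a, A, B, C, D, E, F, hv⟩ := exists_mul_conj_eq_unitMonomial h hu
  have hz0 := zeta_ne_zero 8
  have hu2 : u ^ 2 = zeta 8 * unitMonomial p q s a A B C D E F := by
    rw [← hv]
    linear_combination u * hconj
  have hδ : ((2 + √2 : ℝ) : ℂ) = 2 + rt 2 := by rw [rt]; push_cast; rfl
  have hδ' : ((2 - √2 : ℝ) : ℂ) = 2 - rt 2 := by rw [rt]; push_cast; rfl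
  have hw : ((√2 : ℝ) : ℂ) = rt 2 := by rw [rt]; push_cast; rfl
  have hs2 : √2 ^ 2 = (2 : ℝ) := Real.sq_sqrt (by norm_num)
  have hs2' : (0 : ℝ) < √2 := Real.sqrt_pos.2 (by norm_num)
  have h2lt : √2 < 2 := by nlinarith
  have h20 : (2 + rt 2 : ℂ) ≠ 0 := by
    rw [← hδ]; exact_mod_cast (by positivity : (2 + √2 : ℝ) ≠ 0)
  have h10 : (1 + zeta 8) ≠ 0 := by
    intro h0
    have := one_add_zeta_eight_sq
    rw [h0] at this
    exact mul_ne_zero hz0 h20 (by rw [← this]; simp)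
  have hLr : rt 2 ∈ fieldL p q s 1 := fieldLplus_le_fieldL rt_two_mem
  -- 1 + ζ₈ satisfies the same relation z = ζ₈z̄ as u, so the quotient is real. The factor 2 + √2
  -- makes its square (2 + √2) times the monomial.
  have hX : u * (2 + rt 2) / (1 + zeta 8) ∈ fieldLplus p q s := by
    refine mem_fieldLplus_of_conj_eq (ℓ := 1) ?_ ?_
    · exact div_mem (mul_mem hu.2.1 (add_mem (ofNat_mem _ 2) hLr))
        (add_mem (one_mem _) isUnitIn_zeta_eight.2.1)
    · have hcu : (starRingEnd ℂ) u = u * (zeta 8)⁻¹ := by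
        rw [eq_mul_inv_iff_mul_eq₀ hz0, mul_comm]; exact hconj.symm
      have h2c : (starRingEnd ℂ) (2 : ℂ) = 2 := Complex.conj_ofNat 2
      rw [map_div₀, map_mul, map_add, map_add, map_one, h2c, conj_rt, conj_zeta, hcu]
      have : 1 + (zeta 8)⁻¹ = (1 + zeta 8) * (zeta 8)⁻¹ := by field_simp; ring
      rw [this]
      field_simp
  have hXY : (u * (2 + rt 2) / (1 + zeta 8)) ^ 2 =
      ((2 + √2 : ℝ) : ℂ) * unitMonomial p q s a A B C D E F := by
    rw [div_pow, mul_pow, hu2, one_add_zeta_eight_sq, hδ]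
    field_simp
  -- The norm of 2 + √2 is 2 = (√2)², and `f2` negates w = √2, so k = 1. This makes A, B, E, F odd
  -- instead of even.
  obtain ⟨h1, h2, h3, h4, h5, h6, h7⟩ := parity_of_sq_eq h f hX (δ := 2 + √2) (δ' := 2 - √2)
    (w := √2) (k := 1) (by positivity) (by linarith) (by linarith [hs2])
    (by rw [hδ, hδ']; simp [map_ofNat]; ring) (by rw [hδ]; simp [map_ofNat])
    (by rw [hδ]; simp [map_ofNat]) (by rw [hδ]; simp [map_ofNat]) (by rw [hw]; simp)
    (by rw [hw]; simp) (by rw [hw]; simp) (by rw [hw]; simp) hXY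
  have hev : Even a ∧ Odd A ∧ Odd B ∧ Even C ∧ Even D ∧ Odd E ∧ Odd F := by
    simp only [Int.even_iff, Int.odd_iff] at *; omega
  obtain ⟨⟨a, rfl⟩, ⟨A, rfl⟩, ⟨B, rfl⟩, ⟨C, rfl⟩, ⟨D, rfl⟩, ⟨E, rfl⟩, ⟨F, rfl⟩⟩ := hev
  -- Dividing u by the monomial with halved exponents leaves ±β₀ if that monomial lies in L⁺.
  -- Otherwise lowering the exponent of √ε_{pq} by one brings it into L⁺ and leaves ±β₁.
  have key : ∀ (b : ℕ), Even ((A - b) + B + C + D + E + F) →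
      IsUnitIn (fieldL p q s 1) (mixedRoot p q s b) := by
    intro b hb
    have hg := (isUnitIn_unitMonomial h (a := a) hb).mono (fieldLplus_le_fieldL (ℓ := 1))
    have hsq : (u / unitMonomial p q s a (A - b) B C D E F) ^ 2 = mixedRoot p q s b ^ 2 := by
      rw [div_pow, hu2, mixedRoot_sq h, div_eq_iff (pow_ne_zero 2 hg.1), ← unitMonomial_two_mul h,
        mul_assoc, unitMonomial_mul h]
      congr 2 <;> ring
    have hug := hu.div hg
    rcases sq_eq_sq_iff_eq_or_eq_neg.1 hsq with h8 | h8
    · rwa [← h8]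
    · rw [← neg_eq_iff_eq_neg.2 h8]; exact hug.neg
  rcases Int.even_or_odd (A + B + C + D + E + F) with he | ho
  · left
    exact key 0 (by simpa using he)
  · right
    apply key 1
    rw [Int.odd_iff] at ho
    rw [Int.even_iff]
    push_cast
    omega

/-- Any unit x with x = ζ₈x̄ differs from β_b by a real unit, that is, a unit of L⁺. The generator
√(ε_{qs}ε_{2qs}) of the latter can be dropped, since β_b² expresses it through the others. -/
theorem unitGroup_fieldL_one_of_mixedRoot (h : PrimeTriple p q s) {b : ℕ}
    (hβ : IsUnitIn (fieldL p q s 1) (mixedRoot p q s b)) : unitGroup (fieldL p q s 1) =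
    gen {zeta 8, (fundUnit 2 : ℂ), (fundUnit (p * q) : ℂ),
      (sqrtUnits (p * q) (2 * p * q) : ℂ), (sqrtUnits (p * s) (2 * p * s) : ℂ),
      (sqrtUnits (p * q) (p * s) : ℂ), (sqrtUnits (p * q) (q * s) : ℂ),
      mixedRoot p q s b} := by
  have hle : fieldLplus p q s ≤ fieldL p q s 1 := fieldLplus_le_fieldL
  have g0 : IsUnitIn (fieldL p q s 1) (zeta 8) := isUnitIn_zeta_eight
  have g1 := isUnitIn_fundUnit_two_fieldLplus (p := p) (q := q) (s := s)
  have g2 := isUnitIn_fundUnit_pq h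
  have g3 := isUnitIn_sqrtUnits_pq_two_pq h
  have g4 := isUnitIn_sqrtUnits_ps_two_ps h
  have g6 := isUnitIn_sqrtUnits_pq_ps h
  have g7 := isUnitIn_sqrtUnits_pq_qs h
  refine le_antisymm (unitGroup_le_gen fun u hu => ?_) (gen_le_unitGroup ?_)
  · set S : Set ℂ := {zeta 8, (fundUnit 2 : ℂ), (fundUnit (p * q) : ℂ),
      (sqrtUnits (p * q) (2 * p * q) : ℂ), (sqrtUnits (p * s) (2 * p * s) : ℂ),
      (sqrtUnits (p * q) (p * s) : ℂ), (sqrtUnits (p * q) (q * s) : ℂ),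
      mixedRoot p q s b} with hS
    have k0 : InGen S (zeta 8) := .of_mem (by simp [hS]) g0.1
    have k1 : InGen S (fundUnit 2) := .of_mem (by simp [hS]) g1.1
    have k2 : InGen S (fundUnit (p * q)) := .of_mem (by simp [hS]) g2.1
    have k3 : InGen S (sqrtUnits (p * q) (2 * p * q)) := .of_mem (by simp [hS]) g3.1
    have k4 : InGen S (sqrtUnits (p * s) (2 * p * s)) := .of_mem (by simp [hS]) g4.1
    have k6 : InGen S (sqrtUnits (p * q) (p * s)) := .of_mem (by simp [hS]) g6.1
    have k7 : InGen S (sqrtUnits (p * q) (q * s)) := .of_mem (by simp [hS]) g7.1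
    have k8 : InGen S (mixedRoot p q s b) := .of_mem (by simp [hS]) hβ.1
    have kneg : InGen S (-1) := by
      have := (isPrimitiveRoot_zeta (n := 8) (by norm_num)).pow_of_dvd (p := 4) (by norm_num)
        (by norm_num)
      rw [← (this.eq_neg_one_of_two_right : zeta 8 ^ 4 = -1), ← zpow_natCast]
      exact k0.zpow _
    have k5 : InGen S (sqrtUnits (q * s) (2 * q * s)) := by
      have h0 : zeta 8 * (fundUnit (p * q) : ℂ) ^ b * (sqrtUnits (p * q) (2 * p * q) : ℂ) ≠ 0 :=
        mul_ne_zero (mul_ne_zero g0.1 (pow_ne_zero _ g2.1)) g3.1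
      rw [(eq_inv_mul_iff_mul_eq₀ h0).2 (mixedRoot_sq_eq_mul p q s b).symm, ← zpow_natCast,
        ← zpow_natCast]
      exact ((k0.mul (k2.zpow _)).mul k3).inv.mul (k8.zpow _)
    have hplus : ∀ {x : ℂ}, IsUnitIn (fieldLplus p q s) x → InGen S x := fun hx =>
      inGen_of_isUnitIn_fieldLplus h kneg k1 k2 k3 k4 k5 k6 k7 hx
    have kz : ∀ i : ℕ, InGen S (zeta 8 ^ i) := fun i => by
      rw [← zpow_natCast]; exact k0.zpow i
    rcases exists_zeta_eight_zpow_mul h hu with ⟨i, x, hx, rfl⟩ | ⟨i, x, hx, hxc, rfl⟩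
    · exact (kz i).mul (hplus hx)
    · refine (kz i).mul ?_
      have hreal : (starRingEnd ℂ) (x / mixedRoot p q s b) = x / mixedRoot p q s b := by
        have hβc := mixedRoot_conj h (b := b)
        have hc0 := hβ.conj.1
        have hβ0 := hβ.1
        have hz0 := zeta_ne_zero 8
        rw [map_div₀, div_eq_div_iff hc0 hβ0]
        apply mul_left_cancel₀ hz0
        linear_combination (-(mixedRoot p q s b)) * hxc + x * hβc
      have := (hplus (isUnitIn_fieldLplus_of_conj_eq (hx.div hβ) hreal)).mul k8
      rwa [div_mul_cancel₀ _ hβ.1] at this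
  · rintro z (rfl | rfl | rfl | rfl | rfl | rfl | rfl | rfl)
    exacts [g0, g1.mono hle, g2.mono hle, g3.mono hle, g4.mono hle, g6.mono hle, g7.mono hle, hβ]

theorem unitGroup_fieldL_one_of_forall (h : PrimeTriple p q s)
    (hall : ¬ ∃ x : ℂ, IsUnitIn (fieldL p q s 1) x ∧ x = zeta 8 * (starRingEnd ℂ) x) :
    unitGroup (fieldL p q s 1) = gen {zeta 8} ⊔ unitGroup (fieldLplus p q s) := by
  apply le_antisymm
  · intro u hu
    rw [mem_unitGroup_iff_isUnitIn] at hu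
    rcases exists_zeta_eight_zpow_mul h hu with ⟨i, x, hx, hux⟩ | ⟨i, x, hx, hxc, -⟩
    · have : u = Units.mk0 (zeta 8) (zeta_ne_zero 8) ^ i * Units.mk0 x hx.1 := by
        apply Units.ext; simpa using hux
      rw [this]
      exact Subgroup.mul_mem_sup (pow_mem (mem_gen (by simp)) i)
        (mem_unitGroup_iff_isUnitIn.2 (by simpa using hx))
    · exact absurd ⟨x, hx, hxc⟩ hall
  · refine sup_le (gen_le_unitGroup ?_) fun u hu => ?_
    · rintro z rfl
      exact isUnitIn_zeta_eight
    · rw [mem_unitGroup_iff_isUnitIn] at hu ⊢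
      exact hu.mono fieldLplus_le_fieldL

end One

end MultiquadraticUnits

/-! ### Assembly -/

open MultiquadraticUnits in
theorem mainTheorem2 (p q s ℓ : ℕ) [Fact p.Prime] [Fact q.Prime] [Fact s.Prime]
    (hp : (p : ℤ) ≡ 5 [ZMOD 8]) (hs : -(s : ℤ) ≡ 5 [ZMOD 8]) (hq : (q : ℤ) ≡ 7 [ZMOD 8])
    (hpq : legendreSym q p = -1) (hps : legendreSym s p = -1) (hsq : legendreSym q s = -1)
    (hodd : Odd ℓ) (hsf : Squarefree ℓ)
    (hℓp : Nat.Coprime ℓ p) (hℓq : Nat.Coprime ℓ q) (hℓs : Nat.Coprime ℓ s) :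
    unitGroup (fieldLplus p q s) =
        gen {-1, (fundUnit 2 : ℂ), (fundUnit (p * q) : ℂ),
          (sqrtUnits (p * q) (2 * p * q) : ℂ), (sqrtUnits (p * s) (2 * p * s) : ℂ),
          (sqrtUnits (q * s) (2 * q * s) : ℂ), (sqrtUnits (p * q) (p * s) : ℂ),
          (sqrtUnits (p * q) (q * s) : ℂ)} ∧
    (ℓ = 1 →
      unitGroup (fieldL p q s ℓ) = gen {zeta 8} ⊔ unitGroup (fieldLplus p q s) ∨
      unitGroup (fieldL p q s ℓ) =
        gen {zeta 8, (fundUnit 2 : ℂ), (fundUnit (p * q) : ℂ),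
          (sqrtUnits (p * q) (2 * p * q) : ℂ), (sqrtUnits (p * s) (2 * p * s) : ℂ),
          (sqrtUnits (p * q) (p * s) : ℂ), (sqrtUnits (p * q) (q * s) : ℂ),
          mixedRoot p q s 1} ∨
      unitGroup (fieldL p q s ℓ) =
        gen {zeta 8, (fundUnit 2 : ℂ), (fundUnit (p * q) : ℂ),
          (sqrtUnits (p * q) (2 * p * q) : ℂ), (sqrtUnits (p * s) (2 * p * s) : ℂ),
          (sqrtUnits (p * q) (p * s) : ℂ), (sqrtUnits (p * q) (q * s) : ℂ),
          mixedRoot p q s 0} ∨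
      unitGroup (fieldL p q s ℓ) =
        gen {zeta 8, (fundUnit 2 : ℂ),
          (sqrtUnits (p * q) (2 * p * q) : ℂ), (sqrtUnits (p * s) (2 * p * s) : ℂ),
          (sqrtUnits (p * q) (p * s) : ℂ), (sqrtUnits (p * q) (q * s) : ℂ),
          mixedRoot p q s 0, mixedRoot p q s 1}) ∧
    (ℓ ≠ 1 →
      unitGroup (fieldL p q s ℓ) =
        gen {eta ℓ, (fundUnit 2 : ℂ), (fundUnit (p * q) : ℂ),
          (sqrtUnits (p * q) (2 * p * q) : ℂ), (sqrtUnits (p * s) (2 * p * s) : ℂ),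
          (sqrtUnits (q * s) (2 * q * s) : ℂ), (sqrtUnits (p * q) (p * s) : ℂ),
          (sqrtUnits (p * q) (q * s) : ℂ)}) := by
  have h : PrimeTriple p q s :=
    { p_mod := by rw [Int.ModEq] at hp; omega
      q_mod := by rw [Int.ModEq] at hq; omega
      s_mod := by rw [Int.ModEq] at hs; omega
      sym_q_p := hpq
      sym_s_p := hps
      sym_q_s := hsq }
  refine ⟨unitGroup_fieldLplus h, ?_, unitGroup_fieldL_of_ne_one h hsf hodd hℓp hℓq hℓs⟩
  rintro rfl
  -- The fourth group is not needed: one β_b in L already determines E_L. Both cannot lie in L,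
  -- since β₁/β₀ = ±√ε_{pq} is real and not in L⁺.
  by_cases hex : ∃ x : ℂ, IsUnitIn (fieldL p q s 1) x ∧ x = zeta 8 * (starRingEnd ℂ) x
  · obtain ⟨x, hx, hxc⟩ := hex
    rcases exists_isUnitIn_mixedRoot h hx hxc with hβ | hβ
    · exact Or.inr (Or.inr (Or.inl (unitGroup_fieldL_one_of_mixedRoot h hβ)))
    · exact Or.inr (Or.inl (unitGroup_fieldL_one_of_mixedRoot h hβ))
  · exact Or.inl (unitGroup_fieldL_one_of_forall h hex)
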